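/- Let $\mathcal K$ be the triangulated infinite cylinder with vertex set $\mathbb Z/3\times\mathbb Z$ whose simplices are the subsets of the triangles $\{(l,n),(l,n+1),(l+1,n+1)\}$ and $\{(l,n),(l+1,n+1),(l+1,n)\}$, $l\in\mathbb Z/3$, $n\in\mathbb Z$. For $q\in\{1,2\}$ let $K_q$ be the set of oriented $q$-simplices (sequences of $q+1$ distinct vertices spanning a simplex, modulo even permutations); write $[\tau]$ for the simplex underlying $\tau$. Two $q$-simplices are down neighbors if they intersect in a $(q-1)$-simplex; $E_q$ is the set of pairs $(\tau,\tau')\in K_q\times K_q$ with $[\tau],[\tau']$ down neighbors, and $\deg\tau$ is the number of (unoriented) $q$-simplices that are down neighbors of $[\tau]$. For $(\tau,\tau')\in E_q$ put $\eta(\tau,\tau')=\operatorname{sgn}(\tau,\mu)\operatorname{sgn}(\tau',\mu)$, where $\mu\in K_{q-1}$ is $[\tau]\cap[\tau']$ with any orientation and $\operatorname{sgn}(\langle a_0\cdots a_q\rangle,\langle a_0\cdots\widehat{a_j}\cdots a_q\rangle)=(-1)^j$. Define $$d_q:\ell^2(E_q)\to\ell^2(K_q),\quad (d_q g)(\tau)=\frac1{\sqrt{2\deg\tau}}\sum_{\tau':(\tau,\tau')\in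 E_q}g(\tau,\tau'),\qquad (S_q g)(\tau,\tau')=\eta(\tau,\tau')\,g(\tau',\tau),$$ the down-Grover walk $U_q^{\rm down}=S_q(2d_q^*d_q-I)$ on $\ell^2(E_q)$ and its discriminant $D_q^{\rm down}=d_qS_qd_q^*$ on $\ell^2(K_q)$ (complex Hilbert spaces). The continuous spectrum of a bounded operator $T$ is the set of those $\lambda$ in its spectrum that are not eigenvalues and for which $T-\lambda$ has dense range. Then the following hold. 1. $\operatorname{Spec}(D_2^{\rm down})=[-1,1]$; the continuous spectrum is $[-1,1]\setminus\{0\}$, and $0$ is the only eigenvalue. Moreover $\operatorname{Spec}(U_2^{\rm down})=S^1$; every point of $S^1\setminus\{\pm i,\pm1\}$ belongs to the continuous spectrum, and $\pm i$ are eigenvalues of $U_2^{\rm down}$. 2. $\operatorname{Spec}(D_1^{\rm down})=\{-\tfrac15,0\}\cup(-\tfrac15,\tfrac7{10}]$; the continuous spectrum is $(-\tfrac15,\tfrac7{10}]\setminus\{0\}$, and the eigenvalues are exactly $-\tfrac15$ and $0$. The eigenvalue $0$ is also a point of the continuous part in the sense that the range of $D_1^{\rm down}$ is not closed. Moreover,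 with $A=\{\lambda\in S^1:\operatorname{Re}\lambda\in\{-\tfrac15,0\}\cup(-\tfrac15,\tfrac7{10}]\}$, one has $A\subseteq\operatorname{Spec}(U_1^{\rm down})\subseteq A\cup\{1,-1\}$. A point $\lambda\in S^1$ belongs to the continuous spectrum of $U_1^{\rm down}$ if $\operatorname{Re}\lambda\in(-\tfrac15,\tfrac7{10}]\setminus\{0\}$, and is an eigenvalue if $\operatorname{Re}\lambda\in\{-\tfrac15,0\}$; for $\lambda=\pm i$ the range of $U_1^{\rm down}-\lambda$ is, in addition, not closed. -/

import Mathlib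

noncomputable section

namespace DownWalk

/-! ### Ordered and oriented simplices -/

section Simplices

/-- An ordered `q`-simplex of `K`: a sequence `(a_0, ..., a_q)` of distinct vertices whose
underlying set is a face of `K`. -/
structure OrderedSimplex {V : Type*} (K : AbstractSimplicialComplex V) (q : ℕ) where
  vertex : Fin (q + 1) → V
  injective : Function.Injective vertex
  mem : Finset.univ.map ⟨vertex, injective⟩ ∈ K.faces

namespace OrderedSimplex

/-- The underlying set of vertices of an ordered simplex. -/
def support {V : Type*} {K : AbstractSimplicialComplex V} {q : ℕ} (s : OrderedSimplex K q) :
    Finset V :=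
  Finset.univ.map ⟨s.vertex, s.injective⟩

theorem mem_support {V : Type*} {K : AbstractSimplicialComplex V} {q : ℕ}
    (s : OrderedSimplex K q) (v : V) : v ∈ s.support ↔ ∃ i, s.vertex i = v := by
  simp [support]

/-- The ordered simplex `(a_{π 0}, ..., a_{π q})`. -/
def perm {V : Type*} {K : AbstractSimplicialComplex V} {q : ℕ} (s : OrderedSimplex K q)
    (π : Equiv.Perm (Fin (q + 1))) : OrderedSimplex K q where
  vertex := s.vertex ∘ π
  injective := s.injective.comp π.injective
  mem := by
    have h : Finset.univ.map ⟨s.vertex ∘ π, s.injective.comp π.injective⟩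
        = Finset.univ.map ⟨s.vertex, s.injective⟩ := by
      ext v
      simp only [Finset.mem_map, Finset.mem_univ, true_and, Function.Embedding.coeFn_mk,
        Function.comp_apply]
      exact ⟨fun ⟨i, hi⟩ => ⟨π i, hi⟩, fun ⟨i, hi⟩ => ⟨π.symm i, by simpa using hi⟩⟩
    rw [h]
    exact s.mem

/-- The face `(a_0, ..., â_j, ..., a_{q+1})` of an ordered `(q+1)`-simplex. -/
def face {V : Type*} {K : AbstractSimplicialComplex V} {q : ℕ} (s : OrderedSimplex K (q + 1))
    (j : Fin (q + 2)) : OrderedSimplex K q where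
  vertex := s.vertex ∘ j.succAbove
  injective := s.injective.comp Fin.succAbove_right_injective
  mem := by
    refine (K.isRelLowerSet_faces s.mem).2 ?_ ?_
    · intro v hv
      simp only [Finset.mem_map, Finset.mem_univ, true_and, Function.Embedding.coeFn_mk,
        Function.comp_apply] at hv ⊢
      obtain ⟨i, hi⟩ := hv
      exact ⟨_, hi⟩
    · simp

theorem ext_vertex {V : Type*} {K : AbstractSimplicialComplex V} {q : ℕ}
    {s t : OrderedSimplex K q} (h : s.vertex = t.vertex) : s = t := by
  cases s; cases t; cases h; rfl

theorem support_perm {V : Type*} {K : AbstractSimplicialComplex V} {q : ℕ}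
    (s : OrderedSimplex K q) (π : Equiv.Perm (Fin (q + 1))) : (s.perm π).support = s.support := by
  ext v
  simp only [mem_support, perm, Function.comp_apply]
  exact ⟨fun ⟨i, hi⟩ => ⟨π i, hi⟩, fun ⟨i, hi⟩ => ⟨π.symm i, by simpa using hi⟩⟩

/-- Two ordered simplices define the same orientation if they differ by an even permutation. -/
instance setoid {V : Type*} (K : AbstractSimplicialComplex V) (q : ℕ) :
    Setoid (OrderedSimplex K q) where
  r s t := ∃ π : Equiv.Perm (Fin (q + 1)), Equiv.Perm.sign π = 1 ∧ t = s.perm π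
  iseqv :=
    { refl := fun s => ⟨1, by simp, ext_vertex rfl⟩
      symm := by
        rintro s _ ⟨π, hπ, rfl⟩
        refine ⟨π⁻¹, by simp [hπ], ext_vertex ?_⟩
        ext i
        simp [perm]
      trans := by
        rintro s _ _ ⟨π, hπ, rfl⟩ ⟨ρ, hρ, rfl⟩
        exact ⟨π * ρ, by simp [hπ, hρ], ext_vertex rfl⟩ }

end OrderedSimplex

/-- Oriented `q`-simplices: ordered `q`-simplices modulo the alternating group. -/
def OrientedSimplex {V : Type*} (K : AbstractSimplicialComplex V) (q : ℕ) : Type _ :=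
  Quotient (OrderedSimplex.setoid K q)

/-- The oriented simplex `⟨a_0 ... a_q⟩` represented by an ordered simplex. -/
def OrderedSimplex.oriented {V : Type*} {K : AbstractSimplicialComplex V} {q : ℕ}
    (s : OrderedSimplex K q) : OrientedSimplex K q :=
  Quotient.mk _ s

/-- The simplex (set of vertices) underlying an oriented simplex. -/
def OrientedSimplex.support {V : Type*} {K : AbstractSimplicialComplex V} {q : ℕ}
    (τ : OrientedSimplex K q) : Finset V :=
  Quotient.lift OrderedSimplex.support
    (by rintro s _ ⟨π, -, rfl⟩; exact (s.support_perm π).symm) τ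

theorem OrientedSimplex.exists_rep {V : Type*} {K : AbstractSimplicialComplex V} {q : ℕ}
    (τ : OrientedSimplex K q) : ∃ s : OrderedSimplex K q, s.oriented = τ :=
  Quotient.exists_rep τ

theorem OrderedSimplex.support_oriented {V : Type*} {K : AbstractSimplicialComplex V} {q : ℕ}
    (s : OrderedSimplex K q) : s.oriented.support = s.support := rfl

theorem OrientedSimplex.support_mem {V : Type*} {K : AbstractSimplicialComplex V} {q : ℕ}
    (τ : OrientedSimplex K q) : τ.support ∈ K.faces := by
  obtain ⟨s, rfl⟩ := τ.exists_rep
  exact s.mem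

theorem OrientedSimplex.card_support {V : Type*} {K : AbstractSimplicialComplex V} {q : ℕ}
    (τ : OrientedSimplex K q) : τ.support.card = q + 1 := by
  obtain ⟨s, rfl⟩ := τ.exists_rep
  simp [OrderedSimplex.support_oriented, OrderedSimplex.support]

theorem exists_oriented {V : Type*} {K : AbstractSimplicialComplex V} {q : ℕ} {F : Finset V}
    (hF : F ∈ K.faces) (hc : F.card = q + 1) : ∃ μ : OrientedSimplex K q, μ.support = F := by
  let e : Fin (q + 1) ≃ F := (F.equivFinOfCardEq hc).symm
  have hinj : Function.Injective (fun i => (e i : V)) :=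
    Subtype.val_injective.comp e.injective
  have himg : Finset.univ.map ⟨fun i => (e i : V), hinj⟩ = F := by
    ext v
    simp only [Finset.mem_map, Finset.mem_univ, true_and, Function.Embedding.coeFn_mk]
    constructor
    · rintro ⟨i, rfl⟩
      exact (e i).2
    · intro hv
      exact ⟨e.symm ⟨v, hv⟩, by simp⟩
  let s : OrderedSimplex K q := ⟨fun i => (e i : V), hinj, by rw [himg]; exact hF⟩
  exact ⟨s.oriented, himg⟩

open Classical in
/-- The signature `sgn(σ, τ)`: it is `(-1)^j` if `σ = ⟨a_0 ... a_{q+1}⟩` and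
`τ = ⟨a_0 ... â_j ... a_{q+1}⟩`, and `0` if `τ` is not a face of `σ`. -/
def sgn {V : Type*} {K : AbstractSimplicialComplex V} {q : ℕ} (σ : OrientedSimplex K (q + 1))
    (τ : OrientedSimplex K q) : ℤ :=
  if ∃ (s : OrderedSimplex K (q + 1)) (j : Fin (q + 2)),
      s.oriented = σ ∧ (s.face j).oriented = τ ∧ Even (j : ℕ) then 1
  else if ∃ (s : OrderedSimplex K (q + 1)) (j : Fin (q + 2)),
      s.oriented = σ ∧ (s.face j).oriented = τ ∧ Odd (j : ℕ) then -1
  else 0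

theorem abs_sgn_le {V : Type*} {K : AbstractSimplicialComplex V} {q : ℕ}
    (σ : OrientedSimplex K (q + 1)) (τ : OrientedSimplex K q) : |sgn σ τ| ≤ 1 := by
  unfold sgn
  split_ifs <;> simp

/-- There are at most two orientations of a simplex of positive dimension. -/
theorem OrientedSimplex.eq_or_eq_or_eq {V : Type*} {K : AbstractSimplicialComplex V} {p : ℕ}
    (τ : OrientedSimplex K (p + 1)) :
    ∃ τ' : OrientedSimplex K (p + 1), ∀ ρ : OrientedSimplex K (p + 1),
      ρ.support = τ.support → ρ = τ ∨ ρ = τ' := by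
  obtain ⟨s, rfl⟩ := τ.exists_rep
  refine ⟨(s.perm (Equiv.swap 0 1)).oriented, fun ρ hρ => ?_⟩
  obtain ⟨t, rfl⟩ := ρ.exists_rep
  rw [OrderedSimplex.support_oriented, OrderedSimplex.support_oriented] at hρ
  have h : ∀ i, ∃ j, s.vertex j = t.vertex i := fun i => by
    rw [← OrderedSimplex.mem_support, ← hρ, OrderedSimplex.mem_support]
    exact ⟨i, rfl⟩
  choose f hf using h
  have hfi : Function.Injective f := fun i j hij => t.injective (by rw [← hf, ← hf, hij])
  let π : Equiv.Perm (Fin (p + 2)) :=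
    Equiv.ofBijective f (Finite.injective_iff_bijective.mp hfi)
  have ht : t = s.perm π := OrderedSimplex.ext_vertex (funext fun i => (hf i).symm)
  rcases Int.units_eq_one_or (Equiv.Perm.sign π) with h1 | h1
  · exact Or.inl (Quotient.sound (Setoid.symm ⟨π, h1, ht⟩))
  · refine Or.inr (Quotient.sound (Setoid.symm ⟨Equiv.swap 0 1 * π, ?_, ?_⟩))
    · rw [Equiv.Perm.sign_mul, h1, Equiv.Perm.sign_swap (by simp)]
      simp
    · rw [ht]
      refine OrderedSimplex.ext_vertex (funext fun i => ?_)
      simp [OrderedSimplex.perm]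

end Simplices

/-! ### The down graph `Y_q` (here `q = p + 1 ≥ 1`) -/

section DownGraph

/-- Two sets of vertices (to be used for `(p+1)`-dimensional simplices) are down neighbors if their
intersection is a `p`-dimensional simplex. -/
def DownNeighbor {V : Type*} [DecidableEq V] (K : AbstractSimplicialComplex V) (p : ℕ)
    (F G : Finset V) : Prop :=
  F ∩ G ∈ K.faces ∧ (F ∩ G).card = p + 1

theorem DownNeighbor.symm {V : Type*} [DecidableEq V] {K : AbstractSimplicialComplex V} {p : ℕ}
    {F G : Finset V} (h : DownNeighbor K p F G) : DownNeighbor K p G F := by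
  rwa [DownNeighbor, Finset.inter_comm]

/-- Down neighbors have different underlying simplices; in particular they are
different, and they are not opposite orientations of the same simplex. -/
theorem DownNeighbor.support_ne {V : Type*} [DecidableEq V] {K : AbstractSimplicialComplex V}
    {p : ℕ} {τ₁ τ₂ : OrientedSimplex K (p + 1)} (h : DownNeighbor K p τ₁.support τ₂.support) :
    τ₁.support ≠ τ₂.support := by
  intro he
  have h2 := h.2
  rw [he, Finset.inter_self, τ₂.card_support] at h2
  omega

/-- The oriented edges of the down graph `Y_{p+1}`, whose vertices are the oriented
`(p+1)`-simplices. -/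
def DownEdge {V : Type*} [DecidableEq V] (K : AbstractSimplicialComplex V) (p : ℕ) : Type _ :=
  {e : OrientedSimplex K (p + 1) × OrientedSimplex K (p + 1) //
    DownNeighbor K p e.1.support e.2.support}

/-- The edge with the opposite direction. -/
def DownEdge.rev {V : Type*} [DecidableEq V] {K : AbstractSimplicialComplex V} {p : ℕ}
    (e : DownEdge K p) : DownEdge K p :=
  ⟨(e.1.2, e.1.1), e.2.symm⟩

/-- The number of (unoriented) simplices that are down neighbors of `τ`. -/
def downDegree {V : Type*} [DecidableEq V] (K : AbstractSimplicialComplex V) (p : ℕ)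
    (τ : OrientedSimplex K (p + 1)) : ℕ :=
  {G : Finset V | G ∈ K.faces ∧ G.card = p + 2 ∧ DownNeighbor K p τ.support G}.ncard

/-- An orientation of the common `p`-dimensional face of two down neighbors. -/
def DownEdge.common {V : Type*} [DecidableEq V] {K : AbstractSimplicialComplex V} {p : ℕ}
    (e : DownEdge K p) : OrientedSimplex K p :=
  Classical.choose (exists_oriented e.2.1 e.2.2)

/-- `η(τ₁, τ₂) = sgn(τ₁, μ) sgn(τ₂, μ)`, where `μ` is the common face of `τ₁` and `τ₂` with either
orientation. -/
def eta {V : Type*} [DecidableEq V] {K : AbstractSimplicialComplex V} {p : ℕ}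
    (e : DownEdge K p) : ℤ :=
  sgn e.1.1 e.common * sgn e.1.2 e.common

theorem norm_eta_le {V : Type*} [DecidableEq V] {K : AbstractSimplicialComplex V} {p : ℕ}
    (e : DownEdge K p) : ‖((eta e : ℤ) : ℂ)‖ ≤ 1 := by
  have h : |eta e| ≤ 1 := by
    rw [eta, abs_mul]
    exact mul_le_one₀ (abs_sgn_le _ _) (abs_nonneg _) (abs_sgn_le _ _)
  rw [Complex.norm_intCast]
  exact_mod_cast h

/-- The oriented simplices adjacent to `τ` in the down graph. -/
def AdjTo {V : Type*} [DecidableEq V] (K : AbstractSimplicialComplex V) (p : ℕ)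
    (τ : OrientedSimplex K (p + 1)) : Type _ :=
  {τ' : OrientedSimplex K (p + 1) // DownNeighbor K p τ.support τ'.support}

/-- The directed edge from `τ` to a neighbor of `τ`. -/
def AdjTo.edge {V : Type*} [DecidableEq V] {K : AbstractSimplicialComplex V} {p : ℕ}
    {τ : OrientedSimplex K (p + 1)} (x : AdjTo K p τ) : DownEdge K p :=
  ⟨(τ, x.1), x.2⟩

theorem finite_and_card_adjTo {V : Type*} [DecidableEq V] (K : AbstractSimplicialComplex V)
    (p : ℕ) (τ : OrientedSimplex K (p + 1)) (h : downDegree K p τ ≠ 0) :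
    Finite (AdjTo K p τ) ∧ Nat.card (AdjTo K p τ) ≤ 2 * downDegree K p τ := by
  classical
  set N : Set (Finset V) :=
    {G : Finset V | G ∈ K.faces ∧ G.card = p + 2 ∧ DownNeighbor K p τ.support G} with hN
  have hNf : N.Finite := Set.finite_of_ncard_ne_zero h
  set A : Set (OrientedSimplex K (p + 1)) := {τ' | DownNeighbor K p τ.support τ'.support} with hA
  have hmaps : ∀ ρ ∈ A, ρ.support ∈ N := fun ρ hρ => ⟨ρ.support_mem, ρ.card_support, hρ⟩
  have hfib : ∀ G : Finset V, ∃ a b : OrientedSimplex K (p + 1), ∀ ρ ∈ A, ρ.support = G →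
      ρ = a ∨ ρ = b := by
    intro G
    by_cases hG : ∃ ρ : OrientedSimplex K (p + 1), ρ.support = G
    · obtain ⟨a, ha⟩ := hG
      obtain ⟨b, hb⟩ := a.eq_or_eq_or_eq
      exact ⟨a, b, fun ρ _ hρ => hb ρ (hρ.trans ha.symm)⟩
    · exact ⟨τ, τ, fun ρ _ hρ => (hG ⟨ρ, hρ⟩).elim⟩
  have hAf : A.Finite := by
    refine Set.Finite.of_finite_fibers OrientedSimplex.support
      (hNf.subset (by rintro _ ⟨ρ, hρ, rfl⟩; exact hmaps ρ hρ)) ?_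
    intro G _
    obtain ⟨a, b, hab⟩ := hfib G
    refine (Set.toFinite {a, b}).subset ?_
    rintro ρ ⟨hρ, hρG⟩
    simpa using hab ρ hρ hρG
  refine ⟨hAf, ?_⟩
  have hcard : Nat.card (AdjTo K p τ) = hAf.toFinset.card := by
    have h1 : Nat.card (AdjTo K p τ) = A.ncard := Nat.card_coe_set_eq A
    rw [h1, Set.ncard_eq_toFinset_card A hAf]
  have hdeg : downDegree K p τ = hNf.toFinset.card := Set.ncard_eq_toFinset_card N hNf
  rw [hcard, hdeg]
  refine Finset.card_le_mul_card_image_of_maps_to (f := OrientedSimplex.support) ?_ 2 ?_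
  · intro ρ hρ
    simpa using hmaps ρ (by simpa using hρ)
  · intro G _
    obtain ⟨a, b, hab⟩ := hfib G
    refine (Finset.card_le_card (t := {a, b}) ?_).trans Finset.card_le_two
    intro ρ hρ
    simp only [Finset.mem_filter, Set.Finite.mem_toFinset] at hρ
    simpa using hab ρ hρ.1 hρ.2

end DownGraph

/-! ### The down-Grover walk and its discriminant -/

section Operators

/-- The Hilbert space `ℓ²(X)` of square summable functions `X → ℂ`. -/
abbrev EllTwo (X : Type*) : Type _ := lp (fun _ : X => ℂ) 2

theorem EllTwo.summable {X : Type*} (g : EllTwo X) : Summable fun x => ‖g x‖ ^ 2 := by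
  have h := (lp.memℓp g).summable (by norm_num)
  simpa using h

theorem EllTwo.norm_sq {X : Type*} (g : EllTwo X) : ‖g‖ ^ 2 = ∑' x, ‖g x‖ ^ 2 := by
  have h := lp.norm_rpow_eq_tsum (p := 2) (by norm_num) g
  simpa using h

/-- A linear map given by a pointwise formula which does not increase the `ℓ²`-norm, as
a bounded operator between `ℓ²`-spaces. -/
def mkContraction {X Y : Type*} (T : EllTwo X → Y → ℂ)
    (hadd : ∀ f g, T (f + g) = T f + T g) (hsmul : ∀ (c : ℂ) f, T (c • f) = c • T f)
    (hle : ∀ f (s : Finset Y), ∑ y ∈ s, ‖T f y‖ ^ 2 ≤ ‖f‖ ^ 2) : EllTwo X →L[ℂ] EllTwo Y :=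
  LinearMap.mkContinuous
    { toFun := fun f => ⟨T f, memℓp_gen' (C := ‖f‖ ^ 2) (by simpa using hle f)⟩
      map_add' := fun f g => lp.ext (hadd f g)
      map_smul' := fun c f => lp.ext (hsmul c f) } 1 (by
    intro f
    rw [one_mul]
    refine (sq_le_sq₀ (norm_nonneg _) (norm_nonneg f)).mp ?_
    rw [EllTwo.norm_sq]
    exact Real.tsum_le_of_sum_le (fun _ => by positivity) (hle f))

/-- The operator `d : ℓ²(E(Y_{p+1})) → ℓ²(K_{p+1})`,
`(d g)(τ) = (2 deg τ)^{-1/2} ∑_{τ'} g(τ, τ')`, the sum being over the neighbors of `τ`. -/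
def boundaryFun {V : Type*} [DecidableEq V] (K : AbstractSimplicialComplex V) (p : ℕ)
    (g : EllTwo (DownEdge K p)) (τ : OrientedSimplex K (p + 1)) : ℂ :=
  ((1 / Real.sqrt (2 * downDegree K p τ) : ℝ) : ℂ) *
    ∑' τ' : AdjTo K p τ, g τ'.edge

theorem norm_boundaryFun_sq_le {V : Type*} [DecidableEq V] (K : AbstractSimplicialComplex V)
    (p : ℕ) (g : EllTwo (DownEdge K p)) (τ : OrientedSimplex K (p + 1)) :
    ‖boundaryFun K p g τ‖ ^ 2 ≤ ∑' τ' : AdjTo K p τ, ‖g τ'.edge‖ ^ 2 := by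
  by_cases h : downDegree K p τ = 0
  · rw [boundaryFun, h]
    simpa using tsum_nonneg fun _ => by positivity
  · obtain ⟨hfin, hcard⟩ := finite_and_card_adjTo K p τ h
    have : Fintype (AdjTo K p τ) := Fintype.ofFinite _
    rw [boundaryFun, tsum_fintype, tsum_fintype, norm_mul, mul_pow, Complex.norm_real,
      Real.norm_eq_abs, sq_abs, div_pow, one_pow, Real.sq_sqrt (by positivity)]
    have hd : (0 : ℝ) < 2 * downDegree K p τ := by positivity
    rw [Nat.card_eq_fintype_card] at hcard
    have hc : (Fintype.card (AdjTo K p τ) : ℝ) ≤ 2 * downDegree K p τ := by exact_mod_cast hcard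
    rw [one_div, inv_mul_le_iff₀ hd]
    calc ‖∑ τ' : AdjTo K p τ, g τ'.edge‖ ^ 2
        ≤ (∑ τ' : AdjTo K p τ, ‖g τ'.edge‖) ^ 2 := by
          gcongr
          exact norm_sum_le _ _
      _ ≤ Fintype.card (AdjTo K p τ) * ∑ τ' : AdjTo K p τ, ‖g τ'.edge‖ ^ 2 :=
          sq_sum_le_card_mul_sum_sq
      _ ≤ _ := by gcongr

theorem sum_norm_boundaryFun_sq_le {V : Type*} [DecidableEq V] (K : AbstractSimplicialComplex V)
    (p : ℕ) (g : EllTwo (DownEdge K p)) (s : Finset (OrientedSimplex K (p + 1))) :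
    ∑ τ ∈ s, ‖boundaryFun K p g τ‖ ^ 2 ≤ ‖g‖ ^ 2 := by
  let e : (Σ τ : OrientedSimplex K (p + 1), AdjTo K p τ) ≃ DownEdge K p :=
    { toFun := fun x => ⟨(x.1, x.2.1), x.2.2⟩
      invFun := fun y => ⟨y.1.1, ⟨y.1.2, y.2⟩⟩
      left_inv := fun _ => rfl
      right_inv := fun _ => rfl }
  have hs : Summable fun x => ‖g (e x)‖ ^ 2 := e.summable_iff.mpr (EllTwo.summable g)
  have ht : ‖g‖ ^ 2 = ∑' τ, ∑' τ' : AdjTo K p τ, ‖g τ'.edge‖ ^ 2 := by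
    rw [EllTwo.norm_sq, ← e.tsum_eq, hs.tsum_sigma]
    rfl
  rw [ht]
  refine (Finset.sum_le_sum fun τ _ => norm_boundaryFun_sq_le K p g τ).trans ?_
  exact hs.sigma.sum_le_tsum s fun _ _ => tsum_nonneg fun _ => by positivity

/-- The operator `d : ℓ²(E(Y_{p+1})) → ℓ²(K_{p+1})` as a bounded operator. -/
def boundaryOp {V : Type*} [DecidableEq V] (K : AbstractSimplicialComplex V) (p : ℕ) :
    EllTwo (DownEdge K p) →L[ℂ] EllTwo (OrientedSimplex K (p + 1)) :=
  mkContraction (boundaryFun K p)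
    (by
      intro f g
      funext τ
      by_cases h : downDegree K p τ = 0
      · simp [boundaryFun, h]
      · have := (finite_and_card_adjTo K p τ h).1
        have : Fintype (AdjTo K p τ) := Fintype.ofFinite _
        have hfg : ∀ e, (f + g) e = f e + g e := fun _ => rfl
        simp only [boundaryFun, tsum_fintype, Pi.add_apply, hfg,
          Finset.sum_add_distrib, mul_add])
    (by
      intro c f
      funext τ
      have hcf : ∀ e, (c • f) e = c * f e := fun _ => rfl
      simp only [boundaryFun, hcf, Pi.smul_apply, smul_eq_mul, tsum_mul_left]
      ring)
    (sum_norm_boundaryFun_sq_le K p)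

/-- The shift operator `S` on `ℓ²(E(Y_{p+1}))`, `(S g)(τ₁, τ₂) = η(τ₁, τ₂) g(τ₂, τ₁)`. -/
def shiftOp {V : Type*} [DecidableEq V] (K : AbstractSimplicialComplex V) (p : ℕ) :
    EllTwo (DownEdge K p) →L[ℂ] EllTwo (DownEdge K p) :=
  mkContraction (fun g e => ((eta e : ℤ) : ℂ) * g e.rev)
    (by intro f g; funext e; simp [mul_add])
    (by intro c f; funext e; simp; ring)
    (by
      intro g s
      let r : DownEdge K p ≃ DownEdge K p :=
        { toFun := DownEdge.rev
          invFun := DownEdge.rev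
          left_inv := fun _ => rfl
          right_inv := fun _ => rfl }
      have hs : Summable fun e => ‖g (r e)‖ ^ 2 := r.summable_iff.mpr (EllTwo.summable g)
      rw [EllTwo.norm_sq, ← r.tsum_eq]
      refine (Finset.sum_le_sum fun e _ => ?_).trans
        (hs.sum_le_tsum s fun _ _ => by positivity)
      rw [norm_mul, mul_pow]
      exact mul_le_of_le_one_left (by positivity)
        (pow_le_one₀ (norm_nonneg _) (norm_eta_le e)))

/-- The down-Grover walk `U_{p+1}^down = S (2 d* d - I)` on `ℓ²(E(Y_{p+1}))`. -/
def downGroverWalk {V : Type*} [DecidableEq V] (K : AbstractSimplicialComplex V) (p : ℕ) :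
    EllTwo (DownEdge K p) →L[ℂ] EllTwo (DownEdge K p) :=
  shiftOp K p * ((2 : ℂ) • ((boundaryOp K p).adjoint ∘L boundaryOp K p) - 1)

/-- The down-discriminant `D_{p+1}^down = d S d*` on `ℓ²(K_{p+1})`. -/
def downDiscriminant {V : Type*} [DecidableEq V] (K : AbstractSimplicialComplex V) (p : ℕ) :
    EllTwo (OrientedSimplex K (p + 1)) →L[ℂ] EllTwo (OrientedSimplex K (p + 1)) :=
  boundaryOp K p ∘L shiftOp K p ∘L (boundaryOp K p).adjoint

end Operators

/-! ### Parts of the spectrum -/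

section Spectrum

/-- The point spectrum: the set of eigenvalues. -/
def pointSpectrum {H : Type*} [NormedAddCommGroup H] [NormedSpace ℂ H] (T : H →L[ℂ] H) : Set ℂ :=
  {z | Module.End.HasEigenvalue (T : H →ₗ[ℂ] H) z}

/-- The continuous spectrum: the spectral values `z`, not eigenvalues, for which
`T - z` has dense range. -/
def continuousSpectrum {H : Type*} [NormedAddCommGroup H] [NormedSpace ℂ H] (T : H →L[ℂ] H) :
    Set ℂ :=
  {z | z ∈ spectrum ℂ T ∧ z ∉ pointSpectrum T ∧ DenseRange fun x => T x - z • x}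

end Spectrum

/-! ### The triangulated infinite cylinder -/

section Cylinder

/-- The triangle with vertices `(l, n)`, `(l, n + 1)`, `(l + 1, n + 1)`. -/
def rhoTriangle (l : ZMod 3) (n : ℤ) : Finset (ZMod 3 × ℤ) :=
  {(l, n), (l, n + 1), (l + 1, n + 1)}

/-- The triangle with vertices `(l, n)`, `(l + 1, n + 1)`, `(l + 1, n)`. -/
def sigmaTriangle (l : ZMod 3) (n : ℤ) : Finset (ZMod 3 × ℤ) :=
  {(l, n), (l + 1, n + 1), (l + 1, n)}

/-- The triangulation of the infinite cylinder with vertex set `ℤ/3 × ℤ` in which each square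
`(l, n)`, `(l + 1, n)`, `(l + 1, n + 1)`, `(l, n + 1)` is cut along the diagonal from `(l, n)` to
`(l + 1, n + 1)`: the simplices are the nonempty subsets of these triangles. -/
def cylinder : AbstractSimplicialComplex (ZMod 3 × ℤ) where
  faces := {F | F.Nonempty ∧ ∃ (l : ZMod 3) (n : ℤ), F ⊆ rhoTriangle l n ∨ F ⊆ sigmaTriangle l n}
  isRelLowerSet_faces := by
    rintro F ⟨hF, l, n, h⟩
    exact ⟨hF, fun G hG hne => ⟨hne, l, n, h.imp hG.trans hG.trans⟩⟩
  singleton_mem := by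
    rintro ⟨l, n⟩
    exact ⟨Finset.singleton_nonempty _, l, n, Or.inl (by simp [rhoTriangle])⟩

end Cylinder

end DownWalk

end

open DownWalk

noncomputable section

namespace DownWalk

open scoped InnerProductSpace
open Equiv.Perm (sign)

/-! ### Operators that are bounded below -/

section BoundedBelow

/-! Both discriminants reduce to one operator on ℓ²(ℤ/3 × ℤ), namely T = 1 + τ_(-1,0) + τ_(0,1)
(`triOp`). The Fourier transform turns TT* into multiplication by |1 + ζ⁻¹ + z|² with ζ³ = 1 and |z|
= 1. These values fill [0, 9], and truncated plane waves are approximate eigenvectors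
(`exists_approx_triOp`). There are no true eigenvectors: each ℤ/3-Fourier component of one would be
a decaying solution of a second-order recurrence on ℤ, hence zero (`eq_zero_of_triOp`).

The discriminant D vanishes on functions even under reversal of orientation, which gives the
eigenvalue 0. On odd functions over the triangles, D exchanges the two kinds of triangles through
-T/3 and -T*/3, so its spectral values are ±√x/3 with x in [0, 9]. On the edges, let ∂ be the
boundary map `vertexBoundary`. Then 20 D = ∂*∂ - 2(1 - flip) (`edgeDiscriminant_eq`) and ∂∂* = 2Δ
with Δ = 9 - TT*. So D acts as (Δ - 2)/10 on gradients, where it has no eigenvalues, and as -1/5 on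
odd cycles. The value 0 lies inside the gradient part, which is orthogonal to ker D; therefore the
range of D is not closed.

For the walks, d is a coisometry and S a self-adjoint involution, so U d* = S d* and U S d* = 2 S d*
D - d*. At a point z ≠ ±1 of the circle, z is a spectral value, or an eigenvalue, of U exactly when
Re z is one of D (`IsWalkPair.mem_spectrum_walkOp_iff`, `IsWalkPair.mem_pointSpectrum_walkOp_iff`).
All operators here are normal, so membership in the spectrum is a question about lower bounds for
norms. -/

/-- The operator `T` is bounded below. -/
def IsBoundedBelow {H H' : Type*} [NormedAddCommGroup H] [NormedSpace ℂ H]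
    [NormedAddCommGroup H'] [NormedSpace ℂ H'] (T : H →L[ℂ] H') : Prop :=
  ∃ c : ℝ, ∀ f, ‖f‖ ≤ c * ‖T f‖

variable {H : Type*} [NormedAddCommGroup H] [InnerProductSpace ℂ H]

theorem mem_pointSpectrum {T : H →L[ℂ] H} {z : ℂ} :
    z ∈ pointSpectrum T ↔ ∃ f, f ≠ 0 ∧ T f = z • f := by
  constructor
  · intro h
    obtain ⟨f, hf⟩ := Module.End.HasEigenvalue.exists_hasEigenvector h
    exact ⟨f, hf.2, hf.apply_eq_smul⟩
  · rintro ⟨f, hf, h⟩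
    exact Module.End.hasEigenvalue_of_hasEigenvector
      ⟨Module.End.mem_eigenspace_iff.mpr h, hf⟩

theorem pointSpectrum_subset_spectrum [CompleteSpace H] (T : H →L[ℂ] H) :
    pointSpectrum T ⊆ spectrum ℂ T := by
  intro z hz
  obtain ⟨f, hf, h⟩ := mem_pointSpectrum.mp hz
  rw [spectrum.mem_iff]
  intro hu
  rw [ContinuousLinearMap.isUnit_iff_bijective] at hu
  refine hf (hu.1 ?_)
  simp [Algebra.algebraMap_eq_smul_one, h]

theorem isStarNormal_sub_smul_one [CompleteSpace H] {T : H →L[ℂ] H} (hT : IsStarNormal T)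
    (z : ℂ) : IsStarNormal (T - z • (1 : H →L[ℂ] H)) := by
  constructor
  have h : star T * T = T * star T := hT.star_comm_self
  rw [commute_iff_eq, star_sub, star_smul, star_one]
  simp only [sub_mul, mul_sub, smul_mul_assoc, mul_smul_comm, one_mul, mul_one, h]
  rw [smul_sub, smul_sub, smul_comm z (star z)]
  abel

/-- For a normal operator the orthogonal complement of the range is the kernel, so a lower bound
already forces dense range and hence bijectivity. -/
theorem not_mem_spectrum_iff_isBoundedBelow [CompleteSpace H] {T : H →L[ℂ] H}
    (hT : IsStarNormal T) (z : ℂ) :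
    z ∉ spectrum ℂ T ↔ IsBoundedBelow (T - z • (1 : H →L[ℂ] H)) := by
  have hu : z ∉ spectrum ℂ T ↔ IsUnit (T - z • (1 : H →L[ℂ] H)) := by
    rw [spectrum.notMem_iff, ← IsUnit.neg_iff, neg_sub, Algebra.algebraMap_eq_smul_one]
  have hN := isStarNormal_sub_smul_one hT z
  rw [hu, ContinuousLinearMap.isUnit_iff_bijective,
    ContinuousLinearMap.bijective_iff_dense_range_and_antilipschitz]
  constructor
  · rintro ⟨-, K, hK⟩
    exact ⟨K, fun f => by simpa using hK.le_mul_dist f 0⟩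
  · rintro ⟨c, hc⟩
    refine ⟨?_, c.toNNReal, ?_⟩
    · rw [Submodule.topologicalClosure_eq_top_iff,
        ContinuousLinearMap.IsStarNormal.orthogonal_range hN, Submodule.eq_bot_iff]
      intro f hf
      have h0 : (T - z • (1 : H →L[ℂ] H)) f = 0 := hf
      have := hc f
      rw [h0, norm_zero, mul_zero] at this
      exact norm_le_zero_iff.mp this
    · refine AddMonoidHomClass.antilipschitz_of_bound _ fun f => (hc f).trans ?_
      gcongr
      exact Real.le_coe_toNNReal c

/-- Normal operators have no residual spectrum: a vector orthogonal to the range of T - z would be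
an eigenvector for z. -/
theorem continuousSpectrum_eq [CompleteSpace H] {T : H →L[ℂ] H} (hT : IsStarNormal T) :
    continuousSpectrum T = spectrum ℂ T \ pointSpectrum T := by
  ext z
  constructor
  · rintro ⟨h1, h2, -⟩
    exact ⟨h1, h2⟩
  · rintro ⟨h1, h2⟩
    refine ⟨h1, h2, ?_⟩
    have hN := isStarNormal_sub_smul_one hT z
    have hd : (T - z • (1 : H →L[ℂ] H)).range.topologicalClosure = ⊤ := by
      rw [Submodule.topologicalClosure_eq_top_iff,
        ContinuousLinearMap.IsStarNormal.orthogonal_range hN, Submodule.eq_bot_iff]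
      intro f hf
      by_contra hf0
      refine h2 (mem_pointSpectrum.mpr ⟨f, hf0, ?_⟩)
      have h0 : (T - z • (1 : H →L[ℂ] H)) f = 0 := hf
      simpa [sub_eq_zero] using h0
    have := Submodule.dense_iff_topologicalClosure_eq_top.mpr hd
    exact this

/-- An operator with closed range is bounded below on the orthogonal complement of its kernel. -/
theorem exists_bound_of_isClosed_range [CompleteSpace H] {T : H →L[ℂ] H}
    (h : IsClosed (Set.range T)) : ∃ c : ℝ, ∀ f ∈ T.kerᗮ, ‖f‖ ≤ c * ‖T f‖ := by
  have hcl : IsClosed (T.range : Set H) := h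
  have : CompleteSpace T.range := hcl.completeSpace_coe
  let T' : H →L[ℂ] T.range := T.codRestrict T.range fun x => ⟨x, rfl⟩
  have hs : Function.Surjective T' := by
    rintro ⟨_, x, rfl⟩
    exact ⟨x, rfl⟩
  -- Open mapping theorem onto the range, which is complete because it is closed.
  obtain ⟨c, -, hc⟩ := T'.exists_preimage_norm_le hs
  refine ⟨c, fun f hf => ?_⟩
  obtain ⟨x, hx, hxc⟩ := hc (T' f)
  have hx' : T x = T f := congrArg Subtype.val hx
  have hk : x - f ∈ T.ker := by
    change T (x - f) = 0
    rw [map_sub, hx', sub_self]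
  -- By Pythagoras, f is the shortest preimage of T f, so the bound for x passes to f.
  have ho : ⟪f, x - f⟫_ℂ = 0 := Submodule.inner_left_of_mem_orthogonal hk hf
  have hp := norm_add_sq_eq_norm_sq_add_norm_sq_of_inner_eq_zero f (x - f) ho
  rw [add_sub_cancel] at hp
  have hfx : ‖f‖ ≤ ‖x‖ := abs_le_of_sq_le_sq'
      (by nlinarith [sq_nonneg ‖x - f‖]) (norm_nonneg x) |>.2
  exact hfx.trans hxc

/-- A real number below (or above) the quadratic form of a self-adjoint operator is not in its
spectrum. -/
theorem isBoundedBelow_of_le_re_inner {T : H →L[ℂ] H} {c : ℝ} (hc : 0 < c)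
    (h : ∀ f, c * ‖f‖ ^ 2 ≤ |(⟪T f, f⟫_ℂ).re|) : IsBoundedBelow T := by
  refine ⟨c⁻¹, fun f => ?_⟩
  rcases eq_or_ne f 0 with rfl | hf
  · simp
  have hf' : 0 < ‖f‖ := norm_pos_iff.mpr hf
  have h1 : c * ‖f‖ ^ 2 ≤ ‖T f‖ * ‖f‖ :=
    (h f).trans ((Complex.abs_re_le_norm _).trans (norm_inner_le_norm _ _))
  rw [inv_mul_eq_div, le_div_iff₀ hc]
  have : (‖f‖ * c) * ‖f‖ ≤ ‖T f‖ * ‖f‖ := by nlinarith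
  exact le_of_mul_le_mul_right this hf'

end BoundedBelow

/-! ### Walks and their discriminants -/

section Walk

variable {H E : Type*} [NormedAddCommGroup H] [InnerProductSpace ℂ H] [CompleteSpace H]
  [NormedAddCommGroup E] [InnerProductSpace ℂ E] [CompleteSpace E]

/-- A coisometry `d` and a self-adjoint involution `S`. -/
structure IsWalkPair (d : E →L[ℂ] H) (S : E →L[ℂ] E) : Prop where
  coisometry : ∀ f, d (d.adjoint f) = f
  involutive : ∀ g, S (S g) = g
  selfAdjoint : S.adjoint = S

/-- The walk `S (2 d* d - 1)`. -/
def walkOp (d : E →L[ℂ] H) (S : E →L[ℂ] E) : E →L[ℂ] E :=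
  S * ((2 : ℂ) • (d.adjoint ∘L d) - 1)

/-- The discriminant `d S d*`. -/
def discriminantOp (d : E →L[ℂ] H) (S : E →L[ℂ] E) : H →L[ℂ] H :=
  d ∘L S ∘L d.adjoint

namespace IsWalkPair

variable {d : E →L[ℂ] H} {S : E →L[ℂ] E}

theorem walkOp_apply (d : E →L[ℂ] H) (S : E →L[ℂ] E) (g : E) :
    walkOp d S g = (2 : ℂ) • S (d.adjoint (d g)) - S g := by
  simp [walkOp]

theorem norm_shift (h : IsWalkPair d S) (g : E) : ‖S g‖ = ‖g‖ := by
  have h1 : ‖S g‖ ^ 2 = ‖g‖ ^ 2 := by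
    rw [← @inner_self_eq_norm_sq ℂ, ← @inner_self_eq_norm_sq ℂ,
      ← ContinuousLinearMap.adjoint_inner_right, h.selfAdjoint, h.involutive]
  exact (sq_eq_sq₀ (norm_nonneg _) (norm_nonneg _)).mp h1

theorem norm_adjoint (h : IsWalkPair d S) (f : H) : ‖d.adjoint f‖ = ‖f‖ := by
  have h1 : ‖d.adjoint f‖ ^ 2 = ‖f‖ ^ 2 := by
    rw [← @inner_self_eq_norm_sq ℂ, ← @inner_self_eq_norm_sq ℂ,
      ContinuousLinearMap.adjoint_inner_left, h.coisometry]
  exact (sq_eq_sq₀ (norm_nonneg _) (norm_nonneg _)).mp h1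

theorem norm_apply_le (h : IsWalkPair d S) (g : E) : ‖d g‖ ≤ ‖g‖ := by
  have h1 : ‖d g‖ ^ 2 ≤ ‖d g‖ * ‖g‖ := by
    rw [← @inner_self_eq_norm_sq ℂ, ← ContinuousLinearMap.adjoint_inner_left]
    exact (Complex.re_le_norm _).trans ((norm_inner_le_norm _ _).trans_eq (by rw [h.norm_adjoint]))
  rcases (norm_nonneg (d g)).eq_or_lt with h0 | h0
  · rw [← h0]; positivity
  · exact le_of_mul_le_mul_left (by rwa [← sq]) h0

theorem isSelfAdjoint_discriminantOp (h : IsWalkPair d S) : IsSelfAdjoint (discriminantOp d S) := by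
  rw [ContinuousLinearMap.isSelfAdjoint_iff', discriminantOp, ContinuousLinearMap.adjoint_comp,
    ContinuousLinearMap.adjoint_comp, h.selfAdjoint, ContinuousLinearMap.adjoint_adjoint]
  rfl

theorem norm_discriminantOp_le (h : IsWalkPair d S) : ‖discriminantOp d S‖ ≤ 1 := by
  refine ContinuousLinearMap.opNorm_le_bound _ zero_le_one fun f => ?_
  rw [one_mul]
  change ‖d (S (d.adjoint f))‖ ≤ ‖f‖
  refine (h.norm_apply_le _).trans ?_
  rw [h.norm_shift, h.norm_adjoint]

/-- Since d d* = 1, the operator d* d is a projection and 2 d* d - 1 a reflection; the walk is a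
product of two self-adjoint involutions. -/
theorem walkOp_mem_unitary (h : IsWalkPair d S) : walkOp d S ∈ unitary (E →L[ℂ] E) := by
  have hR : star ((2 : ℂ) • (d.adjoint ∘L d) - 1) = (2 : ℂ) • (d.adjoint ∘L d) - 1 := by
    simp [ContinuousLinearMap.star_eq_adjoint, ContinuousLinearMap.adjoint_comp]
  have hRR : ((2 : ℂ) • (d.adjoint ∘L d) - 1) * ((2 : ℂ) • (d.adjoint ∘L d) - 1) = 1 := by
    ext g
    simp only [mul_apply_eq_comp, _root_.sub_apply,
      _root_.smul_apply, ContinuousLinearMap.coe_comp, Function.comp_apply,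
      one_apply_eq_self, map_sub, map_smul, h.coisometry]
    module
  have hS : star S = S := h.selfAdjoint
  have hSS : S * S = 1 := by ext g; simp [h.involutive]
  rw [Unitary.mem_iff, walkOp, star_mul, hR, hS]
  constructor
  · rw [mul_assoc, ← mul_assoc S, hSS, one_mul, hRR]
  · rw [mul_assoc, ← mul_assoc _ _ S, hRR, one_mul, hSS]

theorem isStarNormal_walkOp (h : IsWalkPair d S) : IsStarNormal (walkOp d S) := by
  obtain ⟨h1, h2⟩ := Unitary.mem_iff.mp h.walkOp_mem_unitary
  exact ⟨by rw [commute_iff_eq, h1, h2]⟩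

/-- The map `f ↦ S d* f - (conj z) d* f`, which sends eigenvectors of the discriminant to
eigenvectors of the walk. -/
def lift (d : E →L[ℂ] H) (S : E →L[ℂ] E) (z : ℂ) (f : H) : E :=
  S (d.adjoint f) - (starRingEnd ℂ z) • d.adjoint f

/-- From U d* = S d* and U S d* = 2 S d* D - d*: the coefficient conj z of the lift makes the d* f
terms cancel, and z + conj z = 2 Re z collects the rest. -/
theorem walkOp_lift (h : IsWalkPair d S) {z : ℂ} (hz : ‖z‖ = 1) (f : H) :
    walkOp d S (lift d S z f) - z • lift d S z f
      = (2 : ℂ) • S (d.adjoint (discriminantOp d S f - ((z.re : ℝ) : ℂ) • f)) := by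
  have hzz : z * starRingEnd ℂ z = 1 := by rw [Complex.mul_conj', hz]; simp
  have hre : (2 : ℂ) * ((z.re : ℝ) : ℂ) = z + starRingEnd ℂ z := by
    rw [Complex.add_conj]; push_cast; ring
  rw [walkOp_apply]
  simp only [lift, discriminantOp, map_sub, map_smul, h.coisometry, h.involutive,
    ContinuousLinearMap.coe_comp, Function.comp_apply, smul_sub, smul_smul, hzz, hre]
  module

/-- Applying S + conj z to the lift returns d* f times 1 - (conj z)². This factor vanishes only at z
= ±1 on the circle, which is why those two points are exceptional. -/
theorem norm_le_norm_lift (h : IsWalkPair d S) {z : ℂ} (hz : ‖z‖ = 1) (f : H) :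
    ‖1 - (starRingEnd ℂ z) ^ 2‖ * ‖f‖ ≤ 2 * ‖lift d S z f‖ := by
  have h1 : S (lift d S z f) + (starRingEnd ℂ z) • lift d S z f
      = (1 - (starRingEnd ℂ z) ^ 2) • d.adjoint f := by
    simp only [lift, map_sub, map_smul, h.involutive]
    module
  rw [← h.norm_adjoint f, ← norm_smul, ← h1]
  refine (norm_add_le _ _).trans ?_
  rw [norm_smul, h.norm_shift, RCLike.norm_conj, hz]
  linarith

/-- With r = (U - z) g, the vectors d r and d (S r) determine (D - Re z)(d g), so the lower bound
for D controls d g. Then g + z S g = 2 d* d g - S r is controlled as well. -/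
theorem norm_le_of_walkOp (h : IsWalkPair d S) {z : ℂ} (hz : ‖z‖ = 1) {c : ℝ} (hc : 0 ≤ c)
    (hD : ∀ f, ‖f‖ ≤ c * ‖discriminantOp d S f - ((z.re : ℝ) : ℂ) • f‖) (g : E) :
    ‖1 - z ^ 2‖ * ‖g‖ ≤ 2 * (2 * c + 1) * ‖walkOp d S g - z • g‖ := by
  have hzz : z * starRingEnd ℂ z = 1 := by rw [Complex.mul_conj', hz]; simp
  have hre : (2 : ℂ) * ((z.re : ℝ) : ℂ) = z + starRingEnd ℂ z := by
    rw [Complex.add_conj]; push_cast; ring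
  set r := walkOp d S g - z • g with hr
  have hSr : S r = (2 : ℂ) • d.adjoint (d g) - g - z • S g := by
    rw [hr, walkOp_apply]
    simp only [map_sub, map_smul, h.involutive]
  have hdr : d r = (2 : ℂ) • discriminantOp d S (d g) - d (S g) - z • d g := by
    rw [hr, walkOp_apply]
    simp [discriminantOp]
  have hdSr : d (S r) = d g - z • d (S g) := by
    rw [hSr]
    simp only [map_sub, map_smul, h.coisometry]
    module
  have hdSg : d (S g) = (starRingEnd ℂ z) • (d g - d (S r)) := by
    rw [hdSr, sub_sub_cancel, smul_smul, mul_comm, hzz, one_smul]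
  have hf : (2 : ℂ) • (discriminantOp d S (d g) - ((z.re : ℝ) : ℂ) • d g)
      = d r - (starRingEnd ℂ z) • d (S r) := by
    rw [smul_sub, smul_smul, hre, hdr, hdSg]
    module
  have hfn : ‖discriminantOp d S (d g) - ((z.re : ℝ) : ℂ) • d g‖ ≤ ‖r‖ := by
    have h1 : ‖(2 : ℂ) • (discriminantOp d S (d g) - ((z.re : ℝ) : ℂ) • d g)‖ ≤ ‖r‖ + ‖r‖ := by
      rw [hf]
      refine (norm_sub_le _ _).trans (add_le_add (h.norm_apply_le _) ?_)
      rw [norm_smul, RCLike.norm_conj, hz, one_mul]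
      exact (h.norm_apply_le _).trans_eq (h.norm_shift _)
    rw [norm_smul, Complex.norm_ofNat] at h1
    linarith
  have hdg : ‖d g‖ ≤ c * ‖r‖ := (hD _).trans (by gcongr)
  have hw : ‖g + z • S g‖ ≤ (2 * c + 1) * ‖r‖ := by
    have h1 : g + z • S g = (2 : ℂ) • d.adjoint (d g) - S r := by rw [hSr]; abel
    rw [h1]
    refine (norm_sub_le _ _).trans ?_
    rw [norm_smul, Complex.norm_ofNat, h.norm_adjoint, h.norm_shift]
    linarith
  -- Because S² = 1, the operator 1 - z S undoes 1 + z S up to the scalar 1 - z².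
  have hg : (1 - z ^ 2) • g = (g + z • S g) - z • S (g + z • S g) := by
    simp only [map_add, map_smul, h.involutive]
    module
  rw [← norm_smul, hg]
  refine (norm_sub_le _ _).trans ?_
  rw [norm_smul, hz, one_mul, h.norm_shift]
  linarith

theorem one_sub_sq_ne_zero {z : ℂ} (h1 : z ≠ 1) (h2 : z ≠ -1) : 1 - z ^ 2 ≠ 0 := by
  intro h
  have : (1 - z) * (1 + z) = 0 := by linear_combination h
  rcases mul_eq_zero.mp this with h | h
  · exact h1 (by linear_combination -h)
  · exact h2 (by linear_combination h)

theorem one_sub_conj_sq_ne_zero {z : ℂ} (h1 : z ≠ 1) (h2 : z ≠ -1) :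
    1 - (starRingEnd ℂ z) ^ 2 ≠ 0 := by
  have := one_sub_sq_ne_zero h1 h2
  rw [← map_ne_zero (starRingEnd ℂ)] at this
  simpa using this

/-- A lower bound for U - z is tested on lifts to give one for D - Re z; the converse is
`norm_le_of_walkOp`. -/
theorem mem_spectrum_walkOp_iff (h : IsWalkPair d S) {z : ℂ} (hz : ‖z‖ = 1)
    (h1 : z ≠ 1) (h2 : z ≠ -1) :
    z ∈ spectrum ℂ (walkOp d S) ↔ ((z.re : ℝ) : ℂ) ∈ spectrum ℂ (discriminantOp d S) := by
  rw [← not_iff_not, not_mem_spectrum_iff_isBoundedBelow h.isStarNormal_walkOp,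
    not_mem_spectrum_iff_isBoundedBelow h.isSelfAdjoint_discriminantOp.isStarNormal]
  simp only [IsBoundedBelow, _root_.sub_apply, _root_.smul_apply,
    one_apply_eq_self]
  constructor
  · rintro ⟨c, hc⟩
    have hne := norm_pos_iff.mpr (one_sub_conj_sq_ne_zero h1 h2)
    refine ⟨4 * c / ‖1 - (starRingEnd ℂ z) ^ 2‖, fun f => ?_⟩
    have := h.norm_le_norm_lift hz f
    have h3 := hc (lift d S z f)
    rw [h.walkOp_lift hz, norm_smul, Complex.norm_ofNat, h.norm_shift, h.norm_adjoint] at h3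
    rw [div_mul_eq_mul_div, le_div_iff₀ hne]
    linarith
  · rintro ⟨c, hc⟩
    have hne := norm_pos_iff.mpr (one_sub_sq_ne_zero h1 h2)
    refine ⟨2 * (2 * |c| + 1) / ‖1 - z ^ 2‖, fun g => ?_⟩
    have := h.norm_le_of_walkOp hz (abs_nonneg c)
      (fun f => (hc f).trans (by gcongr; exact le_abs_self c)) g
    rw [div_mul_eq_mul_div, le_div_iff₀ hne]
    linarith

/-- The map d sends eigenvectors of the walk back to the discriminant. The other two relations show
that an eigenvector with d g = 0 forces z² = 1, and that d (S g) is a multiple of d g. -/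
theorem apply_eigenvector (h : IsWalkPair d S) {z : ℂ} (hz : ‖z‖ = 1)
    {g : E} (hg : walkOp d S g = z • g) :
    discriminantOp d S (d g) = ((z.re : ℝ) : ℂ) • d g ∧
      d (S g) = (starRingEnd ℂ z) • d g ∧ (2 : ℂ) • d.adjoint (d g) = g + z • S g := by
  have hzz : z * starRingEnd ℂ z = 1 := by rw [Complex.mul_conj', hz]; simp
  have hre : (2 : ℂ) * ((z.re : ℝ) : ℂ) = z + starRingEnd ℂ z := by
    rw [Complex.add_conj]; push_cast; ring
  rw [walkOp_apply] at hg
  have h1 : (2 : ℂ) • d.adjoint (d g) = g + z • S g := by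
    have := congrArg S hg
    simp only [map_sub, map_smul, h.involutive] at this
    rw [← this]; abel
  have h2 : d (S g) = (starRingEnd ℂ z) • d g := by
    have := congrArg d h1
    simp only [map_smul, map_add, h.coisometry] at this
    have h3 : d g = z • d (S g) := by
      rw [two_smul] at this
      exact add_left_cancel this
    rw [h3, smul_smul, mul_comm, hzz, one_smul]
  refine ⟨?_, h2, h1⟩
  have h3 := congrArg d hg
  simp only [map_sub, map_smul, h2] at h3
  have h4 : (2 : ℂ) • discriminantOp d S (d g) = (2 : ℂ) • ((z.re : ℝ) : ℂ) • d g := by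
    rw [smul_smul, hre, add_smul, ← h3]
    simp [discriminantOp]
  exact smul_right_injective _ two_ne_zero h4

theorem mem_pointSpectrum_walkOp_iff (h : IsWalkPair d S) {z : ℂ} (hz : ‖z‖ = 1)
    (h1 : z ≠ 1) (h2 : z ≠ -1) :
    z ∈ pointSpectrum (walkOp d S) ↔
      ((z.re : ℝ) : ℂ) ∈ pointSpectrum (discriminantOp d S) := by
  rw [mem_pointSpectrum, mem_pointSpectrum]
  constructor
  · rintro ⟨g, hg0, hg⟩
    obtain ⟨h3, -, h5⟩ := h.apply_eigenvector hz hg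
    refine ⟨d g, fun h0 => hg0 ?_, h3⟩
    rw [h0, map_zero, smul_zero] at h5
    have h6 : (1 - z ^ 2) • g = (g + z • S g) - z • S (g + z • S g) := by
      simp only [map_add, map_smul, h.involutive]
      module
    rw [← h5, map_zero, smul_zero, sub_zero, smul_eq_zero] at h6
    exact h6.resolve_left (one_sub_sq_ne_zero h1 h2)
  · rintro ⟨f, hf0, hf⟩
    refine ⟨lift d S z f, fun h0 => ?_, ?_⟩
    · have := h.norm_le_norm_lift hz f
      rw [h0, norm_zero, mul_zero] at this
      have hne := norm_pos_iff.mpr (one_sub_conj_sq_ne_zero h1 h2)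
      have hf' := norm_pos_iff.mpr hf0
      exact absurd this (not_le.mpr (mul_pos hne hf'))
    · rw [← sub_eq_zero, h.walkOp_lift hz, hf]
      simp

/-- If the discriminant, minus `Re z`, is not bounded below on the complement of its kernel, then
the range of the walk, minus `z`, is not closed. -/
theorem not_isClosed_range (h : IsWalkPair d S) {z : ℂ} (hz : ‖z‖ = 1) (h1 : z ≠ 1) (h2 : z ≠ -1)
    (hD : ∀ c : ℝ, ∃ f, (∀ k, discriminantOp d S k = ((z.re : ℝ) : ℂ) • k → ⟪k, f⟫_ℂ = 0) ∧
      c * ‖discriminantOp d S f - ((z.re : ℝ) : ℂ) • f‖ < ‖f‖) :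
    ¬ IsClosed (Set.range fun x => walkOp d S x - z • x) := by
  intro hcl
  have hcl' : IsClosed (Set.range (walkOp d S - z • (1 : E →L[ℂ] E))) := hcl
  obtain ⟨c, hc⟩ := exists_bound_of_isClosed_range hcl'
  have hne := norm_pos_iff.mpr (one_sub_conj_sq_ne_zero h1 h2)
  obtain ⟨f, hf, hlt⟩ := hD (4 * c / ‖1 - (starRingEnd ℂ z) ^ 2‖)
  -- For g in the kernel of U - z, both d g and d (S g) lie in the kernel of D - Re z, to which f is
  -- orthogonal.
  have hmem : lift d S z f ∈ (walkOp d S - z • (1 : E →L[ℂ] E)).kerᗮ := by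
    intro g hg
    have hg0 : (walkOp d S - z • (1 : E →L[ℂ] E)) g = 0 := hg
    have hg' : walkOp d S g = z • g := by simpa [sub_eq_zero] using hg0
    obtain ⟨h3, h4, -⟩ := h.apply_eigenvector hz hg'
    have h5 : ⟪S g, d.adjoint f⟫_ℂ = ⟪g, S (d.adjoint f)⟫_ℂ := by
      rw [← ContinuousLinearMap.adjoint_inner_right, h.selfAdjoint]
    rw [lift, inner_sub_right, ← h5, inner_smul_right,
      ContinuousLinearMap.adjoint_inner_right, ContinuousLinearMap.adjoint_inner_right, h4,
      inner_smul_left, hf _ h3]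
    simp
  have h3 := hc _ hmem
  simp only [_root_.sub_apply, _root_.smul_apply,
    one_apply_eq_self] at h3
  rw [h.walkOp_lift hz, norm_smul, Complex.norm_ofNat, h.norm_shift, h.norm_adjoint] at h3
  have h4 := h.norm_le_norm_lift hz f
  rw [div_mul_eq_mul_div, div_lt_iff₀ hne] at hlt
  linarith

end IsWalkPair

end Walk

/-! ### Pullback operators on `ℓ²` -/

section Pullback

/-- The pullback `ℓ²(Y) → ℓ²(X)` along an injective map `X → Y`. -/
def pullbackOp {X Y : Type*} (φ : X → Y) (hφ : Function.Injective φ) :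
    EllTwo Y →L[ℂ] EllTwo X :=
  mkContraction (fun f x => f (φ x)) (fun _ _ => rfl) (fun _ _ => rfl) (by
    intro f s
    rw [EllTwo.norm_sq]
    refine le_trans ?_ ((EllTwo.summable f).sum_le_tsum (s.map ⟨φ, hφ⟩) fun _ _ => by positivity)
    rw [Finset.sum_map]
    rfl)

@[simp]
theorem pullbackOp_apply {X Y : Type*} (φ : X → Y) (hφ : Function.Injective φ) (f : EllTwo Y)
    (x : X) : pullbackOp φ hφ f x = f (φ x) := rfl

theorem inner_pullbackOp_equiv {X Y : Type*} (φ : X ≃ Y) (f : EllTwo Y) (g : EllTwo X) :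
    ⟪pullbackOp φ φ.injective f, g⟫_ℂ = ⟪f, pullbackOp φ.symm φ.symm.injective g⟫_ℂ := by
  rw [lp.inner_eq_tsum, lp.inner_eq_tsum, ← φ.tsum_eq]
  simp

theorem adjoint_pullbackOp_equiv {X Y : Type*} (φ : X ≃ Y) :
    (pullbackOp φ φ.injective).adjoint = pullbackOp φ.symm φ.symm.injective :=
  ((ContinuousLinearMap.eq_adjoint_iff _ _).mpr fun f g => by
    rw [inner_pullbackOp_equiv, Equiv.symm_symm]).symm

theorem norm_pullbackOp_equiv {X Y : Type*} (φ : X ≃ Y) (f : EllTwo Y) :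
    ‖pullbackOp φ φ.injective f‖ = ‖f‖ := by
  have h1 : ‖pullbackOp φ φ.injective f‖ ^ 2 = ‖f‖ ^ 2 := by
    rw [EllTwo.norm_sq, EllTwo.norm_sq, ← φ.tsum_eq]
    rfl
  exact (sq_eq_sq₀ (norm_nonneg _) (norm_nonneg _)).mp h1

/-- The translation `(τ_h f)(g) = f (g + h)`. -/
def transOp {G : Type*} [AddCommGroup G] (h : G) : EllTwo G →L[ℂ] EllTwo G :=
  pullbackOp (Equiv.addRight h) (Equiv.addRight h).injective

@[simp]
theorem transOp_apply {G : Type*} [AddCommGroup G] (h : G) (f : EllTwo G) (g : G) :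
    transOp h f g = f (g + h) := rfl

theorem adjoint_transOp {G : Type*} [AddCommGroup G] (h : G) :
    (transOp h).adjoint = transOp (-h) := by
  rw [transOp, adjoint_pullbackOp_equiv]
  ext f g
  simp

theorem norm_transOp {G : Type*} [AddCommGroup G] (h : G) (f : EllTwo G) :
    ‖transOp h f‖ = ‖f‖ := norm_pullbackOp_equiv _ f

end Pullback

/-! ### Recurrences on `ℤ` -/

section Recurrence

open Filter Topology

/-- If |β| ≥ 1 the modulus does not decrease to the right, and if |β| ≤ 1 it does not decrease to
the left; decay at both ends excludes a nonzero value. -/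
theorem eq_zero_of_geometric {w : ℤ → ℂ} {β : ℂ} (hw : Tendsto w cofinite (𝓝 0))
    (h : ∀ n, w (n + 1) = β * w n) : w = 0 := by
  funext n
  have hn : Tendsto (fun k : ℕ => ‖w (n + k)‖) atTop (𝓝 0) := by
    have hinj : Function.Injective fun k : ℕ => n + (k : ℤ) := fun a b hab => by simpa using hab
    have := (hw.comp hinj.tendsto_cofinite).norm
    rwa [norm_zero, Nat.cofinite_eq_atTop] at this
  have hp : Tendsto (fun k : ℕ => ‖w (n - k)‖) atTop (𝓝 0) := by
    have hinj : Function.Injective fun k : ℕ => n - (k : ℤ) := fun a b hab => by simpa using hab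
    have := (hw.comp hinj.tendsto_cofinite).norm
    rwa [norm_zero, Nat.cofinite_eq_atTop] at this
  have key : ‖w n‖ ≤ 0 := by
    rcases le_total 1 ‖β‖ with hβ | hβ
    · refine ge_of_tendsto' hn fun k => ?_
      induction k with
      | zero => simp
      | succ k ih =>
        refine ih.trans ?_
        rw [Nat.cast_succ, ← add_assoc, h, norm_mul]
        exact le_mul_of_one_le_left (norm_nonneg _) hβ
    · refine ge_of_tendsto' hp fun k => ?_
      induction k with
      | zero => simp
      | succ k ih =>
        refine ih.trans ?_
        have h1 : n - (k : ℤ) = (n - ((k + 1 : ℕ) : ℤ)) + 1 := by push_cast; ring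
        rw [h1, h, norm_mul]
        exact mul_le_of_le_one_left (norm_nonneg _) hβ
  exact norm_le_zero_iff.mp key

theorem eq_zero_of_recurrence {v : ℤ → ℂ} {a b c : ℂ} (ha : a ≠ 0)
    (hv : Tendsto v cofinite (𝓝 0))
    (h : ∀ n, a * v (n + 1) + b * v n + c * v (n - 1) = 0) : v = 0 := by
  obtain ⟨s, hs⟩ := IsAlgClosed.exists_pow_nat_eq (discrim a b c) (n := 2) (by norm_num)
  obtain ⟨α, hα⟩ := exists_quadratic_eq_zero ha ⟨s, by rw [← hs, sq]⟩
  have hs1 : Tendsto (fun n => v (n + 1)) cofinite (𝓝 0) :=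
    hv.comp (add_left_injective (1 : ℤ)).tendsto_cofinite
  -- Factor the difference operator: α is one root of the characteristic polynomial and -b/a - α is
  -- the other.
  have hw : (fun n => v (n + 1) - α * v n) = 0 := by
    refine eq_zero_of_geometric (β := -b / a - α) ?_ fun n => ?_
    · simpa using hs1.sub (hv.const_mul α)
    · have h1 := h (n + 1)
      rw [add_sub_cancel_right] at h1
      field_simp
      linear_combination h1 - v n * hα
  refine eq_zero_of_geometric (β := α) hv fun n => ?_
  have := congrFun hw n
  simpa [sub_eq_zero] using this

end Recurrence

/-! ### The operators of the triangular lattice on the cylinder -/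

section Lattice

open Filter Topology

/-- The differences of adjacent vertices of the cylinder. -/
def adjVec : Finset (ZMod 3 × ℤ) := {(1, 0), (-1, 0), (0, 1), (0, -1), (1, 1), (-1, -1)}

theorem sum_adjVec {M : Type*} [AddCommMonoid M] (F : ZMod 3 × ℤ → M) :
    ∑ δ ∈ adjVec, F δ = F (1, 0) + (F (-1, 0) + (F (0, 1) + (F (0, -1) + (F (1, 1) +
      F (-1, -1))))) := by
  unfold adjVec
  rw [Finset.sum_insert (by decide), Finset.sum_insert (by decide), Finset.sum_insert (by decide),
    Finset.sum_insert (by decide), Finset.sum_insert (by decide), Finset.sum_singleton]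

theorem neg_mem_adjVec {δ : ZMod 3 × ℤ} (h : δ ∈ adjVec) : -δ ∈ adjVec := by
  revert δ
  unfold adjVec
  decide

/-- The operator `1 + τ_{(-1,0)} + τ_{(0,1)}`. -/
def triOp : EllTwo (ZMod 3 × ℤ) →L[ℂ] EllTwo (ZMod 3 × ℤ) :=
  1 + transOp (-1, 0) + transOp (0, 1)

theorem triOp_apply (v : EllTwo (ZMod 3 × ℤ)) (g : ZMod 3 × ℤ) :
    triOp v g = v g + v (g + (-1, 0)) + v (g + (0, 1)) := rfl

theorem adjoint_triOp : triOp.adjoint = 1 + transOp (1, 0) + transOp (0, -1) := by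
  rw [triOp, map_add, map_add, adjoint_transOp, adjoint_transOp,
    ContinuousLinearMap.adjoint_one]
  norm_num

theorem adjoint_triOp_apply (v : EllTwo (ZMod 3 × ℤ)) (g : ZMod 3 × ℤ) :
    triOp.adjoint v g = v g + v (g + (1, 0)) + v (g + (0, -1)) := by
  rw [adjoint_triOp]; rfl

/-- Expanding the product of three shifts with their inverses gives three identities and the six
neighbor shifts, so TT* is 3 plus the adjacency operator of the vertex graph. -/
theorem triOp_adjoint_apply (v : EllTwo (ZMod 3 × ℤ)) (g : ZMod 3 × ℤ) :
    triOp (triOp.adjoint v) g = 3 * v g + ∑ δ ∈ adjVec, v (g + δ) := by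
  rw [triOp_apply, sum_adjVec]
  simp only [adjoint_triOp_apply, add_assoc]
  have h0 : g + ((0, 0) : ZMod 3 × ℤ) = g := add_zero g
  simp only [Prod.mk_add_mk]
  norm_num [h0]
  ring

/-- The self-adjoint operator `9 - T T*`, the Laplacian of the graph of the cylinder. -/
def laplaceOp : EllTwo (ZMod 3 × ℤ) →L[ℂ] EllTwo (ZMod 3 × ℤ) :=
  (9 : ℂ) • 1 - triOp ∘L triOp.adjoint

theorem laplaceOp_eq (v : EllTwo (ZMod 3 × ℤ)) :
    laplaceOp v = (9 : ℂ) • v - triOp (triOp.adjoint v) := rfl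

theorem laplaceOp_apply (v : EllTwo (ZMod 3 × ℤ)) (g : ZMod 3 × ℤ) :
    laplaceOp v g = 6 * v g - ∑ δ ∈ adjVec, v (g + δ) := by
  have h : laplaceOp v g = 9 * v g - triOp (triOp.adjoint v) g := rfl
  rw [h, triOp_adjoint_apply]
  ring

/-- Positivity of TT* = 9 - Δ improves the bound 12 that holds for any 6-regular graph. -/
theorem re_inner_laplaceOp_le (v : EllTwo (ZMod 3 × ℤ)) :
    (⟪laplaceOp v, v⟫_ℂ).re ≤ 9 * ‖v‖ ^ 2 := by
  have h : ⟪triOp (triOp.adjoint v), v⟫_ℂ = (‖triOp.adjoint v‖ : ℂ) ^ 2 := by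
    rw [← ContinuousLinearMap.adjoint_inner_right, inner_self_eq_norm_sq_to_K]
    rfl
  rw [laplaceOp_eq, inner_sub_left, inner_smul_left, h, inner_self_eq_norm_sq_to_K]
  have h2 : ((starRingEnd ℂ 9 * (‖v‖ : ℂ) ^ 2 - (‖triOp.adjoint v‖ : ℂ) ^ 2)).re
      = 9 * ‖v‖ ^ 2 - ‖triOp.adjoint v‖ ^ 2 := by
    have : starRingEnd ℂ 9 = 9 := Complex.conj_ofNat 9
    rw [this]
    norm_cast
  refine le_trans (le_of_eq h2) ?_
  nlinarith [sq_nonneg ‖triOp.adjoint v‖]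

theorem tendsto_ellTwo {X : Type*} (v : EllTwo X) : Tendsto v cofinite (𝓝 0) := by
  have h := (EllTwo.summable v).tendsto_cofinite_zero
  rw [tendsto_zero_iff_norm_tendsto_zero]
  have h2 := h.sqrt
  simpa [Real.sqrt_sq (norm_nonneg _)] using h2

/-- The Fourier coefficients in the direction of `ℤ/3` of an eigenvector of `T T*` vanish. -/
theorem fourier_eq_zero {v : EllTwo (ZMod 3 × ℤ)} {x : ℂ}
    (h : triOp (triOp.adjoint v) = x • v) {ζ : ℂ} (hζ : ζ ^ 3 = 1) (n : ℤ) :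
    v (0, n) + ζ * v (1, n) + ζ ^ 2 * v (2, n) = 0 := by
  have hT : ∀ l : ZMod 3, Tendsto (fun n : ℤ => v (l, n)) cofinite (𝓝 0) := fun l =>
    (tendsto_ellTwo v).comp (Prod.mk_right_injective l).tendsto_cofinite
  have hv : (fun n : ℤ => v (0, n) + ζ * v (1, n) + ζ ^ 2 * v (2, n)) = 0 := by
    -- A shift by 1 in ℤ/3 multiplies the Fourier coefficient by ζ⁻¹ = ζ². The shifts (0, 1), (1, 1)
    -- give a; (0, -1), (-1, -1) give c; the horizontal shifts and the diagonal term give b.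
    refine eq_zero_of_recurrence (a := 1 + ζ ^ 2) (b := ζ + ζ ^ 2 + 3 - x) (c := 1 + ζ) ?_ ?_ ?_
    · intro h0
      have h1 : ζ = -1 := by linear_combination ζ * h0 - hζ
      rw [h1] at h0
      norm_num at h0
    · simpa using ((hT 0).add ((hT 1).const_mul ζ)).add ((hT 2).const_mul (ζ ^ 2))
    · intro n
      have h3 : ∀ l : ZMod 3, 3 * v (l, n) + ∑ δ ∈ adjVec, v ((l, n) + δ) = x * v (l, n) := by
        intro l
        rw [← triOp_adjoint_apply, h]
        rfl
      have e0 := h3 0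
      have e1 := h3 1
      have e2 := h3 2
      rw [sum_adjVec] at e0 e1 e2
      simp only [Prod.mk_add_mk, add_zero, ← sub_eq_add_neg, zero_add] at e0 e1 e2
      have a1 : (1 : ZMod 3) + 1 = 2 := by decide
      have a2 : (2 : ZMod 3) + 1 = 0 := by decide
      have a3 : (0 : ZMod 3) - 1 = 2 := by decide
      have a4 : (1 : ZMod 3) - 1 = 0 := by decide
      have a5 : (2 : ZMod 3) - 1 = 1 := by decide
      simp only [a1, a2, a3, a4, a5] at e0 e1 e2
      linear_combination e0 + ζ * e1 + ζ ^ 2 * e2 + (v (1, n) + ζ * v (2, n) + v (2, n) +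
        v (1, n + 1) + ζ * v (2, n + 1) + v (2, n - 1)) * hζ
  exact congrFun hv n

theorem exists_primitive_cube_root : ∃ ω : ℂ, ω ^ 2 + ω + 1 = 0 := by
  obtain ⟨s, hs⟩ := IsAlgClosed.exists_pow_nat_eq (discrim (1 : ℂ) 1 1) (n := 2) (by norm_num)
  obtain ⟨ω, hω⟩ := exists_quadratic_eq_zero (one_ne_zero (α := ℂ)) ⟨s, by rw [← hs, sq]⟩
  exact ⟨ω, by linear_combination hω⟩

theorem zmod_three_cases (l : ZMod 3) : l = 0 ∨ l = 1 ∨ l = 2 := by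
  revert l
  decide

/-- The operator `T T*` has no eigenvectors. -/
theorem eq_zero_of_triOp {v : EllTwo (ZMod 3 × ℤ)} {x : ℂ}
    (h : triOp (triOp.adjoint v) = x • v) : v = 0 := by
  obtain ⟨ω, hω⟩ := exists_primitive_cube_root
  have hω3 : ω ^ 3 = 1 := by linear_combination (ω - 1) * hω
  have hω6 : (ω ^ 2) ^ 3 = 1 := by linear_combination (ω ^ 3 + 1) * hω3
  ext ⟨l, n⟩
  change v (l, n) = 0
  have e0 := fourier_eq_zero h (one_pow 3) n
  have e1 := fourier_eq_zero h hω3 n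
  have e2 := fourier_eq_zero h hω6 n
  have h3 : (3 : ℂ) ≠ 0 := by norm_num
  -- Fourier inversion on ℤ/3: the three relations are added with weights 1, ω^(-l), ω^(-2l).
  rcases zmod_three_cases l with rfl | rfl | rfl
  · refine (mul_eq_zero.mp (?_ : 3 * v (0, n) = 0)).resolve_left h3
    linear_combination e0 + e1 + e2 - (v (1, n) + v (2, n) * (ω ^ 2 - ω + 1)) * hω
  · refine (mul_eq_zero.mp (?_ : 3 * v (1, n) = 0)).resolve_left h3
    linear_combination e0 + ω ^ 2 * e1 + ω * e2 - (v (0, n) + v (2, n)) * hω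
      - (2 * v (1, n) + (ω + ω ^ 2) * v (2, n)) * hω3
  · refine (mul_eq_zero.mp (?_ : 3 * v (2, n) = 0)).resolve_left h3
    linear_combination e0 + ω * e1 + ω ^ 2 * e2 - (v (0, n) + v (1, n)) * hω
      - (v (1, n) * ω + v (2, n) * (ω ^ 3 + 2)) * hω3

/-! #### Approximate eigenvectors -/

theorem norm_eq_one_of_cube {ζ : ℂ} (hζ : ζ ^ 3 = 1) : ‖ζ‖ = 1 := by
  have : ‖ζ‖ ^ 3 = 1 := by rw [← norm_pow, hζ, norm_one]
  exact (pow_eq_one_iff_of_nonneg (norm_nonneg _) three_ne_zero).mp this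

/-- The function `(l, 0) ↦ ζ ^ l`, extended by zero. -/
def layer (ζ : ℂ) : EllTwo (ZMod 3 × ℤ) :=
  lp.single 2 (0, 0) 1 + lp.single 2 (1, 0) ζ + lp.single 2 (2, 0) (ζ ^ 2)

theorem layer_apply (ζ : ℂ) (l : ZMod 3) (n : ℤ) :
    layer ζ (l, n) = if n = 0 then ζ ^ l.val else 0 := by
  have h : layer ζ (l, n) = lp.single (E := fun _ => ℂ) 2 ((0, 0) : ZMod 3 × ℤ) (1 : ℂ) (l, n) +
    lp.single (E := fun _ => ℂ) 2 ((1, 0) : ZMod 3 × ℤ) ζ (l, n) +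
    lp.single (E := fun _ => ℂ) 2 ((2, 0) : ZMod 3 × ℤ) (ζ ^ 2) (l, n) := rfl
  rw [h, lp.single_apply, lp.single_apply, lp.single_apply]
  by_cases hn : n = 0
  · subst hn
    have h02 : (0 : ZMod 3) ≠ 2 := by decide
    have h12 : (1 : ZMod 3) ≠ 2 := by decide
    have v1 : (1 : ZMod 3).val = 1 := rfl
    have v2 : (2 : ZMod 3).val = 2 := rfl
    rcases zmod_three_cases l with rfl | rfl | rfl <;>
      simp [h02, h12, h02.symm, h12.symm, v1, v2]
  · simp [hn]

theorem transOp_layer {ζ : ℂ} (hζ : ζ ^ 3 = 1) : transOp (1, 0) (layer ζ) = ζ • layer ζ := by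
  ext ⟨l, n⟩
  change layer ζ ((l, n) + (1, 0)) = ζ * layer ζ (l, n)
  rw [Prod.mk_add_mk, add_zero, layer_apply, layer_apply]
  split_ifs
  · rcases zmod_three_cases l with rfl | rfl | rfl
    · simp [show (1 : ZMod 3).val = 1 from rfl]
    · simp [show (1 + 1 : ZMod 3).val = 2 from rfl, show (1 : ZMod 3).val = 1 from rfl, sq]
    · simp [show (2 + 1 : ZMod 3).val = 0 from rfl, show (2 : ZMod 3).val = 2 from rfl,
        ← pow_succ', hζ]
  · simp

/-- A plane wave restricted to the layers `0, ..., N - 1`. -/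
def wave (ζ z : ℂ) (N : ℕ) : EllTwo (ZMod 3 × ℤ) :=
  ∑ n ∈ Finset.range N, z ^ n • transOp (0, -(n : ℤ)) (layer ζ)

theorem transOp_transOp {G : Type*} [AddCommGroup G] (a b : G) (f : EllTwo G) :
    transOp a (transOp b f) = transOp (a + b) f := by
  ext g
  simp [add_assoc]

theorem transOp_zero {G : Type*} [AddCommGroup G] (f : EllTwo G) : transOp (0 : G) f = f := by
  ext g
  simp

theorem transOp_one_wave {ζ z : ℂ} (hζ : ζ ^ 3 = 1) (N : ℕ) :
    transOp (1, 0) (wave ζ z N) = ζ • wave ζ z N := by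
  simp only [wave, map_sum, map_smul, Finset.smul_sum]
  refine Finset.sum_congr rfl fun n _ => ?_
  rw [transOp_transOp, add_comm, ← transOp_transOp, transOp_layer hζ, map_smul, smul_comm]

/-- The sum telescopes and leaves only two end layers, so the defect stays bounded while
`le_norm_wave_sq` lets the wave grow with N. -/
theorem norm_transOp_wave_sub_le {ζ z : ℂ} (hz : ‖z‖ = 1) (N : ℕ) :
    ‖transOp (0, 1) (wave ζ z N) - z • wave ζ z N‖ ≤ 2 * ‖layer ζ‖ := by
  have h : transOp (0, 1) (wave ζ z N) - z • wave ζ z N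
      = ∑ n ∈ Finset.range N, (z ^ n • transOp (0, 1 - (n : ℤ)) (layer ζ)
        - z ^ (n + 1) • transOp (0, 1 - ((n + 1 : ℕ) : ℤ)) (layer ζ)) := by
    simp only [wave, map_sum, map_smul, Finset.smul_sum, Finset.sum_sub_distrib, transOp_transOp,
      Prod.mk_add_mk, add_zero, smul_smul, pow_succ']
    congr 1
    refine Finset.sum_congr rfl fun n _ => ?_
    congr 3
    push_cast
    ring_nf
  rw [h, Finset.sum_range_sub']
  refine (norm_sub_le _ _).trans ?_
  simp only [norm_smul, norm_pow, hz, one_pow, one_mul, norm_transOp]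
  linarith

theorem le_norm_wave_sq {ζ z : ℂ} (hz : ‖z‖ = 1) (N : ℕ) : (N : ℝ) ≤ ‖wave ζ z N‖ ^ 2 := by
  have hv : ∀ m ∈ Finset.range N, ‖wave ζ z N (0, (m : ℤ))‖ ^ 2 = 1 := by
    intro m hm
    have h : wave ζ z N (0, (m : ℤ))
        = ∑ n ∈ Finset.range N, z ^ n * layer ζ ((0, (m : ℤ)) + (0, -(n : ℤ))) := by
      rw [wave, lp.coeFn_sum, Finset.sum_apply]
      rfl
    rw [h, Finset.sum_eq_single_of_mem m hm]
    · simp [layer_apply, hz]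
    · intro n _ hnm
      rw [Prod.mk_add_mk, layer_apply, if_neg (by omega), mul_zero]
  have hinj : Function.Injective fun m : ℕ => ((0, (m : ℤ)) : ZMod 3 × ℤ) := fun a b hab => by
    simpa using hab
  have := (EllTwo.summable (wave ζ z N)).sum_le_tsum
    ((Finset.range N).map ⟨fun m : ℕ => ((0, (m : ℤ)) : ZMod 3 × ℤ), hinj⟩)
    fun _ _ => by positivity
  rw [Finset.sum_map, ← EllTwo.norm_sq] at this
  simp only [Function.Embedding.coeFn_mk] at this
  rw [Finset.sum_congr rfl hv] at this
  simpa using this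

theorem norm_triOp_le (v : EllTwo (ZMod 3 × ℤ)) : ‖triOp v‖ ≤ 3 * ‖v‖ := by
  have h : triOp v = v + transOp (-1, 0) v + transOp (0, 1) v := rfl
  rw [h]
  refine (norm_add₃_le ..).trans ?_
  rw [norm_transOp, norm_transOp]
  linarith

theorem conj_eq_inv {z : ℂ} (hz : ‖z‖ = 1) : starRingEnd ℂ z = z⁻¹ := by
  rw [Complex.inv_def, Complex.normSq_eq_norm_sq, hz]
  simp

/-- Horizontal shifts act on the wave exactly, vertical ones up to the defect r. The error is a sum
of two terms of norm at most 3‖r‖ with ‖r‖ ≤ 2‖layer ζ‖, hence the constant 12. -/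
theorem norm_triOp_wave_sub_le {ζ z : ℂ} (hζ : ζ ^ 3 = 1) (hz : ‖z‖ = 1) (N : ℕ) :
    ‖triOp (triOp.adjoint (wave ζ z N)) - ((‖1 + ζ⁻¹ + z‖ ^ 2 : ℝ) : ℂ) • wave ζ z N‖
      ≤ 12 * ‖layer ζ‖ := by
  have hζ1 := norm_eq_one_of_cube hζ
  have hζ0 : ζ ≠ 0 := by rintro rfl; simp at hζ1
  have hz0 : z ≠ 0 := by rintro rfl; simp at hz
  set v := wave ζ z N with hv
  set r := transOp (0, 1) v - z • v with hr
  have hrn : ‖r‖ ≤ 2 * ‖layer ζ‖ := norm_transOp_wave_sub_le hz N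
  have hX : transOp (1, 0) v = ζ • v := transOp_one_wave hζ N
  have hX' : transOp (-1, 0) v = ζ⁻¹ • v := by
    have h1 : transOp (-1, 0) (transOp (1, 0) v) = v := by
      rw [transOp_transOp, show ((-1, 0) : ZMod 3 × ℤ) + (1, 0) = 0 by decide, transOp_zero]
    have h2 : v = ζ⁻¹ • transOp (1, 0) v := by
      rw [hX, smul_smul, inv_mul_cancel₀ hζ0, one_smul]
    calc transOp (-1, 0) v = transOp (-1, 0) (ζ⁻¹ • transOp (1, 0) v) := congrArg _ h2
      _ = ζ⁻¹ • v := by rw [map_smul, h1]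
  have hY' : transOp (0, -1) v = z⁻¹ • v - z⁻¹ • transOp (0, -1) r := by
    have h1 : transOp (0, -1) (transOp (0, 1) v) = v := by
      rw [transOp_transOp, show ((0, -1) : ZMod 3 × ℤ) + (0, 1) = 0 by decide, transOp_zero]
    rw [hr, map_sub, h1, map_smul, smul_sub, smul_smul, inv_mul_cancel₀ hz0, one_smul,
      sub_sub_cancel]
  have hT : triOp v = (1 + ζ⁻¹ + z) • v + r := by
    have h : triOp v = v + transOp (-1, 0) v + transOp (0, 1) v := rfl
    rw [h, hX', hr]
    module
  have hT' : triOp.adjoint v = (1 + ζ + z⁻¹) • v - z⁻¹ • transOp (0, -1) r := by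
    have h : triOp.adjoint v = v + transOp (1, 0) v + transOp (0, -1) v := by
      rw [adjoint_triOp]; rfl
    rw [h, hX, hY']
    module
  have hsq : ((‖1 + ζ⁻¹ + z‖ ^ 2 : ℝ) : ℂ) = (1 + ζ⁻¹ + z) * (1 + ζ + z⁻¹) := by
    push_cast
    rw [← Complex.mul_conj', map_add, map_add, map_one, conj_eq_inv hz,
      conj_eq_inv (by rw [norm_inv, hζ1, inv_one]), inv_inv]
  have hn : ‖1 + ζ + z⁻¹‖ ≤ 3 := by
    refine (norm_add₃_le ..).trans ?_
    rw [norm_inv, hz, hζ1]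
    norm_num
  have key : triOp (triOp.adjoint v) - ((‖1 + ζ⁻¹ + z‖ ^ 2 : ℝ) : ℂ) • v
      = (1 + ζ + z⁻¹) • r - z⁻¹ • triOp (transOp (0, -1) r) := by
    rw [hT', map_sub, map_smul, map_smul, hT, hsq]
    module
  rw [key]
  refine (norm_sub_le _ _).trans ?_
  have h1 : ‖(1 + ζ + z⁻¹) • r‖ ≤ 3 * ‖r‖ := by rw [norm_smul]; gcongr
  have h2 : ‖z⁻¹ • triOp (transOp (0, -1) r)‖ ≤ 3 * ‖r‖ := by
    rw [norm_smul, norm_inv, hz, inv_one, one_mul]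
    refine (norm_triOp_le _).trans_eq ?_
    rw [norm_transOp]
  linarith

/-- A point of the unit circle with prescribed real part. -/
theorem exists_norm_one_re {c : ℝ} (h1 : -1 ≤ c) (h2 : c ≤ 1) : ∃ w : ℂ, ‖w‖ = 1 ∧ w.re = c := by
  refine ⟨⟨c, Real.sqrt (1 - c ^ 2)⟩, ?_, rfl⟩
  rw [Complex.norm_eq_sqrt_sq_add_sq, Real.sq_sqrt (by nlinarith)]
  simp

/-- For a primitive cube root, 1 + ω⁻¹ = -ω, and z = -ω w gives |1 + w|² = 2 + 2 Re w, which sweeps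
[0, 4]. For ζ = 1 one gets |2 + w|² = 5 + 4 Re w, which sweeps [1, 9]. -/
theorem exists_wave_parameters {x : ℝ} (h0 : 0 ≤ x) (h9 : x ≤ 9) :
    ∃ ζ z : ℂ, ζ ^ 3 = 1 ∧ ‖z‖ = 1 ∧ ‖1 + ζ⁻¹ + z‖ ^ 2 = x := by
  rcases le_total x 4 with h4 | h4
  · obtain ⟨ω, hω⟩ := exists_primitive_cube_root
    have hω3 : ω ^ 3 = 1 := by linear_combination (ω - 1) * hω
    have hω1 := norm_eq_one_of_cube hω3
    have hω0 : ω ≠ 0 := by rintro rfl; simp at hω1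
    obtain ⟨w, hw, hre⟩ := exists_norm_one_re (c := (x - 2) / 2) (by linarith) (by linarith)
    refine ⟨ω, -ω * w, hω3, by simp [hω1, hw], ?_⟩
    have h1 : 1 + ω⁻¹ + -ω * w = -ω * (1 + w) := by
      field_simp
      linear_combination hω
    rw [h1, norm_mul, norm_neg, hω1, one_mul, Complex.sq_norm, Complex.normSq_add,
      Complex.normSq_eq_norm_sq w, hw]
    simp [hre]
    ring
  · obtain ⟨w, hw, hre⟩ := exists_norm_one_re (c := (x - 5) / 4) (by linarith) (by linarith)
    refine ⟨1, w, one_pow 3, hw, ?_⟩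
    have h1 : (1 : ℂ) + 1⁻¹ + w = 2 + w := by norm_num
    rw [h1, Complex.sq_norm, Complex.normSq_add, Complex.normSq_eq_norm_sq w, hw]
    simp [hre]
    ring

/-- Each `x ∈ [0, 9]` is an approximate eigenvalue of `T T*`. -/
theorem exists_approx_triOp {x : ℝ} (h0 : 0 ≤ x) (h9 : x ≤ 9) :
    ∃ C : ℝ, ∀ B : ℝ, ∃ v : EllTwo (ZMod 3 × ℤ),
      ‖triOp (triOp.adjoint v) - (x : ℂ) • v‖ ≤ C ∧ B < ‖v‖ := by
  obtain ⟨ζ, z, hζ, hz, hx⟩ := exists_wave_parameters h0 h9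
  refine ⟨12 * ‖layer ζ‖, fun B => ?_⟩
  obtain ⟨N, hN⟩ := exists_nat_gt (B ^ 2)
  refine ⟨wave ζ z N, hx ▸ norm_triOp_wave_sub_le hζ hz N, ?_⟩
  exact lt_of_pow_lt_pow_left₀ 2 (norm_nonneg _) (hN.trans_le (le_norm_wave_sq hz N))

end Lattice

/-! ### Signs of faces -/

section Signs

theorem face_sign {p : ℕ} {π : Equiv.Perm (Fin (p + 2))} {ρ : Equiv.Perm (Fin (p + 1))}
    {j j' : Fin (p + 2)} (h : ∀ i, j.succAbove (ρ i) = π (j'.succAbove i)) :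
    ((sign π : ℤˣ) : ℤ) * (sign ρ : ℤˣ) = (-1) ^ (j : ℕ) * (-1) ^ (j' : ℕ) := by
  have hj : π j' = j := by
    by_contra hne
    obtain ⟨k, hk⟩ := Fin.exists_succAbove_eq hne
    obtain ⟨i, rfl⟩ := ρ.surjective k
    rw [h] at hk
    exact Fin.succAbove_ne _ _ (π.injective hk)
  -- Moving j' and j to the front by cycles of signs (-1)^j' and (-1)^j turns π into a permutation
  -- fixing 0 and acting as ρ on the rest.
  have hπ : π = j.cycleRange.symm * Equiv.Perm.decomposeFin.symm (0, ρ) * j'.cycleRange := by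
    rw [← mul_inv_eq_iff_eq_mul]
    ext1 i
    refine Fin.cases ?_ (fun i => ?_) i
    · simp [Equiv.Perm.inv_def, hj]
    · simp [Equiv.Perm.inv_def, h]
  rw [hπ]
  simp only [Equiv.Perm.sign_mul, Equiv.Perm.sign_symm, Fin.sign_cycleRange,
    Equiv.Perm.decomposeFin.symm_sign, if_true, one_mul]
  push_cast
  have : ((sign ρ : ℤˣ) : ℤ) * (sign ρ : ℤˣ) = 1 := by
    rw [← Units.val_mul, Int.units_mul_self, Units.val_one]
  linear_combination ((-1) ^ (j : ℕ) * (-1) ^ (j' : ℕ)) * this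

/-- Any reordered face is an honest deletion from an even reordering of the simplex: there are at
least two indices, so j' ∈ {0, 1} can be chosen to correct the parity. -/
theorem exists_even_face {p : ℕ} (ρ : Equiv.Perm (Fin (p + 1))) (j : Fin (p + 2)) :
    ∃ (π : Equiv.Perm (Fin (p + 2))) (j' : Fin (p + 2)), sign π = 1 ∧
      ∀ i, j.succAbove (ρ i) = π (j'.succAbove i) := by
  have key : ∃ j' : Fin (p + 2), (-1 : ℤˣ) ^ (j : ℕ) * sign ρ * (-1) ^ (j' : ℕ) = 1 := by
    rcases Int.units_eq_one_or ((-1 : ℤˣ) ^ (j : ℕ) * sign ρ) with h | h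
    · exact ⟨0, by rw [h]; simp⟩
    · exact ⟨1, by rw [h]; simp⟩
  obtain ⟨j', hj'⟩ := key
  refine ⟨j.cycleRange.symm * Equiv.Perm.decomposeFin.symm (0, ρ) * j'.cycleRange, j', ?_, ?_⟩
  · simpa only [Equiv.Perm.sign_mul, Equiv.Perm.sign_symm, Fin.sign_cycleRange,
      Equiv.Perm.decomposeFin.symm_sign, if_true, one_mul] using hj'
  · intro i
    simp

variable {V : Type*} {K : AbstractSimplicialComplex V} {p : ℕ}

namespace OrderedSimplex

theorem perm_perm {q : ℕ} (s : OrderedSimplex K q) (π ρ : Equiv.Perm (Fin (q + 1))) :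
    (s.perm π).perm ρ = s.perm (π * ρ) := rfl

theorem oriented_eq_iff {q : ℕ} {s t : OrderedSimplex K q} :
    s.oriented = t.oriented ↔ ∃ π : Equiv.Perm (Fin (q + 1)), sign π = 1 ∧ t = s.perm π :=
  Quotient.eq

theorem sgn_perm_face (s : OrderedSimplex K (p + 1)) (j : Fin (p + 2))
    (ρ : Equiv.Perm (Fin (p + 1))) :
    sgn s.oriented ((s.face j).perm ρ).oriented = (sign ρ : ℤˣ) * (-1) ^ (j : ℕ) := by
  -- The definition of `sgn` only asks for some representative; by `face_sign`, all representatives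
  -- give the same parity.
  have hpar : ∀ (s' : OrderedSimplex K (p + 1)) (j' : Fin (p + 2)), s'.oriented = s.oriented →
      (s'.face j').oriented = ((s.face j).perm ρ).oriented →
      (-1 : ℤ) ^ (j' : ℕ) = (sign ρ : ℤˣ) * (-1) ^ (j : ℕ) := by
    intro s' j' h1 h2
    obtain ⟨π, hπ, rfl⟩ := oriented_eq_iff.mp h1
    obtain ⟨κ, hκ, h3⟩ := oriented_eq_iff.mp h2
    have h4 : ∀ i, j'.succAbove ((κ * ρ⁻¹) i) = π (j.succAbove i) := by
      intro i
      refine s'.injective ?_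
      have := congrFun (congrArg vertex h3) (ρ⁻¹ i)
      simpa [perm, face] using this.symm
    have h5 := face_sign h4
    rw [hπ, Equiv.Perm.sign_mul, hκ, Equiv.Perm.sign_inv] at h5
    have h6 : ((-1 : ℤ) ^ (j : ℕ)) * (-1) ^ (j : ℕ) = 1 := by rw [← mul_pow]; simp
    push_cast at h5
    linear_combination (-(-1 : ℤ) ^ (j' : ℕ)) * h6 - (-1 : ℤ) ^ (j : ℕ) * h5
  obtain ⟨π, j', hπ, h⟩ := exists_even_face ρ j
  have h1 : (s.perm π).oriented = s.oriented := (oriented_eq_iff.mpr ⟨π, hπ, rfl⟩).symm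
  have h2 : ((s.perm π).face j').oriented = ((s.face j).perm ρ).oriented :=
    congrArg oriented (ext_vertex (funext fun i => by simp [perm, face, h]))
  rw [← hpar _ _ h1 h2]
  unfold sgn
  rcases Nat.even_or_odd (j' : ℕ) with he | ho
  · rw [if_pos ⟨_, _, h1, h2, he⟩, he.neg_one_pow]
  · rw [if_neg, if_pos ⟨_, _, h1, h2, ho⟩, ho.neg_one_pow]
    rintro ⟨s', j'', h3, h4, he⟩
    have := (hpar _ _ h1 h2).trans (hpar _ _ h3 h4).symm
    rw [ho.neg_one_pow, he.neg_one_pow] at this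
    norm_num at this

theorem sgn_eq_of_vertex {s : OrderedSimplex K (p + 1)} {t : OrderedSimplex K p} (j : Fin (p + 2))
    (ρ : Equiv.Perm (Fin (p + 1))) (h : ∀ i, t.vertex i = s.vertex (j.succAbove (ρ i))) :
    sgn s.oriented t.oriented = (sign ρ : ℤˣ) * (-1) ^ (j : ℕ) := by
  have : t = (s.face j).perm ρ := ext_vertex (funext h)
  rw [this, sgn_perm_face]

theorem exists_perm {q : ℕ} {s t : OrderedSimplex K q} (h : t.support ⊆ s.support) :
    ∃ π, t = s.perm π := by
  have h : ∀ i, ∃ j, s.vertex j = t.vertex i := fun i => by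
    rw [← mem_support]
    exact h ((mem_support _ _).mpr ⟨i, rfl⟩)
  choose f hf using h
  have hfi : Function.Injective f := fun i j hij => t.injective (by rw [← hf, ← hf, hij])
  exact ⟨Equiv.ofBijective f (Finite.injective_iff_bijective.mp hfi),
    ext_vertex (funext fun i => (hf i).symm)⟩

theorem exists_face {s : OrderedSimplex K (p + 1)} {t : OrderedSimplex K p}
    (h : t.support ⊆ s.support) : ∃ j ρ, t = (s.face j).perm ρ := by
  classical
  have hc : ∀ {q : ℕ} (s : OrderedSimplex K q), s.support.card = q + 1 := fun s => by
    simp [support]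
  obtain ⟨v, hvs, hvt⟩ := Finset.exists_of_ssubset (Finset.ssubset_iff_subset_ne.mpr
    ⟨h, fun he => by have := congrArg Finset.card he; rw [hc, hc] at this; omega⟩)
  obtain ⟨j, rfl⟩ := (mem_support _ _).mp hvs
  refine ⟨j, exists_perm fun w hw => ?_⟩
  obtain ⟨k, rfl⟩ := (mem_support _ _).mp (h hw)
  have hkj : k ≠ j := by rintro rfl; exact hvt hw
  obtain ⟨i, rfl⟩ := Fin.exists_succAbove_eq hkj
  exact (mem_support _ _).mpr ⟨i, rfl⟩

theorem sgn_perm_left {s : OrderedSimplex K (p + 1)} {t : OrderedSimplex K p}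
    (h : t.support ⊆ s.support) (π : Equiv.Perm (Fin (p + 2))) :
    sgn (s.perm π).oriented t.oriented = (sign π : ℤˣ) * sgn s.oriented t.oriented := by
  obtain ⟨j, ρ, rfl⟩ := exists_face h
  obtain ⟨j', ρ', h'⟩ := exists_face (s := s.perm π) (t := (s.face j).perm ρ)
    (by rw [s.support_perm]; exact h)
  rw [sgn_perm_face, h', sgn_perm_face]
  have h4 : ∀ i, j.succAbove ((ρ * ρ'⁻¹) i) = π (j'.succAbove i) := by
    intro i
    refine s.injective ?_
    have := congrFun (congrArg vertex h') (ρ'⁻¹ i)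
    simpa [perm, face] using this
  have h5 := face_sign h4
  rw [Equiv.Perm.sign_mul, Equiv.Perm.sign_inv] at h5
  push_cast at h5
  have h6 : ((-1 : ℤ) ^ (j : ℕ)) * (-1) ^ (j : ℕ) = 1 := by rw [← mul_pow]; simp
  have hu : ∀ ε : ℤˣ, (ε : ℤ) * ε = 1 := fun ε => by
    rw [← Units.val_mul, Int.units_mul_self, Units.val_one]
  have h7 := hu (sign ρ')
  have h8 : ((-1 : ℤ) ^ (j' : ℕ)) * (-1) ^ (j' : ℕ) = 1 := by rw [← mul_pow]; simp
  linear_combination (-(sign ρ' : ℤˣ) * (-1 : ℤ) ^ (j' : ℕ) : ℤ) * h6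
    - ((sign ρ' : ℤˣ) * (-1) ^ (j : ℕ) : ℤ) * h5
    + ((sign π : ℤˣ) * (sign ρ : ℤˣ) * (-1) ^ (j : ℕ) : ℤ) * h7

theorem sgn_perm_right {s : OrderedSimplex K (p + 1)} {t : OrderedSimplex K p}
    (h : t.support ⊆ s.support) (κ : Equiv.Perm (Fin (p + 1))) :
    sgn s.oriented (t.perm κ).oriented = (sign κ : ℤˣ) * sgn s.oriented t.oriented := by
  obtain ⟨j, ρ, rfl⟩ := exists_face h
  rw [perm_perm, sgn_perm_face, sgn_perm_face, Equiv.Perm.sign_mul]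
  push_cast
  ring

end OrderedSimplex

namespace OrientedSimplex

theorem sgn_mul_self {τ : OrientedSimplex K (p + 1)} {μ : OrientedSimplex K p}
    (h : μ.support ⊆ τ.support) : sgn τ μ * sgn τ μ = 1 := by
  obtain ⟨s, rfl⟩ := τ.exists_rep
  obtain ⟨t, rfl⟩ := μ.exists_rep
  obtain ⟨j, ρ, rfl⟩ := OrderedSimplex.exists_face h
  have hu : ((sign ρ : ℤˣ) : ℤ) * (sign ρ : ℤˣ) = 1 := by
    rw [← Units.val_mul, Int.units_mul_self, Units.val_one]
  have h6 : ((-1 : ℤ) ^ (j : ℕ)) * (-1) ^ (j : ℕ) = 1 := by rw [← mul_pow]; simp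
  rw [OrderedSimplex.sgn_perm_face, mul_mul_mul_comm, hu, h6, one_mul]

/-- Reversing the common face changes both factors, so η does not depend on the orientation chosen
in `DownEdge.common`. -/
theorem sgn_mul_sgn {τ τ' : OrientedSimplex K (p + 1)} {μ μ' : OrientedSimplex K p}
    (hμ : μ'.support = μ.support) (h : μ.support ⊆ τ.support) (h' : μ.support ⊆ τ'.support) :
    sgn τ μ' * sgn τ' μ' = sgn τ μ * sgn τ' μ := by
  obtain ⟨s, rfl⟩ := τ.exists_rep
  obtain ⟨s', rfl⟩ := τ'.exists_rep
  obtain ⟨t, rfl⟩ := μ.exists_rep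
  obtain ⟨t', rfl⟩ := μ'.exists_rep
  obtain ⟨κ, rfl⟩ := OrderedSimplex.exists_perm hμ.subset
  have hu : ((sign κ : ℤˣ) : ℤ) * (sign κ : ℤˣ) = 1 := by
    rw [← Units.val_mul, Int.units_mul_self, Units.val_one]
  rw [OrderedSimplex.sgn_perm_right h, OrderedSimplex.sgn_perm_right h', mul_mul_mul_comm, hu,
    one_mul]

/-- The same simplex with the opposite orientation. -/
def flip (τ : OrientedSimplex K (p + 1)) : OrientedSimplex K (p + 1) :=
  Quotient.map (fun s => s.perm (Equiv.swap 0 1)) (by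
    rintro s _ ⟨π, hπ, rfl⟩
    refine ⟨Equiv.swap 0 1 * π * Equiv.swap 0 1, ?_, ?_⟩
    · rw [Equiv.Perm.sign_mul, Equiv.Perm.sign_mul, hπ, mul_one, Int.units_mul_self]
    · rw [OrderedSimplex.perm_perm, OrderedSimplex.perm_perm]
      simp [← mul_assoc]) τ

theorem flip_oriented (s : OrderedSimplex K (p + 1)) :
    s.oriented.flip = (s.perm (Equiv.swap 0 1)).oriented := rfl

@[simp]
theorem support_flip (τ : OrientedSimplex K (p + 1)) : τ.flip.support = τ.support := by
  obtain ⟨s, rfl⟩ := τ.exists_rep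
  exact s.support_perm _

@[simp]
theorem flip_flip (τ : OrientedSimplex K (p + 1)) : τ.flip.flip = τ := by
  obtain ⟨s, rfl⟩ := τ.exists_rep
  rw [flip_oriented, flip_oriented, OrderedSimplex.perm_perm, Equiv.swap_mul_self]
  rfl

theorem flip_ne (τ : OrientedSimplex K (p + 1)) : τ.flip ≠ τ := by
  obtain ⟨s, rfl⟩ := τ.exists_rep
  rw [flip_oriented, ne_comm, Ne, OrderedSimplex.oriented_eq_iff]
  rintro ⟨π, hπ, h⟩
  have : Equiv.swap 0 1 = π :=
    Equiv.ext fun i => s.injective (congrFun (congrArg OrderedSimplex.vertex h) i)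
  rw [← this, Equiv.Perm.sign_swap (by simp)] at hπ
  exact absurd hπ (by decide)

theorem eq_or_eq_flip {τ ρ : OrientedSimplex K (p + 1)} (h : ρ.support = τ.support) :
    ρ = τ ∨ ρ = τ.flip := by
  obtain ⟨s, rfl⟩ := τ.exists_rep
  obtain ⟨t, rfl⟩ := ρ.exists_rep
  obtain ⟨π, rfl⟩ := OrderedSimplex.exists_perm h.subset
  rcases Int.units_eq_one_or (sign π) with h1 | h1
  · exact Or.inl (OrderedSimplex.oriented_eq_iff.mpr ⟨π, h1, rfl⟩).symm
  · refine Or.inr (OrderedSimplex.oriented_eq_iff.mpr ⟨Equiv.swap 0 1 * π, ?_, ?_⟩).symm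
    · rw [Equiv.Perm.sign_mul, h1, Equiv.Perm.sign_swap (by simp), Int.units_mul_self]
    · rw [OrderedSimplex.perm_perm, ← mul_assoc, Equiv.swap_mul_self, one_mul]

theorem sgn_flip {τ : OrientedSimplex K (p + 1)} {μ : OrientedSimplex K p}
    (h : μ.support ⊆ τ.support) : sgn τ.flip μ = -sgn τ μ := by
  obtain ⟨s, rfl⟩ := τ.exists_rep
  obtain ⟨t, rfl⟩ := μ.exists_rep
  rw [flip_oriented, OrderedSimplex.sgn_perm_left h, Equiv.Perm.sign_swap (by simp)]
  simp

end OrientedSimplex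

end Signs

/-! ### The coefficients of the shift -/

section Eta

variable {V : Type*} [DecidableEq V] {K : AbstractSimplicialComplex V} {p : ℕ}

/-- The first vertex of an edge of the down graph. -/
def DownEdge.source (e : DownEdge K p) : OrientedSimplex K (p + 1) := e.1.1

/-- The second vertex of an edge of the down graph. -/
def DownEdge.target (e : DownEdge K p) : OrientedSimplex K (p + 1) := e.1.2

/-- The edge between two down neighbors. -/
def DownEdge.of {τ τ' : OrientedSimplex K (p + 1)}
    (h : DownNeighbor K p τ.support τ'.support) : DownEdge K p := ⟨(τ, τ'), h⟩

/-- The neighbor given by an element of `AdjTo K p τ`. -/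
def AdjTo.target {τ : OrientedSimplex K (p + 1)} (x : AdjTo K p τ) : OrientedSimplex K (p + 1) :=
  x.1

/-- A down neighbor as an element of `AdjTo K p τ`. -/
def AdjTo.of {τ τ' : OrientedSimplex K (p + 1)}
    (h : DownNeighbor K p τ.support τ'.support) : AdjTo K p τ := ⟨τ', h⟩

theorem AdjTo.ext {τ : OrientedSimplex K (p + 1)} {x y : AdjTo K p τ} (h : x.target = y.target) :
    x = y := Subtype.ext h

theorem AdjTo.downNeighbor {τ : OrientedSimplex K (p + 1)} (x : AdjTo K p τ) :
    DownNeighbor K p τ.support x.target.support := x.2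

theorem AdjTo.exists_of {τ : OrientedSimplex K (p + 1)} (x : AdjTo K p τ) :
    ∃ (τ' : OrientedSimplex K (p + 1)) (h : DownNeighbor K p τ.support τ'.support),
      AdjTo.of h = x := ⟨x.1, x.2, rfl⟩

theorem DownEdge.support_common (e : DownEdge K p) :
    e.common.support = e.source.support ∩ e.target.support :=
  Classical.choose_spec (exists_oriented e.2.1 e.2.2)

theorem eta_eq (e : DownEdge K p) {μ : OrientedSimplex K p}
    (hμ : μ.support = e.source.support ∩ e.target.support) :
    eta e = sgn e.source μ * sgn e.target μ :=
  OrientedSimplex.sgn_mul_sgn (e.support_common.trans hμ.symm)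
    (hμ ▸ Finset.inter_subset_left) (hμ ▸ Finset.inter_subset_right)

theorem eta_rev (e : DownEdge K p) : eta e.rev = eta e := by
  rw [eta_eq e.rev (μ := e.common) (by rw [e.support_common, Finset.inter_comm]; rfl), eta,
    mul_comm]
  rfl

theorem eta_mul_self (e : DownEdge K p) : eta e * eta e = 1 := by
  rw [eta, mul_mul_mul_comm,
    OrientedSimplex.sgn_mul_self (e.support_common ▸ Finset.inter_subset_left),
    OrientedSimplex.sgn_mul_self (e.support_common ▸ Finset.inter_subset_right), one_mul]

open Classical in
/-- The coefficient `η(τ, τ')`, extended by zero to all pairs of oriented simplices. -/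
def etaCoeff (τ τ' : OrientedSimplex K (p + 1)) : ℤ :=
  if h : DownNeighbor K p τ.support τ'.support then eta (DownEdge.of h) else 0

theorem etaCoeff_eq {τ τ' : OrientedSimplex K (p + 1)}
    (h : DownNeighbor K p τ.support τ'.support) {μ : OrientedSimplex K p}
    (hμ : μ.support = τ.support ∩ τ'.support) : etaCoeff τ τ' = sgn τ μ * sgn τ' μ := by
  rw [etaCoeff, dif_pos h]
  exact eta_eq (DownEdge.of h) hμ

theorem etaCoeff_edge {τ : OrientedSimplex K (p + 1)} (x : AdjTo K p τ) :
    eta x.edge = etaCoeff τ x.target := by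
  rw [etaCoeff, dif_pos x.downNeighbor]
  rfl

theorem etaCoeff_comm (τ τ' : OrientedSimplex K (p + 1)) : etaCoeff τ τ' = etaCoeff τ' τ := by
  by_cases h : DownNeighbor K p τ.support τ'.support
  · rw [etaCoeff, etaCoeff, dif_pos h, dif_pos h.symm, ← eta_rev]
    rfl
  · rw [etaCoeff, etaCoeff, dif_neg h, dif_neg fun h' => h h'.symm]

theorem etaCoeff_flip_left (τ τ' : OrientedSimplex K (p + 1)) :
    etaCoeff τ.flip τ' = -etaCoeff τ τ' := by
  by_cases h : DownNeighbor K p τ.support τ'.support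
  · obtain ⟨μ, hμ⟩ := exists_oriented h.1 h.2
    rw [etaCoeff_eq h hμ, etaCoeff_eq (by rwa [τ.support_flip]) (by rwa [τ.support_flip]),
      OrientedSimplex.sgn_flip (hμ ▸ Finset.inter_subset_left), neg_mul]
  · rw [etaCoeff, etaCoeff, dif_neg h, dif_neg (by rwa [τ.support_flip]), neg_zero]

theorem etaCoeff_flip_right (τ τ' : OrientedSimplex K (p + 1)) :
    etaCoeff τ τ'.flip = -etaCoeff τ τ' := by
  rw [etaCoeff_comm, etaCoeff_flip_left, etaCoeff_comm]

end Eta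

/-! ### Enumeration of the neighbors -/

section Neighbors

variable {V : Type*} [DecidableEq V] {K : AbstractSimplicialComplex V} {p : ℕ}

/-- The family `t` consists of one orientation of each down neighbor of `τ`. -/
structure IsNeighborFamily (τ : OrientedSimplex K (p + 1)) {ι : Type*}
    (t : ι → OrientedSimplex K (p + 1)) : Prop where
  injective : Function.Injective fun i => (t i).support
  downNeighbor_iff : ∀ τ' : OrientedSimplex K (p + 1),
    DownNeighbor K p τ.support τ'.support ↔ ∃ i, τ'.support = (t i).support

namespace IsNeighborFamily

variable {τ : OrientedSimplex K (p + 1)} {ι : Type*}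
  {t : ι → OrientedSimplex K (p + 1)}

theorem downDegree_eq [Fintype ι] (ht : IsNeighborFamily τ t) : downDegree K p τ = Fintype.card ι := by
  have h : {G : Finset V | G ∈ K.faces ∧ G.card = p + 2 ∧ DownNeighbor K p τ.support G}
      = Set.range fun i => (t i).support := by
    ext G
    constructor
    · rintro ⟨h1, h2, h3⟩
      obtain ⟨τ', rfl⟩ := exists_oriented h1 h2
      obtain ⟨i, hi⟩ := (ht.downNeighbor_iff τ').mp h3
      exact ⟨i, hi.symm⟩
    · rintro ⟨i, rfl⟩
      exact ⟨(t i).support_mem, (t i).card_support, (ht.downNeighbor_iff _).mpr ⟨i, rfl⟩⟩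
  rw [downDegree, h, ← Nat.card_coe_set_eq, Nat.card_range_of_injective ht.injective,
    Nat.card_eq_fintype_card]

theorem flip (ht : IsNeighborFamily τ t) : IsNeighborFamily τ.flip t :=
  ⟨ht.injective, fun τ' => by rw [τ.support_flip]; exact ht.downNeighbor_iff τ'⟩

/-- Each neighboring simplex occurs with both orientations; this is the factor 2 in the
normalization by 2 deg τ. -/
theorem bijective (ht : IsNeighborFamily τ t) : Function.Bijective fun x : ι × Bool =>
    AdjTo.of (τ := τ) (τ' := bif x.2 then (t x.1).flip else t x.1)
      ((ht.downNeighbor_iff _).mpr ⟨x.1, by cases x.2 <;> simp⟩) := by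
  constructor
  · rintro ⟨i, b⟩ ⟨j, c⟩ h
    have h1 : (bif b then (t i).flip else t i) = bif c then (t j).flip else t j :=
      congrArg AdjTo.target h
    have hij : i = j := by
      have := congrArg OrientedSimplex.support h1
      apply ht.injective
      cases b <;> cases c <;> simpa using this
    subst hij
    have hne := (t i).flip_ne
    cases b <;> cases c
    · rfl
    · exact absurd h1.symm hne
    · exact absurd h1 hne
    · rfl
  · rintro x
    obtain ⟨τ', h, rfl⟩ := x.exists_of
    obtain ⟨i, hi⟩ := (ht.downNeighbor_iff τ').mp h
    rcases OrientedSimplex.eq_or_eq_flip hi with rfl | rfl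
    · exact ⟨(i, false), rfl⟩
    · exact ⟨(i, true), rfl⟩

theorem tsum_adjTo [Fintype ι] (ht : IsNeighborFamily τ t) (g : OrientedSimplex K (p + 1) → ℂ) :
    ∑' x : AdjTo K p τ, g x.target = ∑ i, (g (t i) + g (t i).flip) := by
  rw [← (Equiv.ofBijective _ ht.bijective).tsum_eq, tsum_fintype, Fintype.sum_prod_type]
  refine Finset.sum_congr rfl fun i _ => ?_
  rw [Fintype.sum_bool, add_comm]
  rfl

end IsNeighborFamily

end Neighbors

/-! ### Adjoints and the formula for the discriminant -/

section Formula

variable {V : Type*} [DecidableEq V] {K : AbstractSimplicialComplex V} {p : ℕ}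

theorem adjoint_shiftOp : (shiftOp K p).adjoint = shiftOp K p := by
  refine ((ContinuousLinearMap.eq_adjoint_iff _ _).mpr fun f g => ?_).symm
  let r : DownEdge K p ≃ DownEdge K p := ⟨DownEdge.rev, DownEdge.rev, fun _ => rfl, fun _ => rfl⟩
  rw [lp.inner_eq_tsum, lp.inner_eq_tsum, ← r.tsum_eq]
  refine tsum_congr fun e => ?_
  have h1 : shiftOp K p f (r e) = (eta e.rev : ℂ) * f e := rfl
  have h2 : shiftOp K p g e = (eta e : ℂ) * g (r e) := rfl
  rw [h1, h2, eta_rev]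
  simp only [RCLike.inner_apply, map_mul, map_intCast]
  ring

theorem shiftOp_shiftOp (g : EllTwo (DownEdge K p)) : shiftOp K p (shiftOp K p g) = g := by
  ext e
  have h1 : shiftOp K p (shiftOp K p g) e = (eta e : ℂ) * ((eta e.rev : ℂ) * g e) := rfl
  rw [h1, eta_rev, ← mul_assoc, ← Int.cast_mul, eta_mul_self, Int.cast_one, one_mul]

theorem adjoint_boundaryOp_apply (f : EllTwo (OrientedSimplex K (p + 1))) (e : DownEdge K p) :
    (boundaryOp K p).adjoint f e
      = ((1 / Real.sqrt (2 * downDegree K p e.source) : ℝ) : ℂ) * f e.source := by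
  classical
  have h1 : (boundaryOp K p).adjoint f e
      = ⟪lp.single 2 e (1 : ℂ), (boundaryOp K p).adjoint f⟫_ℂ := by
    rw [lp.inner_single_left]; simp
  -- The point mass at an edge is seen only from the source of that edge.
  have h2 : boundaryOp K p (lp.single 2 e (1 : ℂ))
      = lp.single 2 e.source ((1 / Real.sqrt (2 * downDegree K p e.source) : ℝ) : ℂ) := by
    ext τ
    have h3 : boundaryOp K p (lp.single 2 e (1 : ℂ)) τ
      = ((1 / Real.sqrt (2 * downDegree K p τ) : ℝ) : ℂ) *
        ∑' τ' : AdjTo K p τ, (lp.single 2 e (1 : ℂ) : EllTwo (DownEdge K p)) τ'.edge := rfl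
    rw [h3, lp.single_apply]
    by_cases hτ : τ = e.source
    · subst hτ
      rw [tsum_eq_single (AdjTo.of (τ := e.source) (τ' := e.target) e.2)]
      · have h4 : AdjTo.edge (AdjTo.of (τ := e.source) (τ' := e.target) e.2) = e := rfl
        simp [h4]
      · intro x hx
        rw [lp.single_apply, Pi.single_eq_of_ne]
        intro he
        exact hx (AdjTo.ext (congrArg (fun y : DownEdge K p => y.target) he))
    · rw [Pi.single_eq_of_ne hτ]
      have h5 : ∀ x : AdjTo K p τ,
          (lp.single 2 e (1 : ℂ) : EllTwo (DownEdge K p)) x.edge = 0 := by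
        intro x
        rw [lp.single_apply, Pi.single_eq_of_ne]
        intro he
        exact hτ (congrArg (fun y : DownEdge K p => y.source) he)
      rw [tsum_congr h5, tsum_zero, mul_zero]
  rw [h1, ContinuousLinearMap.adjoint_inner_right, h2, lp.inner_single_left]
  simp only [RCLike.inner_apply, Complex.conj_ofReal]
  ring

theorem sqrt_inv_mul_sqrt_inv (m : ℕ) :
    ((1 / Real.sqrt (2 * m) : ℝ) : ℂ) * ((1 / Real.sqrt (2 * m) : ℝ) : ℂ) = 1 / (2 * m) := by
  rw [← Complex.ofReal_mul, div_mul_div_comm, Real.mul_self_sqrt (by positivity)]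
  push_cast
  ring

/-- On the 2 deg τ edges leaving τ, the function d* f is constant, and the two square-root factors
cancel the number of edges. A nonzero degree is needed here. -/
theorem isWalkPair_of_neighborFamily
    (h : ∀ τ : OrientedSimplex K (p + 1), downDegree K p τ ≠ 0 ∧
      ∃ (ι : Type) (_ : Fintype ι) (t : ι → OrientedSimplex K (p + 1)), IsNeighborFamily τ t) :
    IsWalkPair (boundaryOp K p) (shiftOp K p) where
  involutive := shiftOp_shiftOp
  selfAdjoint := adjoint_shiftOp
  coisometry f := by
    ext τ
    obtain ⟨h0, ι, _, t, ht⟩ := h τ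
    have h1 : boundaryOp K p ((boundaryOp K p).adjoint f) τ
      = ((1 / Real.sqrt (2 * downDegree K p τ) : ℝ) : ℂ) *
        ∑' x : AdjTo K p τ, (boundaryOp K p).adjoint f x.edge := rfl
    have h2 : ∀ x : AdjTo K p τ, (boundaryOp K p).adjoint f x.edge
        = ((1 / Real.sqrt (2 * downDegree K p τ) : ℝ) : ℂ) * f τ :=
      fun x => adjoint_boundaryOp_apply f x.edge
    rw [h1, tsum_congr h2,
      ht.tsum_adjTo fun _ => ((1 / Real.sqrt (2 * downDegree K p τ) : ℝ) : ℂ) * f τ,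
      Finset.sum_const, Finset.card_univ, ← ht.downDegree_eq, nsmul_eq_mul]
    have h3 := sqrt_inv_mul_sqrt_inv (downDegree K p τ)
    have h4 : (downDegree K p τ : ℂ) ≠ 0 := by exact_mod_cast h0
    have h5 : (1 : ℂ) / (2 * downDegree K p τ) * (2 * downDegree K p τ) = 1 := by field_simp
    linear_combination (2 * downDegree K p τ * f τ) * h3 + f τ * h5

/-- The coefficient η changes sign with the orientation of the neighbor, so only the odd part of f
enters. Constant degree merges the two square roots into 1/(2m). -/
theorem downDiscriminant_apply {m : ℕ} (hm : ∀ τ : OrientedSimplex K (p + 1), downDegree K p τ = m)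
    {τ : OrientedSimplex K (p + 1)} {ι : Type*} [Fintype ι] {t : ι → OrientedSimplex K (p + 1)}
    (ht : IsNeighborFamily τ t) (f : EllTwo (OrientedSimplex K (p + 1))) :
    downDiscriminant K p f τ
      = 1 / (2 * m) * ∑ i, (etaCoeff τ (t i) : ℂ) * (f (t i) - f (t i).flip) := by
  have h1 : downDiscriminant K p f τ = ((1 / Real.sqrt (2 * downDegree K p τ) : ℝ) : ℂ) *
      ∑' x : AdjTo K p τ, (eta x.edge : ℂ) * (boundaryOp K p).adjoint f x.edge.rev := rfl
  have h2 : ∀ x : AdjTo K p τ, (eta x.edge : ℂ) * (boundaryOp K p).adjoint f x.edge.rev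
      = (etaCoeff τ x.target : ℂ) * (((1 / Real.sqrt (2 * m) : ℝ) : ℂ) * f x.target) := by
    intro x
    rw [etaCoeff_edge, adjoint_boundaryOp_apply, hm]
    rfl
  rw [h1, tsum_congr h2,
    ht.tsum_adjTo fun τ' => (etaCoeff τ τ' : ℂ) * (((1 / Real.sqrt (2 * m) : ℝ) : ℂ) * f τ'), hm,
    ← sqrt_inv_mul_sqrt_inv, mul_assoc]
  congr 1
  rw [Finset.mul_sum]
  refine Finset.sum_congr rfl fun i _ => ?_
  rw [etaCoeff_flip_right]
  push_cast
  ring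

theorem downDiscriminant_apply_flip {m : ℕ}
    (hm : ∀ τ : OrientedSimplex K (p + 1), downDegree K p τ = m)
    {τ : OrientedSimplex K (p + 1)} {ι : Type*} [Fintype ι] {t : ι → OrientedSimplex K (p + 1)}
    (ht : IsNeighborFamily τ t) (f : EllTwo (OrientedSimplex K (p + 1))) :
    downDiscriminant K p f τ.flip = -downDiscriminant K p f τ := by
  rw [downDiscriminant_apply hm ht, downDiscriminant_apply hm ht.flip, ← mul_neg,
    ← Finset.sum_neg_distrib]
  congr 1
  refine Finset.sum_congr rfl fun i _ => ?_
  rw [etaCoeff_flip_left]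
  push_cast
  ring

/-- The operator `f ↦ f ∘ flip`. -/
def flipOp (K : AbstractSimplicialComplex V) (p : ℕ) :
    EllTwo (OrientedSimplex K (p + 1)) →L[ℂ] EllTwo (OrientedSimplex K (p + 1)) :=
  pullbackOp OrientedSimplex.flip
    (Function.LeftInverse.injective (g := OrientedSimplex.flip) OrientedSimplex.flip_flip)

/-- Functions which do not depend on the orientation are in the kernel of the discriminant. -/
theorem zero_mem_pointSpectrum {m : ℕ}
    (hm : ∀ τ : OrientedSimplex K (p + 1), downDegree K p τ = m)
    (h : ∀ τ : OrientedSimplex K (p + 1), ∃ (ι : Type) (_ : Fintype ι)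
      (t : ι → OrientedSimplex K (p + 1)), IsNeighborFamily τ t)
    [Nonempty (OrientedSimplex K (p + 1))] : 0 ∈ pointSpectrum (downDiscriminant K p) := by
  classical
  obtain ⟨τ₀⟩ := ‹Nonempty (OrientedSimplex K (p + 1))›
  set f : EllTwo (OrientedSimplex K (p + 1)) := lp.single 2 τ₀ 1 with hf
  have h1 : ∀ τ, (f + flipOp K p f) τ = f τ + f τ.flip := fun _ => rfl
  refine mem_pointSpectrum.mpr ⟨f + flipOp K p f, fun h0 => ?_, ?_⟩
  · have h2 := h1 τ₀
    rw [h0, hf, lp.single_apply_self, lp.single_apply, Pi.single_eq_of_ne τ₀.flip_ne] at h2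
    simp at h2
  · rw [zero_smul]
    ext τ
    obtain ⟨ι, _, t, ht⟩ := h τ
    rw [downDiscriminant_apply hm ht]
    simp only [h1, OrientedSimplex.flip_flip]
    rw [Finset.sum_eq_zero fun i _ => by ring, mul_zero]
    rfl

end Formula

/-! ### The edges of the cylinder -/

section Edges

theorem ne_zero_of_mem_adjVec {δ : ZMod 3 × ℤ} (h : δ ∈ adjVec) : δ ≠ 0 := by
  rintro rfl
  revert h
  decide

theorem pair_mem_cylinder (v : ZMod 3 × ℤ) {δ : ZMod 3 × ℤ} (h : δ ∈ adjVec) :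
    {v, v + δ} ∈ cylinder.faces := by
  obtain ⟨l, n⟩ := v
  refine ⟨by simp, ?_⟩
  simp only [adjVec, Finset.mem_insert, Finset.mem_singleton] at h
  rcases h with rfl | rfl | rfl | rfl | rfl | rfl
  · exact ⟨l, n, Or.inr (by simp [sigmaTriangle, Finset.insert_subset_iff])⟩
  · exact ⟨l - 1, n, Or.inr (by simp [sigmaTriangle, Finset.insert_subset_iff, sub_eq_add_neg])⟩
  · exact ⟨l, n, Or.inl (by simp [rhoTriangle, Finset.insert_subset_iff])⟩
  · exact ⟨l, n - 1, Or.inl (by simp [rhoTriangle, Finset.insert_subset_iff, sub_eq_add_neg])⟩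
  · exact ⟨l, n, Or.inl (by simp [rhoTriangle, Finset.insert_subset_iff])⟩
  · exact ⟨l - 1, n - 1,
      Or.inl (by simp [rhoTriangle, Finset.insert_subset_iff, sub_eq_add_neg])⟩

theorem sub_mem_adjVec {a b : ZMod 3 × ℤ} (hab : a ≠ b) {F : Finset (ZMod 3 × ℤ)}
    (hF : F ∈ cylinder.faces) (ha : a ∈ F) (hb : b ∈ F) : b - a ∈ adjVec := by
  obtain ⟨-, l, n, h | h⟩ := hF
  · have ha' := h ha
    have hb' := h hb
    simp only [rhoTriangle, Finset.mem_insert, Finset.mem_singleton] at ha' hb'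
    rcases ha' with rfl | rfl | rfl <;> rcases hb' with rfl | rfl | rfl <;>
      first
        | exact absurd rfl hab
        | simp [adjVec]
  · have ha' := h ha
    have hb' := h hb
    simp only [sigmaTriangle, Finset.mem_insert, Finset.mem_singleton] at ha' hb'
    rcases ha' with rfl | rfl | rfl <;> rcases hb' with rfl | rfl | rfl <;>
      first
        | exact absurd rfl hab
        | simp [adjVec]

theorem OrderedSimplex.map_mem {V : Type*} {K : AbstractSimplicialComplex V} {q : ℕ}
    {a : Fin (q + 1) → V} {ha : Function.Injective a} {F : Finset V} (hF : F ∈ K.faces)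
    (h : ∀ w, w ∈ F ↔ ∃ i, a i = w) : Finset.univ.map ⟨a, ha⟩ ∈ K.faces := by
  have : Finset.univ.map ⟨a, ha⟩ = F := by
    ext w
    simp [h]
  rwa [this]

/-- The ordered edge from `v` to `v + δ`. -/
def orderedEdge (v : ZMod 3 × ℤ) (δ : adjVec) : OrderedSimplex cylinder (0 + 1) where
  vertex := ![v, v + δ]
  injective := by
    have h := ne_zero_of_mem_adjVec δ.2
    intro i j hij
    fin_cases i <;> fin_cases j <;> simp_all
  mem := by
    refine OrderedSimplex.map_mem (pair_mem_cylinder v δ.2) fun w => ?_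
    rw [Fin.exists_fin_two, Finset.mem_insert, Finset.mem_singleton, eq_comm, @eq_comm _ w]
    rfl

/-- The oriented edge from `v` to `v + δ`. -/
def edge (v : ZMod 3 × ℤ) (δ : adjVec) : OrientedSimplex cylinder (0 + 1) :=
  (orderedEdge v δ).oriented

/-- The opposite difference vector. -/
def negVec (δ : adjVec) : adjVec := ⟨-δ, neg_mem_adjVec δ.2⟩

theorem support_edge (v : ZMod 3 × ℤ) (δ : adjVec) : (edge v δ).support = {v, v + ↑δ} := by
  ext w
  rw [edge, OrderedSimplex.support_oriented, OrderedSimplex.mem_support]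
  simp [orderedEdge, Fin.exists_fin_two, eq_comm]

theorem flip_edge (v : ZMod 3 × ℤ) (δ : adjVec) : (edge v δ).flip = edge (v + δ) (negVec δ) := by
  rw [edge, OrientedSimplex.flip_oriented]
  refine congrArg OrderedSimplex.oriented (OrderedSimplex.ext_vertex (funext fun i => ?_))
  fin_cases i <;> simp [OrderedSimplex.perm, orderedEdge, negVec]

theorem exists_edge (τ : OrientedSimplex cylinder (0 + 1)) : ∃ v δ, τ = edge v δ := by
  obtain ⟨s, rfl⟩ := τ.exists_rep
  have hne : s.vertex 0 ≠ s.vertex 1 := fun h => by simpa using s.injective h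
  refine ⟨s.vertex 0, ⟨s.vertex 1 - s.vertex 0, sub_mem_adjVec hne s.mem ?_ ?_⟩, ?_⟩
  · exact (s.mem_support _).mpr ⟨0, rfl⟩
  · exact (s.mem_support _).mpr ⟨1, rfl⟩
  · refine congrArg OrderedSimplex.oriented (OrderedSimplex.ext_vertex (funext fun i => ?_))
    fin_cases i <;> simp [orderedEdge]

theorem edge_inj {v w : ZMod 3 × ℤ} {δ ε : adjVec} : edge v δ = edge w ε ↔ v = w ∧ δ = ε := by
  constructor
  · intro h
    obtain ⟨π, hπ, h⟩ := OrderedSimplex.oriented_eq_iff.mp h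
    -- Two letters have no nontrivial even permutation, so an oriented edge is the same as an
    -- ordered pair.
    have hone : ∀ π : Equiv.Perm (Fin 2), Equiv.Perm.sign π = 1 → π = 1 := by decide
    obtain rfl := hone π hπ
    have h0 := congrFun (congrArg OrderedSimplex.vertex h) 0
    have h1 := congrFun (congrArg OrderedSimplex.vertex h) 1
    simp only [orderedEdge, OrderedSimplex.perm, Equiv.Perm.coe_one, Function.comp_apply, id,
      Matrix.cons_val_zero, Matrix.cons_val_one] at h0 h1
    subst h0
    exact ⟨rfl, Subtype.ext (add_left_cancel h1).symm⟩
  · rintro ⟨rfl, rfl⟩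
    rfl

theorem edge_left_injective (δ : adjVec) : Function.Injective fun v => edge v δ :=
  fun _ _ h => (edge_inj.mp h).1

theorem singleton_mem_cylinder (v : ZMod 3 × ℤ) : {v} ∈ cylinder.faces :=
  cylinder.singleton_mem v

/-- A vertex as a `0`-simplex. -/
def orderedVertex (v : ZMod 3 × ℤ) : OrderedSimplex cylinder 0 where
  vertex := fun _ => v
  injective := fun i j _ => Subsingleton.elim (α := Fin 1) i j
  mem := by
    refine OrderedSimplex.map_mem (singleton_mem_cylinder v) fun w => ?_
    rw [Finset.mem_singleton, eq_comm]
    exact ⟨fun h => ⟨0, h⟩, fun ⟨_, h⟩ => h⟩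

theorem support_orderedVertex (v : ZMod 3 × ℤ) : (orderedVertex v).oriented.support = {v} := by
  ext w
  rw [OrderedSimplex.support_oriented, OrderedSimplex.mem_support]
  simp [orderedVertex, eq_comm]

theorem sgn_edge_left (v : ZMod 3 × ℤ) (δ : adjVec) :
    sgn (edge v δ) (orderedVertex v).oriented = -1 := by
  rw [edge, OrderedSimplex.sgn_eq_of_vertex 1 1]
  · simp
  · intro i
    fin_cases i
    simp [orderedVertex, orderedEdge]

theorem sgn_edge_right (v : ZMod 3 × ℤ) (δ : adjVec) :
    sgn (edge v δ) (orderedVertex (v + δ)).oriented = 1 := by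
  rw [edge, OrderedSimplex.sgn_eq_of_vertex 0 1]
  · simp
  · intro i
    fin_cases i
    simp [orderedVertex, orderedEdge]

/-- The edges which share exactly one vertex with `edge v δ`. -/
def edgeNeighbor (v : ZMod 3 × ℤ) (δ : adjVec) :
    {ε : adjVec // ε ≠ negVec δ} ⊕ {ε : adjVec // ε ≠ δ} → OrientedSimplex cylinder (0 + 1) :=
  Sum.elim (fun ε => edge (v + δ) ε) (fun ε => edge v ε)

theorem inter_edge_right (v : ZMod 3 × ℤ) (δ : adjVec) (ε : {ε : adjVec // ε ≠ negVec δ}) :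
    (edge v δ).support ∩ (edge (v + δ) ε).support = {v + ↑δ} := by
  have h1 := ne_zero_of_mem_adjVec δ.2
  have h3 : v ≠ v + δ + ε.1 := by
    intro h
    refine ε.2 (Subtype.ext ?_)
    rw [add_assoc, left_eq_add] at h
    exact (neg_eq_of_add_eq_zero_right h).symm
  rw [support_edge, support_edge]
  ext w
  simp only [Finset.mem_inter, Finset.mem_insert, Finset.mem_singleton]
  constructor
  · rintro ⟨rfl | rfl, h | h⟩
    · exact h
    · exact absurd h h3
    · rfl
    · rfl
  · rintro rfl
    exact ⟨Or.inr rfl, Or.inl rfl⟩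

theorem inter_edge_left (v : ZMod 3 × ℤ) (δ : adjVec) (ε : {ε : adjVec // ε ≠ δ}) :
    (edge v δ).support ∩ (edge v ε).support = {v} := by
  have h1 := ne_zero_of_mem_adjVec δ.2
  rw [support_edge, support_edge]
  ext w
  simp only [Finset.mem_inter, Finset.mem_insert, Finset.mem_singleton]
  constructor
  · rintro ⟨rfl | rfl, h | h⟩
    · rfl
    · rfl
    · exact h
    · exact absurd (Subtype.ext (add_left_cancel h).symm) ε.2
  · rintro rfl
    exact ⟨Or.inl rfl, Or.inl rfl⟩

theorem isNeighborFamily_edge (v : ZMod 3 × ℤ) (δ : adjVec) :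
    IsNeighborFamily (edge v δ) (edgeNeighbor v δ) where
  injective := by
    have hδ := ne_zero_of_mem_adjVec δ.2
    have key : ∀ (w : ZMod 3 × ℤ) (a b : adjVec),
        ({w, w + ↑a} : Finset (ZMod 3 × ℤ)) = {w, w + ↑b} → a = b := by
      intro w a b h
      have h1 : w + ↑a ∈ ({w, w + ↑b} : Finset (ZMod 3 × ℤ)) := h ▸ by simp
      simp only [Finset.mem_insert, Finset.mem_singleton, add_eq_left,
        ne_zero_of_mem_adjVec a.2, false_or] at h1
      exact Subtype.ext (add_left_cancel h1)
    have key2 : ∀ (a : {ε : adjVec // ε ≠ negVec δ}) (b : {ε : adjVec // ε ≠ δ}),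
        (edge (v + δ) a).support ≠ (edge v b).support := by
      intro a b h
      have h1 := inter_edge_right v δ a
      rw [h, inter_edge_left, Finset.singleton_inj, left_eq_add] at h1
      exact hδ h1
    rintro (a | a) (b | b) h
    · simp only [edgeNeighbor, Sum.elim_inl, support_edge] at h
      exact congrArg _ (Subtype.ext (key _ _ _ h))
    · exact absurd h (key2 a b)
    · exact absurd h.symm (key2 b a)
    · simp only [edgeNeighbor, Sum.elim_inr, support_edge] at h
      exact congrArg _ (Subtype.ext (key _ _ _ h))
  downNeighbor_iff := by
    intro τ'
    constructor
    · rintro ⟨-, hc'⟩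
      have hc : ((edge v δ).support ∩ τ'.support).card = 1 := hc'
      obtain ⟨w, ε, rfl⟩ := exists_edge τ'
      have key : ∀ x ∈ (edge w ε).support, ∃ κ : adjVec, (edge w ε).support = (edge x κ).support := by
        intro x hx
        rw [support_edge, Finset.mem_insert, Finset.mem_singleton] at hx
        rcases hx with rfl | rfl
        · exact ⟨ε, rfl⟩
        · exact ⟨negVec ε, by rw [← flip_edge, OrientedSimplex.support_flip]⟩
      obtain ⟨x, hx⟩ := Finset.card_eq_one.mp hc
      have hx1 : x ∈ (edge v δ).support ∩ (edge w ε).support := by rw [hx]; simp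
      obtain ⟨hx1, hx2⟩ := Finset.mem_inter.mp hx1
      obtain ⟨κ, hκ⟩ := key x hx2
      rw [hκ] at hc ⊢
      rw [support_edge, Finset.mem_insert, Finset.mem_singleton] at hx1
      rcases hx1 with rfl | rfl
      · refine ⟨Sum.inr ⟨κ, ?_⟩, rfl⟩
        rintro rfl
        rw [Finset.inter_self, OrientedSimplex.card_support] at hc
        omega
      · refine ⟨Sum.inl ⟨κ, ?_⟩, rfl⟩
        rintro rfl
        rw [← flip_edge, OrientedSimplex.support_flip, Finset.inter_self,
          OrientedSimplex.card_support] at hc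
        omega
    · rintro ⟨i, hi⟩
      rw [DownNeighbor, hi]
      rcases i with a | a
      · have h := inter_edge_right v δ a
        rw [edgeNeighbor, Sum.elim_inl, h]
        exact ⟨singleton_mem_cylinder _, rfl⟩
      · have h := inter_edge_left v δ a
        rw [edgeNeighbor, Sum.elim_inr, h]
        exact ⟨singleton_mem_cylinder _, rfl⟩

/-- Each endpoint has six edges, one of which is the given edge: 2 · (6 - 1) = 10. -/
theorem downDegree_edges (τ : OrientedSimplex cylinder (0 + 1)) : downDegree cylinder 0 τ = 10 := by
  obtain ⟨v, δ, rfl⟩ := exists_edge τ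
  rw [(isNeighborFamily_edge v δ).downDegree_eq, Fintype.card_sum, Fintype.card_subtype_compl,
    Fintype.card_subtype_compl, Fintype.card_subtype_eq, Fintype.card_subtype_eq,
    Fintype.card_coe]
  rfl

theorem exists_neighborFamily_edges (τ : OrientedSimplex cylinder (0 + 1)) :
    ∃ (ι : Type) (_ : Fintype ι) (t : ι → OrientedSimplex cylinder (0 + 1)),
      IsNeighborFamily τ t := by
  obtain ⟨v, δ, rfl⟩ := exists_edge τ
  exact ⟨_, inferInstance, _, isNeighborFamily_edge v δ⟩

theorem isWalkPair_edges : IsWalkPair (boundaryOp cylinder 0) (shiftOp cylinder 0) :=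
  isWalkPair_of_neighborFamily fun τ =>
    ⟨by rw [downDegree_edges]; norm_num, exists_neighborFamily_edges τ⟩

/-- The common vertex ends one edge and begins the other, so the signs differ; in
`etaCoeff_edge_left` it begins both. -/
theorem etaCoeff_edge_right (v : ZMod 3 × ℤ) (δ : adjVec) (ε : {ε : adjVec // ε ≠ negVec δ}) :
    etaCoeff (edge v δ) (edge (v + δ) ε) = -1 := by
  have hd : DownNeighbor cylinder 0 (edge v δ).support (edge (v + δ) ε).support :=
    ((isNeighborFamily_edge v δ).downNeighbor_iff _).mpr ⟨Sum.inl ε, rfl⟩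
  rw [etaCoeff_eq (μ := (orderedVertex (v + δ)).oriented) hd
    (by rw [support_orderedVertex, inter_edge_right]), sgn_edge_right, sgn_edge_left]
  rfl

theorem etaCoeff_edge_left (v : ZMod 3 × ℤ) (δ : adjVec) (ε : {ε : adjVec // ε ≠ δ}) :
    etaCoeff (edge v δ) (edge v ε) = 1 := by
  have hd : DownNeighbor cylinder 0 (edge v δ).support (edge v ε).support :=
    ((isNeighborFamily_edge v δ).downNeighbor_iff _).mpr ⟨Sum.inr ε, rfl⟩
  rw [etaCoeff_eq (μ := (orderedVertex v).oriented) hd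
    (by rw [support_orderedVertex, inter_edge_left]), sgn_edge_left, sgn_edge_left]
  rfl

end Edges

/-! ### The discriminant on the edges -/

section EdgeDiscriminant

/-- The boundary operator from functions on the edges to functions on the vertices. -/
def vertexBoundary : EllTwo (OrientedSimplex cylinder (0 + 1)) →L[ℂ] EllTwo (ZMod 3 × ℤ) :=
  -∑ δ : adjVec, pullbackOp (fun v => edge v δ) (edge_left_injective δ) ∘L (1 - flipOp cylinder 0)

theorem vertexBoundary_apply (f : EllTwo (OrientedSimplex cylinder (0 + 1))) (v : ZMod 3 × ℤ) :
    vertexBoundary f v = -∑ δ : adjVec, (f (edge v δ) - f (edge v δ).flip) := by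
  have h : vertexBoundary f = -∑ δ : adjVec,
      pullbackOp (fun v => edge v δ) (edge_left_injective δ) (f - flipOp cylinder 0 f) := by
    simp [vertexBoundary]
  rw [h]
  change -((∑ δ : adjVec, pullbackOp (fun v => edge v δ) (edge_left_injective δ)
    (f - flipOp cylinder 0 f) : EllTwo (ZMod 3 × ℤ)) v) = _
  rw [lp.coeFn_sum, Finset.sum_apply]
  rfl

theorem vertexBoundary_single (v : ZMod 3 × ℤ) (δ : adjVec) [DecidableEq
    (OrientedSimplex cylinder (0 + 1))] :
    vertexBoundary (lp.single 2 (edge v δ) 1) = lp.single 2 (v + ↑δ) 1 - lp.single 2 v 1 := by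
  ext w
  have h1 : (lp.single 2 (v + ↑δ) 1 - lp.single 2 v 1 : EllTwo (ZMod 3 × ℤ)) w
    = (lp.single 2 (v + ↑δ) 1 : EllTwo (ZMod 3 × ℤ)) w
      - (lp.single 2 v 1 : EllTwo (ZMod 3 × ℤ)) w := rfl
  have h2 : ∀ ε : adjVec, (edge w ε).flip = edge v δ ↔ w = v + δ ∧ ε = negVec δ := by
    intro ε
    rw [← edge_inj, ← flip_edge]
    constructor
    · intro h
      rw [← h, OrientedSimplex.flip_flip]
    · intro h
      rw [h, OrientedSimplex.flip_flip]
  rw [vertexBoundary_apply, h1]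
  simp only [lp.single_apply, Pi.single_apply, h2, edge_inj, ite_and, Finset.sum_sub_distrib]
  split_ifs <;> simp

theorem adjoint_vertexBoundary_apply (u : EllTwo (ZMod 3 × ℤ)) (v : ZMod 3 × ℤ) (δ : adjVec) :
    vertexBoundary.adjoint u (edge v δ) = u (v + δ) - u v := by
  classical
  have h1 : vertexBoundary.adjoint u (edge v δ)
      = ⟪lp.single 2 (edge v δ) (1 : ℂ), vertexBoundary.adjoint u⟫_ℂ := by
    rw [lp.inner_single_left]; simp
  rw [h1, ContinuousLinearMap.adjoint_inner_right, vertexBoundary_single, inner_sub_left,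
    lp.inner_single_left, lp.inner_single_left]
  simp

theorem flipOp_apply {V : Type*} [DecidableEq V] {K : AbstractSimplicialComplex V} {p : ℕ}
    (f : EllTwo (OrientedSimplex K (p + 1))) (τ : OrientedSimplex K (p + 1)) :
    flipOp K p f τ = f τ.flip := rfl

theorem norm_flipOp {V : Type*} [DecidableEq V] {K : AbstractSimplicialComplex V} {p : ℕ}
    (f : EllTwo (OrientedSimplex K (p + 1))) : ‖flipOp K p f‖ = ‖f‖ :=
  norm_pullbackOp_equiv (⟨OrientedSimplex.flip, OrientedSimplex.flip, OrientedSimplex.flip_flip,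
    OrientedSimplex.flip_flip⟩ : OrientedSimplex K (p + 1) ≃ OrientedSimplex K (p + 1)) f

theorem flipOp_flipOp {V : Type*} [DecidableEq V] {K : AbstractSimplicialComplex V} {p : ℕ}
    (f : EllTwo (OrientedSimplex K (p + 1))) : flipOp K p (flipOp K p f) = f := by
  ext τ
  rw [flipOp_apply, flipOp_apply, OrientedSimplex.flip_flip]

theorem vertexBoundary_flipOp (f : EllTwo (OrientedSimplex cylinder (0 + 1))) :
    vertexBoundary (flipOp cylinder 0 f) = -vertexBoundary f := by
  ext v
  change _ = -(vertexBoundary f v)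
  rw [vertexBoundary_apply, vertexBoundary_apply]
  congr 1
  rw [← Finset.sum_neg_distrib]
  refine Finset.sum_congr rfl fun δ _ => ?_
  rw [flipOp_apply, flipOp_apply, OrientedSimplex.flip_flip]
  ring

theorem flipOp_adjoint_vertexBoundary (u : EllTwo (ZMod 3 × ℤ)) :
    flipOp cylinder 0 (vertexBoundary.adjoint u) = -vertexBoundary.adjoint u := by
  ext τ
  obtain ⟨v, δ, rfl⟩ := exists_edge τ
  change vertexBoundary.adjoint u (edge v δ).flip = -(vertexBoundary.adjoint u (edge v δ))
  rw [flip_edge, adjoint_vertexBoundary_apply, adjoint_vertexBoundary_apply]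
  simp [negVec]

/-- The divergence of a gradient is the graph Laplacian; the factor 2 arises because both
orientations of every edge are counted. -/
theorem vertexBoundary_adjoint (u : EllTwo (ZMod 3 × ℤ)) :
    vertexBoundary (vertexBoundary.adjoint u) = (2 : ℂ) • laplaceOp u := by
  ext v
  change _ = 2 * laplaceOp u v
  rw [vertexBoundary_apply, laplaceOp_apply, ← Finset.sum_coe_sort adjVec fun δ => u (v + δ)]
  have h : ∀ δ : adjVec, vertexBoundary.adjoint u (edge v δ)
      - vertexBoundary.adjoint u (edge v δ).flip = 2 * u (v + δ) - 2 * u v := by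
    intro δ
    rw [flip_edge, adjoint_vertexBoundary_apply, adjoint_vertexBoundary_apply]
    simp only [negVec, add_neg_cancel_right]
    ring
  rw [Finset.sum_congr rfl fun δ _ => h δ, Finset.sum_sub_distrib, Finset.sum_const,
    ← Finset.mul_sum, Finset.card_univ, Fintype.card_coe]
  have hc : adjVec.card = 6 := rfl
  rw [hc]
  simp
  ring

/-- The sum over the ten neighbors is the difference of the boundaries at the two endpoints with the
edge itself removed from each; the two removed terms give the correction -2(f - f ∘ flip). -/
theorem edgeDiscriminant_eq (f : EllTwo (OrientedSimplex cylinder (0 + 1))) :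
    (20 : ℂ) • downDiscriminant cylinder 0 f
      = vertexBoundary.adjoint (vertexBoundary f) - (2 : ℂ) • (f - flipOp cylinder 0 f) := by
  ext τ
  obtain ⟨v, δ, rfl⟩ := exists_edge τ
  change 20 * downDiscriminant cylinder 0 f (edge v δ)
    = vertexBoundary.adjoint (vertexBoundary f) (edge v δ) - 2 * (f (edge v δ) - f (edge v δ).flip)
  rw [adjoint_vertexBoundary_apply,
    downDiscriminant_apply downDegree_edges (isNeighborFamily_edge v δ), Fintype.sum_sum_type]
  simp only [edgeNeighbor, Sum.elim_inl, Sum.elim_inr, etaCoeff_edge_right, etaCoeff_edge_left]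
  rw [vertexBoundary_apply, vertexBoundary_apply,
    Fintype.sum_eq_add_sum_subtype_ne _ (negVec δ),
    Fintype.sum_eq_add_sum_subtype_ne (fun ε => f (edge v ε) - f (edge v ε).flip) δ,
    ← flip_edge, OrientedSimplex.flip_flip]
  push_cast
  simp only [neg_mul, one_mul, Finset.sum_neg_distrib]
  ring

/-- Gradients are odd, so the flip correction is -4 there and 20 D ∂* = ∂*(2Δ - 4). This transports
approximate eigenvectors from vertices to edges. -/
theorem edgeDiscriminant_adjoint (u : EllTwo (ZMod 3 × ℤ)) :
    (10 : ℂ) • downDiscriminant cylinder 0 (vertexBoundary.adjoint u)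
      = vertexBoundary.adjoint (laplaceOp u - (2 : ℂ) • u) := by
  have h := edgeDiscriminant_eq (vertexBoundary.adjoint u)
  rw [vertexBoundary_adjoint, flipOp_adjoint_vertexBoundary, map_smul] at h
  refine smul_right_injective _ (two_ne_zero (α := ℂ)) ?_
  simp only [smul_smul, map_sub, map_smul, smul_sub]
  rw [show (2 : ℂ) * 10 = 20 by norm_num, h]
  module

theorem vertexBoundary_edgeDiscriminant (f : EllTwo (OrientedSimplex cylinder (0 + 1))) :
    (10 : ℂ) • vertexBoundary (downDiscriminant cylinder 0 f)
      = laplaceOp (vertexBoundary f) - (2 : ℂ) • vertexBoundary f := by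
  have h := congrArg vertexBoundary (edgeDiscriminant_eq f)
  rw [map_sub, vertexBoundary_adjoint, map_smul, map_smul, map_sub, vertexBoundary_flipOp] at h
  refine smul_right_injective _ (two_ne_zero (α := ℂ)) ?_
  simp only [smul_smul, smul_sub]
  rw [show (2 : ℂ) * 10 = 20 by norm_num, h]
  module

/-! ### Eigenvalues of the discriminant on the edges. -/

theorem eq_zero_of_laplaceOp {u : EllTwo (ZMod 3 × ℤ)} {x : ℂ} (h : laplaceOp u = x • u) :
    u = 0 := by
  refine eq_zero_of_triOp (x := 9 - x) ?_
  rw [sub_smul, ← h, laplaceOp_eq, sub_sub_cancel]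

/-- A nonzero boundary would be an ℓ² eigenvector of Δ with eigenvalue 10 z + 2, and Δ has none. -/
theorem vertexBoundary_eq_zero {f : EllTwo (OrientedSimplex cylinder (0 + 1))} {z : ℂ}
    (h : downDiscriminant cylinder 0 f = z • f) : vertexBoundary f = 0 := by
  have h1 := vertexBoundary_edgeDiscriminant f
  rw [h, map_smul] at h1
  refine eq_zero_of_laplaceOp (x := 10 * z + 2) ?_
  rw [← sub_add_cancel (laplaceOp (vertexBoundary f)) ((2 : ℂ) • vertexBoundary f), ← h1]
  module

/-- On cycles D = -(1 - flip)/10, which is 0 on even functions and -1/5 on odd ones. -/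
theorem pointSpectrum_edgeDiscriminant_subset :
    pointSpectrum (downDiscriminant cylinder 0) ⊆ {((-1 / 5 : ℝ) : ℂ), 0} := by
  intro z hz
  obtain ⟨f, hf0, hf⟩ := mem_pointSpectrum.mp hz
  have h := edgeDiscriminant_eq f
  rw [vertexBoundary_eq_zero hf, hf, map_zero, zero_sub] at h
  have h2 := congrArg (flipOp cylinder 0) h
  simp only [map_smul, map_neg, map_sub, flipOp_flipOp] at h2
  rcases eq_or_ne z 0 with hz0 | hz0
  · exact Or.inr hz0
  have h3 : flipOp cylinder 0 f = -f := by
    have h4 : (20 * z) • (flipOp cylinder 0 f + f) = 0 := by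
      have : (20 * z) • (flipOp cylinder 0 f + f)
        = (20 : ℂ) • z • flipOp cylinder 0 f + (20 : ℂ) • z • f := by module
      rw [this, h, h2]
      module
    rw [smul_eq_zero] at h4
    exact eq_neg_of_add_eq_zero_left (h4.resolve_left (by simp [hz0]))
  rw [h3] at h
  have h5 : (20 * z + 4) • f = 0 := by
    have : (20 * z + 4) • f = (20 : ℂ) • z • f + (4 : ℂ) • f := by module
    rw [this, h]
    module
  left
  have h6 := (smul_eq_zero.mp h5).resolve_right hf0
  push_cast
  linear_combination h6 / 20

theorem neg_one_fifth_mem_pointSpectrum :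
    ((-1 / 5 : ℝ) : ℂ) ∈ pointSpectrum (downDiscriminant cylinder 0) := by
  classical
  let δ : adjVec := ⟨(1, 0), by decide⟩
  -- The closed path of three horizontal edges around the cylinder is a finitely supported cycle;
  -- its odd part is the eigenvector.
  let g : EllTwo (OrientedSimplex cylinder (0 + 1)) :=
    lp.single 2 (edge (0, 0) δ) 1 + lp.single 2 (edge (1, 0) δ) 1 + lp.single 2 (edge (2, 0) δ) 1
  have hg : vertexBoundary g = 0 := by
    simp only [g, map_add, vertexBoundary_single]
    have e0 : ((0, 0) : ZMod 3 × ℤ) + δ.1 = (1, 0) := by decide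
    have e1 : ((1, 0) : ZMod 3 × ℤ) + δ.1 = (2, 0) := by decide
    have e2 : ((2, 0) : ZMod 3 × ℤ) + δ.1 = (0, 0) := by decide
    rw [e0, e1, e2]
    abel
  have hgv : ∀ τ, g τ = (lp.single 2 (edge (0, 0) δ) 1 : EllTwo _) τ
      + (lp.single 2 (edge (1, 0) δ) 1 : EllTwo _) τ
      + (lp.single 2 (edge (2, 0) δ) 1 : EllTwo _) τ := fun _ => rfl
  refine mem_pointSpectrum.mpr ⟨g - flipOp cylinder 0 g, fun h0 => ?_, ?_⟩
  · have h1 : (g - flipOp cylinder 0 g) (edge (0, 0) δ)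
        = g (edge (0, 0) δ) - g (edge (0, 0) δ).flip := rfl
    rw [h0, hgv, hgv, flip_edge] at h1
    have hn : negVec δ ≠ δ := by decide
    have h01 : (0 : ZMod 3) ≠ 2 := by decide
    simp [lp.single_apply, edge_inj, hn, h01] at h1
  · refine smul_right_injective _ (show (20 : ℂ) ≠ 0 by norm_num) ?_
    simp only []
    rw [edgeDiscriminant_eq, map_sub vertexBoundary, vertexBoundary_flipOp, hg, map_sub (flipOp _ _),
      flipOp_flipOp]
    simp only [neg_zero, sub_zero, map_zero]
    push_cast
    module

/-! ### Bounds for the quadratic form of the discriminant on the edges. -/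

theorem norm_sub_flipOp_sq {V : Type*} [DecidableEq V] {K : AbstractSimplicialComplex V} {p : ℕ}
    (f : EllTwo (OrientedSimplex K (p + 1))) :
    ‖f - flipOp K p f‖ ^ 2 = 2 * (⟪f - flipOp K p f, f⟫_ℂ).re := by
  have h := @norm_sub_sq ℂ _ _ _ _ f (flipOp K p f)
  rw [norm_flipOp] at h
  have h2 : (⟪f - flipOp K p f, f⟫_ℂ).re = ‖f‖ ^ 2 - (⟪f, flipOp K p f⟫_ℂ).re := by
    rw [inner_sub_left, Complex.sub_re, ← inner_conj_symm (flipOp K p f) f, Complex.conj_re]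
    congr 1
    exact @inner_self_eq_norm_sq ℂ _ _ _ _ f
  rw [h, h2]
  simp only [RCLike.re_to_complex]
  ring

/-- The operator 1 - flip is self-adjoint with square 2(1 - flip), so the flip term is itself a
squared norm. -/
theorem re_inner_edgeDiscriminant (f : EllTwo (OrientedSimplex cylinder (0 + 1))) :
    20 * (⟪downDiscriminant cylinder 0 f, f⟫_ℂ).re
      = ‖vertexBoundary f‖ ^ 2 - ‖f - flipOp cylinder 0 f‖ ^ 2 := by
  have h := congrArg (fun g => (⟪g, f⟫_ℂ).re) (edgeDiscriminant_eq f)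
  simp only [inner_sub_left, inner_smul_left, ContinuousLinearMap.adjoint_inner_left] at h
  rw [← inner_sub_left, Complex.sub_re] at h
  have c1 : starRingEnd ℂ 20 = ((20 : ℝ) : ℂ) := Complex.conj_ofNat 20
  have c2 : starRingEnd ℂ 2 = ((2 : ℝ) : ℂ) := Complex.conj_ofNat 2
  rw [c1, c2, Complex.re_ofReal_mul, Complex.re_ofReal_mul, ← norm_sub_flipOp_sq] at h
  rw [h]
  congr 1
  exact @inner_self_eq_norm_sq ℂ _ _ _ _ _

theorem norm_adjoint_vertexBoundary_sq_le (u : EllTwo (ZMod 3 × ℤ)) :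
    ‖vertexBoundary.adjoint u‖ ^ 2 ≤ 18 * ‖u‖ ^ 2 := by
  have h1 : ‖vertexBoundary.adjoint u‖ ^ 2 = 2 * (⟪laplaceOp u, u⟫_ℂ).re := by
    rw [← @inner_self_eq_norm_sq ℂ, ← ContinuousLinearMap.adjoint_inner_left,
      ContinuousLinearMap.adjoint_adjoint, vertexBoundary_adjoint, inner_smul_left]
    have c2 : starRingEnd ℂ 2 = ((2 : ℝ) : ℂ) := Complex.conj_ofNat 2
    rw [c2]
    exact Complex.re_ofReal_mul _ _
  linarith [re_inner_laplaceOp_le u]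

/-- An operator and its adjoint satisfy the same norm bound; here 18 = 2 · 9 comes from ∂∂* = 2Δ ≤
18. -/
theorem norm_vertexBoundary_sq_le (f : EllTwo (OrientedSimplex cylinder (0 + 1))) :
    ‖vertexBoundary f‖ ^ 2 ≤ 18 * ‖f‖ ^ 2 := by
  have h1 : ‖vertexBoundary f‖ ^ 2 ≤ ‖vertexBoundary.adjoint (vertexBoundary f)‖ * ‖f‖ := by
    rw [← @inner_self_eq_norm_sq ℂ, ← ContinuousLinearMap.adjoint_inner_left]
    exact (Complex.re_le_norm _).trans (norm_inner_le_norm _ _)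
  have h2 := norm_adjoint_vertexBoundary_sq_le (vertexBoundary f)
  rcases (norm_nonneg (vertexBoundary f)).eq_or_lt with h0 | h0
  · rw [← h0]
    nlinarith [sq_nonneg ‖f‖]
  · have h3 : (‖vertexBoundary f‖ ^ 2) ^ 2
        ≤ (‖vertexBoundary.adjoint (vertexBoundary f)‖ * ‖f‖) ^ 2 := by gcongr
    have h4 : ‖vertexBoundary f‖ ^ 2 * ‖vertexBoundary f‖ ^ 2
        ≤ ‖vertexBoundary f‖ ^ 2 * (18 * ‖f‖ ^ 2) := by
      nlinarith [mul_le_mul_of_nonneg_right h2 (sq_nonneg ‖f‖)]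
    exact le_of_mul_le_mul_left h4 (by positivity)

theorem norm_sub_flipOp_sq_le {V : Type*} [DecidableEq V] {K : AbstractSimplicialComplex V} {p : ℕ}
    (f : EllTwo (OrientedSimplex K (p + 1))) : ‖f - flipOp K p f‖ ^ 2 ≤ 4 * ‖f‖ ^ 2 := by
  have h := norm_sub_le f (flipOp K p f)
  rw [norm_flipOp] at h
  nlinarith [norm_nonneg (f - flipOp K p f)]

theorem le_re_inner_edgeDiscriminant (f : EllTwo (OrientedSimplex cylinder (0 + 1))) :
    -1 / 5 * ‖f‖ ^ 2 ≤ (⟪downDiscriminant cylinder 0 f, f⟫_ℂ).re := by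
  have h1 := re_inner_edgeDiscriminant f
  have h2 := norm_sub_flipOp_sq_le f
  nlinarith [sq_nonneg ‖vertexBoundary f‖]

theorem re_inner_edgeDiscriminant_le (f : EllTwo (OrientedSimplex cylinder (0 + 1))) :
    (⟪downDiscriminant cylinder 0 f, f⟫_ℂ).re ≤ 7 / 10 * ‖f‖ ^ 2 := by
  have h1 := re_inner_edgeDiscriminant f
  have h2 := norm_sub_flipOp_sq_le f
  -- Applying the bound to the odd part is essential: it gives ‖∂f‖² ≤ (9/2)‖f - f ∘ flip‖², so 20⟨D
  -- f, f⟩ ≤ (7/2)‖f - f ∘ flip‖² ≤ 14‖f‖².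
  have h3 := norm_vertexBoundary_sq_le (f - flipOp cylinder 0 f)
  have h4 : vertexBoundary (f - flipOp cylinder 0 f) = (2 : ℂ) • vertexBoundary f := by
    rw [map_sub, vertexBoundary_flipOp]
    module
  rw [h4, norm_smul, Complex.norm_ofNat] at h3
  nlinarith

theorem isSelfAdjoint_edgeDiscriminant : IsSelfAdjoint (downDiscriminant cylinder 0) :=
  isWalkPair_edges.isSelfAdjoint_discriminantOp

theorem re_inner_sub_smul {H : Type*} [NormedAddCommGroup H] [InnerProductSpace ℂ H]
    (T : H →L[ℂ] H) (x : ℝ) (f : H) :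
    (⟪(T - (x : ℂ) • (1 : H →L[ℂ] H)) f, f⟫_ℂ).re = (⟪T f, f⟫_ℂ).re - x * ‖f‖ ^ 2 := by
  have h1 : (T - (x : ℂ) • (1 : H →L[ℂ] H)) f = T f - (x : ℂ) • f := rfl
  rw [h1, inner_sub_left, inner_smul_left, Complex.conj_ofReal, Complex.sub_re,
    Complex.re_ofReal_mul]
  congr 2
  exact @inner_self_eq_norm_sq ℂ _ _ _ _ f

theorem spectrum_edgeDiscriminant_subset :
    spectrum ℂ (downDiscriminant cylinder 0) ⊆ Complex.ofReal '' Set.Icc (-1 / 5) (7 / 10) := by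
  intro z hz
  have hre := isSelfAdjoint_edgeDiscriminant.mem_spectrum_eq_re hz
  refine ⟨z.re, ?_, hre.symm⟩
  rw [hre] at hz
  generalize z.re = x at hz
  by_contra hx
  refine (not_mem_spectrum_iff_isBoundedBelow
    isSelfAdjoint_edgeDiscriminant.isStarNormal _).mpr ?_ hz
  rw [Set.mem_Icc, not_and_or, not_le, not_le] at hx
  rcases hx with hx | hx
  · refine isBoundedBelow_of_le_re_inner (c := -1 / 5 - x) (by linarith) fun f => ?_
    rw [re_inner_sub_smul]
    refine le_trans ?_ (le_abs_self _)
    linarith [le_re_inner_edgeDiscriminant f]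
  · refine isBoundedBelow_of_le_re_inner (c := x - 7 / 10) (by linarith) fun f => ?_
    rw [re_inner_sub_smul]
    refine le_trans ?_ (neg_le_abs _)
    linarith [re_inner_edgeDiscriminant_le f]

/-- Approximate eigenvectors of the discriminant in the range of the coboundary. -/
theorem exists_approx_edgeDiscriminant {x : ℝ} (hx : x ∈ Set.Ioc (-1 / 5 : ℝ) (7 / 10)) (c : ℝ) :
    ∃ u : EllTwo (ZMod 3 × ℤ),
      c * ‖downDiscriminant cylinder 0 (vertexBoundary.adjoint u)
        - (x : ℂ) • vertexBoundary.adjoint u‖ < ‖vertexBoundary.adjoint u‖ := by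
  -- The value x of D corresponds to 10 x + 2 for Δ, hence to 9 - (10 x + 2) for TT*.
  obtain ⟨C, hC⟩ := exists_approx_triOp (x := 9 - (10 * x + 2)) (by linarith [hx.2])
    (by linarith [hx.1])
  set M := ‖vertexBoundary.adjoint‖ with hM
  have hM0 : 0 ≤ M := norm_nonneg _
  have hy : 0 < 10 * x + 2 := by linarith [hx.1]
  -- The threshold makes ‖∂*u‖ exceed |c| times the error bound M C below; M + 1 replaces M to avoid
  -- a possible zero factor.
  obtain ⟨u, hu1, hu2⟩ := hC (((M + 1) * (|c| * M * C) + 2 * C) / (2 * (10 * x + 2)))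
  have hC0 : 0 ≤ C := (norm_nonneg _).trans hu1
  refine ⟨u, ?_⟩
  set r := laplaceOp u - ((10 * x + 2 : ℝ) : ℂ) • u with hr
  have hrn : ‖r‖ ≤ C := by
    have : r = -(triOp (triOp.adjoint u) - ((9 - (10 * x + 2) : ℝ) : ℂ) • u) := by
      rw [hr, laplaceOp_eq]
      push_cast
      module
    rw [this, norm_neg]
    exact hu1
  have h1 : (10 : ℂ) • (downDiscriminant cylinder 0 (vertexBoundary.adjoint u)
      - (x : ℂ) • vertexBoundary.adjoint u) = vertexBoundary.adjoint r := by
    rw [smul_sub, edgeDiscriminant_adjoint, hr]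
    simp only [map_sub, map_smul]
    push_cast
    module
  have h2 : ‖downDiscriminant cylinder 0 (vertexBoundary.adjoint u)
      - (x : ℂ) • vertexBoundary.adjoint u‖ ≤ M * C := by
    have h3 := congrArg norm h1
    rw [norm_smul, Complex.norm_ofNat] at h3
    have h4 : ‖vertexBoundary.adjoint r‖ ≤ M * C :=
      (ContinuousLinearMap.le_opNorm _ _).trans (by gcongr)
    nlinarith [norm_nonneg (downDiscriminant cylinder 0 (vertexBoundary.adjoint u)
      - (x : ℂ) • vertexBoundary.adjoint u)]
  -- A large u has a large gradient, because ∂∂*u is close to 2(10 x + 2) u; the factor is positive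
  -- exactly when x > -1/5.
  have h5 : 2 * (10 * x + 2) * ‖u‖ ≤ M * ‖vertexBoundary.adjoint u‖ + 2 * C := by
    have h6 : ((2 * (10 * x + 2) : ℝ) : ℂ) • u
        = vertexBoundary (vertexBoundary.adjoint u) - (2 : ℂ) • r := by
      rw [vertexBoundary_adjoint, hr]
      push_cast
      module
    have h7 := congrArg norm h6
    rw [norm_smul, Complex.norm_real, Real.norm_eq_abs, abs_of_pos (by positivity)] at h7
    rw [h7]
    refine (norm_sub_le _ _).trans (add_le_add ?_ ?_)
    · refine (ContinuousLinearMap.le_opNorm _ _).trans_eq ?_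
      rw [hM, LinearIsometryEquiv.norm_map]
    · rw [norm_smul, Complex.norm_ofNat]
      gcongr
  rw [div_lt_iff₀ (by positivity)] at hu2
  have h8 : (M + 1) * (|c| * M * C) < M * ‖vertexBoundary.adjoint u‖ := by linarith
  have h9 : |c| * M * C < ‖vertexBoundary.adjoint u‖ := by
    have h10 : (M + 1) * (|c| * M * C) < (M + 1) * ‖vertexBoundary.adjoint u‖ := by
      linarith [norm_nonneg (vertexBoundary.adjoint u)]
    exact lt_of_mul_lt_mul_left h10 (by positivity)
  refine lt_of_le_of_lt ?_ h9
  calc c * _ ≤ |c| * (M * C) := by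
        gcongr
        exact le_abs_self c
    _ = |c| * M * C := by ring

theorem spectrum_edgeDiscriminant :
    spectrum ℂ (downDiscriminant cylinder 0) = Complex.ofReal '' Set.Icc (-1 / 5) (7 / 10) := by
  refine Set.Subset.antisymm spectrum_edgeDiscriminant_subset ?_
  rintro _ ⟨x, hx, rfl⟩
  rcases hx.1.eq_or_lt with rfl | hlt
  · exact pointSpectrum_subset_spectrum _ neg_one_fifth_mem_pointSpectrum
  · by_contra hns
    obtain ⟨c, hc⟩ := (not_mem_spectrum_iff_isBoundedBelow
      isSelfAdjoint_edgeDiscriminant.isStarNormal _).mp hns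
    obtain ⟨u, hu⟩ := exists_approx_edgeDiscriminant ⟨hlt, hx.2⟩ c
    exact absurd (hc (vertexBoundary.adjoint u)) (not_le.mpr hu)

theorem pointSpectrum_edgeDiscriminant :
    pointSpectrum (downDiscriminant cylinder 0) = {((-1 / 5 : ℝ) : ℂ), 0} := by
  refine Set.Subset.antisymm pointSpectrum_edgeDiscriminant_subset ?_
  have : Nonempty (OrientedSimplex cylinder (0 + 1)) := ⟨edge 0 ⟨(1, 0), by decide⟩⟩
  rintro _ (rfl | rfl)
  · exact neg_one_fifth_mem_pointSpectrum
  · exact zero_mem_pointSpectrum downDegree_edges exists_neighborFamily_edges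

/-- The approximate eigenvectors for 0 are gradients ∂*u, and ker D lies in ker ∂, so they are
orthogonal to ker D. -/
theorem exists_approx_kernel_edgeDiscriminant (c : ℝ) :
    ∃ f, (∀ k, downDiscriminant cylinder 0 k = 0 → ⟪k, f⟫_ℂ = 0) ∧
      c * ‖downDiscriminant cylinder 0 f‖ < ‖f‖ := by
  obtain ⟨u, hu⟩ := exists_approx_edgeDiscriminant (x := 0) (by norm_num) c
  refine ⟨vertexBoundary.adjoint u, fun k hk => ?_, by simpa using hu⟩
  rw [ContinuousLinearMap.adjoint_inner_right,
    vertexBoundary_eq_zero (z := 0) (by rw [hk, zero_smul]), inner_zero_left]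

theorem not_isClosed_range_edgeDiscriminant :
    ¬ IsClosed (Set.range (downDiscriminant cylinder 0)) := by
  intro h
  obtain ⟨c, hc⟩ := exists_bound_of_isClosed_range h
  obtain ⟨f, hf, hlt⟩ := exists_approx_kernel_edgeDiscriminant c
  exact absurd (hc f fun k hk => hf k hk) (not_le.mpr hlt)

end EdgeDiscriminant

/-! ### The triangles of the cylinder -/

section Triangles

/-- The two kinds of triangles at the origin. -/
def baseTriangle (b : Bool) : Finset (ZMod 3 × ℤ) :=
  bif b then {(0, 0), (0, 1), (1, 1)} else {(0, 0), (1, 1), (1, 0)}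

/-- The three triangles sharing an edge with `baseTriangle b` are the translates of
`baseTriangle !b` by these vectors. -/
def triShift (b : Bool) : Fin 3 → ZMod 3 × ℤ :=
  bif b then ![(0, 0), (-1, 0), (0, 1)] else ![(0, 0), (1, 0), (0, -1)]

/-- The translate of `baseTriangle b` by `v`. -/
def triangle (b : Bool) (v : ZMod 3 × ℤ) : Finset (ZMod 3 × ℤ) :=
  (baseTriangle b).map (addRightEmbedding v)

theorem triangle_true (v : ZMod 3 × ℤ) : triangle true v = rhoTriangle v.1 v.2 := by
  obtain ⟨l, n⟩ := v
  simp [triangle, baseTriangle, rhoTriangle, add_comm]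

theorem triangle_false (v : ZMod 3 × ℤ) : triangle false v = sigmaTriangle v.1 v.2 := by
  obtain ⟨l, n⟩ := v
  simp [triangle, baseTriangle, sigmaTriangle, add_comm]

theorem triangle_mem_cylinder (b : Bool) (v : ZMod 3 × ℤ) : triangle b v ∈ cylinder.faces := by
  refine ⟨by cases b <;> simp [triangle, baseTriangle], v.1, v.2, ?_⟩
  cases b
  · exact Or.inr (triangle_false v).subset
  · exact Or.inl (triangle_true v).subset

theorem card_triangle (b : Bool) (v : ZMod 3 × ℤ) : (triangle b v).card = 3 := by
  rw [triangle, Finset.card_map]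
  cases b <;> rfl

theorem card_triangle_inter (a b : Bool) (v w : ZMod 3 × ℤ) :
    (triangle a v ∩ triangle b w).card = (baseTriangle a ∩ triangle b (w - v)).card := by
  have h : triangle b w = (triangle b (w - v)).map (addRightEmbedding v) := by
    rw [triangle, triangle, Finset.map_map]
    congr 1
    ext x <;> simp [add_assoc]
  rw [h, triangle, ← Finset.map_inter, Finset.card_map]

/-- The base triangles live in the layers 0 and 1. Bounding the vertical displacement leaves
finitely many translates, so intersections, including those wrapping around ℤ/3, can be checked by
`decide`. -/
theorem snd_mem_of_inter {a b : Bool} {d : ZMod 3 × ℤ}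
    (h : (baseTriangle a ∩ triangle b d).Nonempty) : d.2 ∈ ({-1, 0, 1} : Finset ℤ) := by
  obtain ⟨x, hx⟩ := h
  obtain ⟨h1, h2⟩ := Finset.mem_inter.mp hx
  rw [triangle, Finset.mem_map] at h2
  obtain ⟨y, hy, rfl⟩ := h2
  have hb : ∀ (c : Bool) (z : ZMod 3 × ℤ), z ∈ baseTriangle c → z.2 = 0 ∨ z.2 = 1 := by
    intro c z hz
    cases c <;> simp only [baseTriangle, cond_true, cond_false, Finset.mem_insert,
      Finset.mem_singleton] at hz <;> rcases hz with rfl | rfl | rfl <;> simp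
  have h3 := hb a _ h1
  have h4 := hb b y hy
  simp only [addRightEmbedding_apply, Prod.snd_add] at h3
  simp only [Finset.mem_insert, Finset.mem_singleton]
  omega

theorem card_inter_eq_two_aux : ∀ (a b : Bool) (x : ZMod 3), ∀ y ∈ ({-1, 0, 1} : Finset ℤ),
    (baseTriangle a ∩ triangle b (x, y)).card = 2 ↔ b = !a ∧ ∃ i, (x, y) = triShift a i := by
  decide

theorem card_inter_eq_three_aux : ∀ (a b : Bool) (x : ZMod 3), ∀ y ∈ ({-1, 0, 1} : Finset ℤ),
    (baseTriangle a ∩ triangle b (x, y)).card = 3 → b = a ∧ (x, y) = 0 := by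
  decide

theorem triShift_injective (a : Bool) : Function.Injective (triShift a) := by
  revert a
  unfold Function.Injective
  decide

theorem triShift_not (a : Bool) (i : Fin 3) : triShift (!a) i = -triShift a i := by
  revert a i
  decide

theorem snd_triShift_mem (a : Bool) (i : Fin 3) : (triShift a i).2 ∈ ({-1, 0, 1} : Finset ℤ) := by
  revert a i
  decide

theorem card_triangle_inter_eq_two {a b : Bool} {v w : ZMod 3 × ℤ} :
    (triangle a v ∩ triangle b w).card = 2 ↔ b = !a ∧ ∃ i, w = v + triShift a i := by
  rw [card_triangle_inter]
  simp only [← sub_eq_iff_eq_add']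
  generalize w - v = d
  obtain ⟨x, y⟩ := d
  constructor
  · intro h
    have hy : (x, y).2 ∈ _ := snd_mem_of_inter (Finset.card_pos.mp (h ▸ two_pos))
    exact (card_inter_eq_two_aux a b x y hy).mp h
  · rintro ⟨hb, i, hi⟩
    have hy : (x, y).2 ∈ ({-1, 0, 1} : Finset ℤ) := hi ▸ snd_triShift_mem a i
    exact (card_inter_eq_two_aux a b x y hy).mpr ⟨hb, i, hi⟩

theorem triangle_inj {a b : Bool} {v w : ZMod 3 × ℤ} :
    triangle b w = triangle a v ↔ b = a ∧ w = v := by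
  constructor
  · intro h
    have h3 : (triangle a v ∩ triangle b w).card = 3 := by
      rw [h, Finset.inter_self, card_triangle]
    rw [card_triangle_inter] at h3
    have hy := snd_mem_of_inter (Finset.card_pos.mp (h3 ▸ three_pos))
    obtain ⟨h4, h5⟩ := card_inter_eq_three_aux a b (w - v).1 (w - v).2 hy h3
    exact ⟨h4, sub_eq_zero.mp h5⟩
  · rintro ⟨rfl, rfl⟩
    rfl

theorem exists_eq_triangle {F : Finset (ZMod 3 × ℤ)} (hF : F ∈ cylinder.faces)
    (hc : F.card = 3) : ∃ b v, F = triangle b v := by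
  obtain ⟨-, l, n, h | h⟩ := hF
  · refine ⟨true, (l, n), ?_⟩
    rw [← triangle_true (l, n)] at h
    exact Finset.eq_of_subset_of_card_le h (by rw [hc, card_triangle])
  · refine ⟨false, (l, n), ?_⟩
    rw [← triangle_false (l, n)] at h
    exact Finset.eq_of_subset_of_card_le h (by rw [hc, card_triangle])

/-- The vertices of the triangle `triangle b v`, in a coherent order. -/
def triangleVertex (b : Bool) (v : ZMod 3 × ℤ) : Fin 3 → ZMod 3 × ℤ :=
  bif b then ![v, v + (0, 1), v + (1, 1)] else ![v, v + (1, 1), v + (1, 0)]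

theorem mem_triangle_iff (b : Bool) (v w : ZMod 3 × ℤ) :
    w ∈ triangle b v ↔ ∃ i, triangleVertex b v i = w := by
  have h0 : ((0, 0) : ZMod 3 × ℤ) + v = v := zero_add v
  cases b <;>
    simp [triangle, baseTriangle, triangleVertex, Fin.exists_fin_succ, add_comm v, eq_comm, h0]

/-- The triangle `triangle b v` as an ordered simplex. -/
def orderedTriangle (b : Bool) (v : ZMod 3 × ℤ) : OrderedSimplex cylinder (1 + 1) where
  vertex := triangleVertex b v
  injective := by
    intro i j
    cases b <;> fin_cases i <;> fin_cases j <;> simp [triangleVertex]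
  mem := OrderedSimplex.map_mem (triangle_mem_cylinder b v) (mem_triangle_iff b v)

/-- The triangle `triangle b v` with the coherent orientation. -/
def tri (b : Bool) (v : ZMod 3 × ℤ) : OrientedSimplex cylinder (1 + 1) :=
  (orderedTriangle b v).oriented

@[simp]
theorem support_tri (b : Bool) (v : ZMod 3 × ℤ) : (tri b v).support = triangle b v := by
  ext w
  rw [tri, OrderedSimplex.support_oriented, OrderedSimplex.mem_support, mem_triangle_iff]
  rfl

theorem exists_tri (τ : OrientedSimplex cylinder (1 + 1)) :
    ∃ b v, τ = tri b v ∨ τ = (tri b v).flip := by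
  obtain ⟨b, v, h⟩ := exists_eq_triangle τ.support_mem τ.card_support
  exact ⟨b, v, OrientedSimplex.eq_or_eq_flip (by rw [h, support_tri])⟩

theorem tri_inj {a b : Bool} {v w : ZMod 3 × ℤ} : tri b w = tri a v ↔ b = a ∧ w = v := by
  rw [← triangle_inj, ← support_tri, ← support_tri]
  constructor
  · intro h
    rw [h]
  · intro h
    rw [support_tri, support_tri, triangle_inj] at h
    rw [h.1, h.2]

theorem flip_tri_ne (a b : Bool) (v w : ZMod 3 × ℤ) : (tri b w).flip ≠ tri a v := by
  intro h
  have h1 := congrArg OrientedSimplex.support h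
  rw [OrientedSimplex.support_flip, support_tri, support_tri, triangle_inj] at h1
  obtain ⟨rfl, rfl⟩ := h1
  exact (tri b w).flip_ne h

theorem tri_injective (b : Bool) : Function.Injective (tri b) := fun _ _ h => (tri_inj.mp h).2

theorem downNeighbor_iff_card {F G : Finset (ZMod 3 × ℤ)} (hF : F ∈ cylinder.faces) :
    DownNeighbor cylinder 1 F G ↔ (F ∩ G).card = 2 := by
  refine ⟨fun h => h.2, fun h => ⟨?_, h⟩⟩
  exact (cylinder.isRelLowerSet_faces hF).2 Finset.inter_subset_left
    (Finset.card_pos.mp (h ▸ two_pos))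

theorem isNeighborFamily_tri (b : Bool) (v : ZMod 3 × ℤ) :
    IsNeighborFamily (tri b v) fun i => tri (!b) (v + triShift b i) where
  injective := by
    intro i j h
    simp only [support_tri, triangle_inj] at h
    exact triShift_injective b (add_left_cancel h.2)
  downNeighbor_iff := by
    intro τ'
    obtain ⟨c, w, h⟩ := exists_eq_triangle τ'.support_mem τ'.card_support
    rw [h, support_tri, downNeighbor_iff_card (triangle_mem_cylinder b v),
      card_triangle_inter_eq_two]
    simp only [support_tri, triangle_inj, exists_and_left]

theorem exists_neighborFamily_triangles (τ : OrientedSimplex cylinder (1 + 1)) :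
    ∃ (ι : Type) (_ : Fintype ι) (t : ι → OrientedSimplex cylinder (1 + 1)),
      IsNeighborFamily τ t := by
  obtain ⟨b, v, rfl | rfl⟩ := exists_tri τ
  · exact ⟨_, inferInstance, _, isNeighborFamily_tri b v⟩
  · exact ⟨_, inferInstance, _, (isNeighborFamily_tri b v).flip⟩

theorem downDegree_triangles (τ : OrientedSimplex cylinder (1 + 1)) :
    downDegree cylinder 1 τ = 3 := by
  obtain ⟨b, v, rfl | rfl⟩ := exists_tri τ
  · rw [(isNeighborFamily_tri b v).downDegree_eq, Fintype.card_fin]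
  · rw [(isNeighborFamily_tri b v).flip.downDegree_eq, Fintype.card_fin]

theorem isWalkPair_triangles : IsWalkPair (boundaryOp cylinder 1) (shiftOp cylinder 1) :=
  isWalkPair_of_neighborFamily fun τ =>
    ⟨by rw [downDegree_triangles]; norm_num, exists_neighborFamily_triangles τ⟩

/-! ### Signs between coherently oriented adjacent triangles. -/

theorem etaCoeff_of_faces {V : Type*} [DecidableEq V] {K : AbstractSimplicialComplex V} {p : ℕ}
    {s s' : OrderedSimplex K (p + 1)} {t : OrderedSimplex K p}
    (hd : DownNeighbor K p s.oriented.support s'.oriented.support)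
    (j : Fin (p + 2)) (ρ : Equiv.Perm (Fin (p + 1)))
    (h : ∀ i, t.vertex i = s.vertex (j.succAbove (ρ i)))
    (j' : Fin (p + 2)) (ρ' : Equiv.Perm (Fin (p + 1)))
    (h' : ∀ i, t.vertex i = s'.vertex (j'.succAbove (ρ' i))) :
    etaCoeff s.oriented s'.oriented
      = ((sign ρ : ℤˣ) * (-1) ^ (j : ℕ)) * ((sign ρ' : ℤˣ) * (-1) ^ (j' : ℕ)) := by
  rw [etaCoeff_eq hd (μ := t.oriented), OrderedSimplex.sgn_eq_of_vertex j ρ h,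
    OrderedSimplex.sgn_eq_of_vertex j' ρ' h']
  refine Finset.eq_of_subset_of_card_le (fun w hw => ?_) ?_
  · obtain ⟨i, rfl⟩ := (t.mem_support w).mp hw
    exact Finset.mem_inter.mpr ⟨(s.mem_support _).mpr ⟨_, (h i).symm⟩,
      (s'.mem_support _).mpr ⟨_, (h' i).symm⟩⟩
  · rw [hd.2, OrientedSimplex.card_support]

/-- Coherent orientations induce opposite orientations on a common edge. The three cases are the
diagonal, vertical and horizontal edge. -/
theorem etaCoeff_tri_true (v : ZMod 3 × ℤ) (i : Fin 3) :
    etaCoeff (tri true v) (tri false (v + triShift true i)) = -1 := by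
  have hd : DownNeighbor cylinder 1 (tri true v).support
      (tri false (v + triShift true i)).support :=
    ((isNeighborFamily_tri true v).downNeighbor_iff _).mpr ⟨i, rfl⟩
  obtain ⟨l, n⟩ := v
  have h21 : (-1 + 1 : ZMod 3) = 0 := by decide
  fin_cases i
  · refine (etaCoeff_of_faces (t := orderedEdge (l, n) ⟨(1, 1), by decide⟩) hd 1 1 (fun i => ?_)
      2 1 (fun i => ?_)).trans (by simp) <;>
    fin_cases i <;>
    simp [orderedEdge, orderedTriangle, triangleVertex, triShift, Fin.succAbove]
  · refine (etaCoeff_of_faces (t := orderedEdge (l, n) ⟨(0, 1), by decide⟩) hd 2 1 (fun i => ?_)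
      0 (Equiv.swap 0 1) (fun i => ?_)).trans (by simp) <;>
    fin_cases i <;>
    simp [orderedEdge, orderedTriangle, triangleVertex, triShift, Fin.succAbove]
  · refine (etaCoeff_of_faces (t := orderedEdge ((l, n) + (0, 1)) ⟨(1, 0), by decide⟩) hd 0 1
      (fun i => ?_) 1 1 (fun i => ?_)).trans (by simp) <;>
    fin_cases i <;>
    simp [orderedEdge, orderedTriangle, triangleVertex, triShift, Fin.succAbove]

theorem etaCoeff_tri (b : Bool) (v : ZMod 3 × ℤ) (i : Fin 3) :
    etaCoeff (tri b v) (tri (!b) (v + triShift b i)) = -1 := by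
  cases b
  · have h := etaCoeff_tri_true (v + triShift false i) i
    have h2 : triShift true i = -triShift false i := triShift_not false i
    rwa [h2, add_neg_cancel_right, etaCoeff_comm] at h
  · exact etaCoeff_tri_true v i

end Triangles

/-! ### The discriminant on the triangles -/

section TriangleDiscriminant

/-- The antisymmetrized restriction to the triangles of kind `b`. -/
def triRestrict (b : Bool) :
    EllTwo (OrientedSimplex cylinder (1 + 1)) →L[ℂ] EllTwo (ZMod 3 × ℤ) :=
  pullbackOp (tri b) (tri_injective b) ∘L (1 - flipOp cylinder 1)

theorem triRestrict_apply (b : Bool) (f : EllTwo (OrientedSimplex cylinder (1 + 1)))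
    (v : ZMod 3 × ℤ) : triRestrict b f v = f (tri b v) - f (tri b v).flip := rfl

theorem triangleDiscriminant_apply (b : Bool) (f : EllTwo (OrientedSimplex cylinder (1 + 1)))
    (v : ZMod 3 × ℤ) : downDiscriminant cylinder 1 f (tri b v)
      = -(1 / 6) * ∑ i, triRestrict (!b) f (v + triShift b i) := by
  rw [downDiscriminant_apply downDegree_triangles (isNeighborFamily_tri b v)]
  simp only [etaCoeff_tri, triRestrict_apply]
  push_cast
  simp only [neg_mul, one_mul, Finset.sum_neg_distrib]
  ring

theorem triangleDiscriminant_apply_flip (b : Bool)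
    (f : EllTwo (OrientedSimplex cylinder (1 + 1))) (v : ZMod 3 × ℤ) :
    downDiscriminant cylinder 1 f (tri b v).flip = -downDiscriminant cylinder 1 f (tri b v) :=
  downDiscriminant_apply_flip downDegree_triangles (isNeighborFamily_tri b v) f

/-- The three neighbors of a triangle are of the other kind, at the shifts that define T. Since D f
is odd, antisymmetrizing doubles the factor 1/6 to 1/3. -/
theorem triRestrict_true_discriminant (f : EllTwo (OrientedSimplex cylinder (1 + 1))) :
    (3 : ℂ) • triRestrict true (downDiscriminant cylinder 1 f)
      = -triOp (triRestrict false f) := by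
  ext v
  change 3 * triRestrict true (downDiscriminant cylinder 1 f) v = -(triOp (triRestrict false f) v)
  rw [triRestrict_apply, triangleDiscriminant_apply_flip, triangleDiscriminant_apply, triOp_apply,
    Fin.sum_univ_three]
  have h : v + ((0, 0) : ZMod 3 × ℤ) = v := add_zero v
  simp [triShift, h]
  ring

theorem triRestrict_false_discriminant (f : EllTwo (OrientedSimplex cylinder (1 + 1))) :
    (3 : ℂ) • triRestrict false (downDiscriminant cylinder 1 f)
      = -triOp.adjoint (triRestrict true f) := by
  ext v
  change 3 * triRestrict false (downDiscriminant cylinder 1 f) v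
    = -(triOp.adjoint (triRestrict true f) v)
  rw [triRestrict_apply, triangleDiscriminant_apply_flip, triangleDiscriminant_apply,
    adjoint_triOp_apply, Fin.sum_univ_three]
  have h : v + ((0, 0) : ZMod 3 × ℤ) = v := add_zero v
  simp [triShift, h]
  ring

theorem isSelfAdjoint_triangleDiscriminant : IsSelfAdjoint (downDiscriminant cylinder 1) :=
  isWalkPair_triangles.isSelfAdjoint_discriminantOp

/-- Obtained from `triRestrict_true_discriminant` by taking adjoints, D being self-adjoint. -/
theorem triangleDiscriminant_adjoint_true (u : EllTwo (ZMod 3 × ℤ)) :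
    (3 : ℂ) • downDiscriminant cylinder 1 ((triRestrict true).adjoint u)
      = -(triRestrict false).adjoint (triOp.adjoint u) := by
  refine ext_inner_left ℂ fun f => ?_
  have h := congrArg (fun g => ⟪g, u⟫_ℂ) (triRestrict_true_discriminant f)
  simp only [inner_smul_left, inner_neg_left, Complex.conj_ofNat] at h
  rw [inner_smul_right, inner_neg_right, ContinuousLinearMap.adjoint_inner_right,
    ContinuousLinearMap.adjoint_inner_right, ← h, ← isSelfAdjoint_triangleDiscriminant.adjoint_eq,
    ContinuousLinearMap.adjoint_inner_right, ContinuousLinearMap.adjoint_inner_right,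
    isSelfAdjoint_triangleDiscriminant.adjoint_eq]

theorem triangleDiscriminant_adjoint_false (u : EllTwo (ZMod 3 × ℤ)) :
    (3 : ℂ) • downDiscriminant cylinder 1 ((triRestrict false).adjoint u)
      = -(triRestrict true).adjoint (triOp u) := by
  refine ext_inner_left ℂ fun f => ?_
  have h := congrArg (fun g => ⟪g, u⟫_ℂ) (triRestrict_false_discriminant f)
  simp only [inner_smul_left, inner_neg_left, Complex.conj_ofNat,
    ContinuousLinearMap.adjoint_inner_left] at h
  rw [inner_smul_right, inner_neg_right, ContinuousLinearMap.adjoint_inner_right, ← h,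
    ← isSelfAdjoint_triangleDiscriminant.adjoint_eq,
    ContinuousLinearMap.adjoint_inner_right, ContinuousLinearMap.adjoint_inner_right,
    isSelfAdjoint_triangleDiscriminant.adjoint_eq]

theorem triRestrict_single (a b : Bool) (v : ZMod 3 × ℤ)
    [DecidableEq (OrientedSimplex cylinder (1 + 1))] :
    triRestrict b (lp.single 2 (tri a v) 1) = if b = a then lp.single 2 v 1 else 0 := by
  ext w
  rw [triRestrict_apply, lp.single_apply, lp.single_apply, Pi.single_eq_of_ne (flip_tri_ne _ _ _ _),
    sub_zero, Pi.single_apply]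
  simp only [tri_inj, ite_and]
  split_ifs with h1 h2
  · subst h2
    rw [lp.single_apply_self]
  · rw [lp.single_apply, Pi.single_eq_of_ne h2]
  · rfl

theorem triRestrict_flipOp (b : Bool) (f : EllTwo (OrientedSimplex cylinder (1 + 1))) :
    triRestrict b (flipOp cylinder 1 f) = -triRestrict b f := by
  ext v
  change triRestrict b (flipOp cylinder 1 f) v = -(triRestrict b f v)
  rw [triRestrict_apply, triRestrict_apply, flipOp_apply, flipOp_apply, OrientedSimplex.flip_flip]
  ring

theorem flipOp_single {V : Type*} [DecidableEq V] {K : AbstractSimplicialComplex V} {p : ℕ}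
    [DecidableEq (OrientedSimplex K (p + 1))] (τ : OrientedSimplex K (p + 1)) :
    flipOp K p (lp.single 2 τ 1) = lp.single 2 τ.flip 1 := by
  ext ρ
  rw [flipOp_apply, lp.single_apply, lp.single_apply, Pi.single_apply, Pi.single_apply]
  have h : ρ.flip = τ ↔ ρ = τ.flip :=
    ⟨fun h => by rw [← h, OrientedSimplex.flip_flip],
      fun h => by rw [h, OrientedSimplex.flip_flip]⟩
  simp only [h]

theorem adjoint_triRestrict_apply (a b : Bool) (u : EllTwo (ZMod 3 × ℤ)) (v : ZMod 3 × ℤ) :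
    (triRestrict b).adjoint u (tri a v) = (if b = a then u v else 0) ∧
      (triRestrict b).adjoint u (tri a v).flip = -(if b = a then u v else 0) := by
  classical
  have h1 : ∀ τ, (triRestrict b).adjoint u τ
      = ⟪triRestrict b (lp.single 2 τ (1 : ℂ)), u⟫_ℂ := by
    intro τ
    rw [← ContinuousLinearMap.adjoint_inner_right, lp.inner_single_left]
    simp
  have h2 : ⟪triRestrict b (lp.single 2 (tri a v) (1 : ℂ)), u⟫_ℂ = if b = a then u v else 0 := by
    rw [triRestrict_single]
    split_ifs
    · rw [lp.inner_single_left]; simp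
    · exact inner_zero_left _
  constructor
  · rw [h1, h2]
  · rw [h1, ← flipOp_single, triRestrict_flipOp, inner_neg_left, h2]

theorem triRestrict_adjoint (a b : Bool) (u : EllTwo (ZMod 3 × ℤ)) :
    triRestrict a ((triRestrict b).adjoint u) = if b = a then (2 : ℂ) • u else 0 := by
  ext v
  obtain ⟨h1, h2⟩ := adjoint_triRestrict_apply a b u v
  rw [triRestrict_apply, h1, h2]
  split_ifs
  · change u v - -u v = 2 * u v
    ring
  · change (0 : ℂ) - -0 = 0
    simp

theorem pointSpectrum_triangleDiscriminant :
    pointSpectrum (downDiscriminant cylinder 1) = {0} := by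
  refine Set.Subset.antisymm ?_ ?_
  · intro z hz
    obtain ⟨f, hf0, hf⟩ := mem_pointSpectrum.mp hz
    by_contra hz0
    have hz0' : z ≠ 0 := hz0
    have h1 := triRestrict_true_discriminant f
    have h2 := triRestrict_false_discriminant f
    rw [hf, map_smul] at h1 h2
    have h3 : triRestrict true f = 0 := by
      -- Composing the two off-diagonal relations, the restriction to one kind of triangle would be
      -- an eigenvector of TT*.
      refine eq_zero_of_triOp (x := 9 * z ^ 2) ?_
      have h4 : triOp.adjoint (triRestrict true f) = (-3 * z) • triRestrict false f := by
        rw [← neg_neg (triOp.adjoint _), ← h2]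
        module
      have h5 : triOp (triRestrict false f) = (-3 * z) • triRestrict true f := by
        rw [← neg_neg (triOp _), ← h1]
        module
      rw [h4, map_smul, h5]
      module
    have h4 : triRestrict false f = 0 := by
      rw [h3, map_zero, neg_zero, smul_smul, smul_eq_zero] at h2
      exact h2.resolve_left (by simp [hz0'])
    have h5 : ∀ b, triRestrict b f = 0 := fun b => by
      cases b
      · exact h4
      · exact h3
    -- Now f has no odd part, so D f = 0, which contradicts D f = z f with z ≠ 0.
    have h6 : downDiscriminant cylinder 1 f = 0 := by
      ext τ
      change downDiscriminant cylinder 1 f τ = 0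
      have h7 : ∀ b v, downDiscriminant cylinder 1 f (tri b v) = 0 := by
        intro b v
        rw [triangleDiscriminant_apply, h5]
        simp
      obtain ⟨b, v, rfl | rfl⟩ := exists_tri τ
      · exact h7 b v
      · rw [triangleDiscriminant_apply_flip, h7, neg_zero]
    rw [hf, smul_eq_zero] at h6
    exact h6.elim hz0' hf0
  · rintro _ rfl
    have : Nonempty (OrientedSimplex cylinder (1 + 1)) := ⟨tri true 0⟩
    exact zero_mem_pointSpectrum downDegree_triangles exists_neighborFamily_triangles

theorem exists_approx_triangleDiscriminant {x : ℝ} (hx : x ∈ Set.Icc (-1 : ℝ) 1) (hx0 : x ≠ 0)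
    (c : ℝ) : ∃ f, c * ‖downDiscriminant cylinder 1 f - (x : ℂ) • f‖ < ‖f‖ := by
  obtain ⟨C, hC⟩ := exists_approx_triOp (x := 9 * x ^ 2) (by positivity) (by nlinarith [hx.1, hx.2])
  set A := (triRestrict true).adjoint with hA
  set A' := (triRestrict false).adjoint with hA'
  set M := ‖A‖ with hM
  have hM0 : 0 ≤ M := norm_nonneg _
  obtain ⟨u, hu1, hu2⟩ := hC ((M + 1) * (|c| * M * C) / (6 * |x|))
  have hC0 : 0 ≤ C := (norm_nonneg _).trans hu1
  have hx' : 0 < |x| := abs_pos.mpr hx0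
  set r := triOp (triOp.adjoint u) - ((9 * x ^ 2 : ℝ) : ℂ) • u with hr
  -- If TT*u = 9x²u, this is the eigenvector for x of the off-diagonal operator with blocks -T/3 and
  -- -T*/3.
  set f := (3 * x : ℂ) • A u - A' (triOp.adjoint u) with hf
  have h1 : (3 : ℂ) • (downDiscriminant cylinder 1 f - (x : ℂ) • f) = A r := by
    have e1 := triangleDiscriminant_adjoint_true u
    have e2 := triangleDiscriminant_adjoint_false (triOp.adjoint u)
    rw [← hA] at e1 e2
    rw [← hA'] at e1 e2
    have e3 : (3 : ℂ) • downDiscriminant cylinder 1 f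
        = (3 * x : ℂ) • (3 : ℂ) • downDiscriminant cylinder 1 (A u)
          - (3 : ℂ) • downDiscriminant cylinder 1 (A' (triOp.adjoint u)) := by
      rw [hf, map_sub, map_smul]
      module
    rw [smul_sub, e3, e1, e2, hr, map_sub, map_smul, hf]
    push_cast
    module
  have h2 : ‖downDiscriminant cylinder 1 f - (x : ℂ) • f‖ ≤ M * C := by
    have h3 := congrArg norm h1
    rw [norm_smul, Complex.norm_ofNat] at h3
    have h4 : ‖A r‖ ≤ M * C := (ContinuousLinearMap.le_opNorm _ _).trans (by gcongr)
    nlinarith [norm_nonneg (downDiscriminant cylinder 1 f - (x : ℂ) • f)]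
  -- One component of f already recovers 6 x u; this needs x ≠ 0 to be useful.
  have h5 : 6 * |x| * ‖u‖ ≤ M * ‖f‖ := by
    have h6 : triRestrict true f = (6 * x : ℂ) • u := by
      rw [hf, map_sub, map_smul, triRestrict_adjoint, triRestrict_adjoint, if_pos rfl,
        if_neg (by decide)]
      module
    have h7 := congrArg norm h6
    rw [norm_smul, norm_mul, Complex.norm_ofNat, Complex.norm_real, Real.norm_eq_abs] at h7
    rw [← h7]
    refine (ContinuousLinearMap.le_opNorm _ _).trans_eq ?_
    rw [hM, hA, LinearIsometryEquiv.norm_map]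
  rw [div_lt_iff₀ (by positivity)] at hu2
  have h9 : |c| * M * C < ‖f‖ := by
    have h10 : (M + 1) * (|c| * M * C) < (M + 1) * ‖f‖ := by
      linarith [norm_nonneg f]
    exact lt_of_mul_lt_mul_left h10 (by positivity)
  refine ⟨f, lt_of_le_of_lt ?_ h9⟩
  calc c * _ ≤ |c| * (M * C) := by
        gcongr
        exact le_abs_self c
    _ = |c| * M * C := by ring

theorem spectrum_triangleDiscriminant :
    spectrum ℂ (downDiscriminant cylinder 1) = Complex.ofReal '' Set.Icc (-1) 1 := by
  refine Set.Subset.antisymm (fun z hz => ?_) ?_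
  · have hre := isSelfAdjoint_triangleDiscriminant.mem_spectrum_eq_re hz
    refine ⟨z.re, ?_, hre.symm⟩
    have h1 := spectrum.norm_le_norm_mul_of_mem hz
    have h2 : ‖(1 : EllTwo (OrientedSimplex cylinder (1 + 1)) →L[ℂ] _)‖ ≤ 1 :=
      ContinuousLinearMap.norm_id_le
    have h3 : ‖downDiscriminant cylinder 1‖ ≤ 1 := isWalkPair_triangles.norm_discriminantOp_le
    have h4 : ‖z‖ ≤ 1 := h1.trans (mul_le_one₀ h3 (norm_nonneg _) h2)
    exact abs_le.mp ((Complex.abs_re_le_norm z).trans h4)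
  · rintro _ ⟨x, hx, rfl⟩
    rcases eq_or_ne x 0 with rfl | hx0
    · refine pointSpectrum_subset_spectrum _ ?_
      rw [pointSpectrum_triangleDiscriminant]
      simp
    · by_contra hns
      obtain ⟨c, hc⟩ := (not_mem_spectrum_iff_isBoundedBelow
        isSelfAdjoint_triangleDiscriminant.isStarNormal _).mp hns
      obtain ⟨f, hf⟩ := exists_approx_triangleDiscriminant hx hx0 c
      exact absurd (hc f) (not_le.mpr hf)

end TriangleDiscriminant

/-! ### The spectra of the walks -/

section WalkSpectra

theorem norm_eq_one_of_mem_sphere {z : ℂ} (hz : z ∈ Metric.sphere (0 : ℂ) 1) : ‖z‖ = 1 :=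
  mem_sphere_zero_iff_norm.mp hz

theorem abs_re_le_one {z : ℂ} (hz : ‖z‖ = 1) : -1 ≤ z.re ∧ z.re ≤ 1 :=
  abs_le.mp (hz ▸ Complex.abs_re_le_norm z)

theorem continuousSpectrum_triangleDiscriminant :
    continuousSpectrum (downDiscriminant cylinder 1)
      = Complex.ofReal '' (Set.Icc (-1) 1 \ {0}) := by
  rw [continuousSpectrum_eq isSelfAdjoint_triangleDiscriminant.isStarNormal,
    spectrum_triangleDiscriminant, pointSpectrum_triangleDiscriminant,
    Set.image_sdiff Complex.ofReal_injective]
  simp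

theorem mem_spectrum_triangleWalk {z : ℂ} (hz : ‖z‖ = 1) (h1 : z ≠ 1) (h2 : z ≠ -1) :
    z ∈ spectrum ℂ (downGroverWalk cylinder 1) := by
  refine (isWalkPair_triangles.mem_spectrum_walkOp_iff hz h1 h2).mpr ?_
  have h := spectrum_triangleDiscriminant.superset ⟨z.re, abs_re_le_one hz, rfl⟩
  exact h

theorem exp_mul_I_ne_one {t : ℝ} (h0 : 0 < t) (hπ : t < Real.pi) :
    Complex.exp (t * Complex.I) ≠ 1 ∧ Complex.exp (t * Complex.I) ≠ -1 := by
  have h := Real.sin_pos_of_pos_of_lt_pi h0 hπ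
  constructor <;> intro he <;>
  · have := congrArg Complex.im he
    rw [Complex.exp_ofReal_mul_I_im] at this
    simp at this
    exact h.ne' this

/-- A closed subset of the plane containing the unit circle, except possibly `±1`, contains the
unit circle. -/
theorem sphere_subset_of_isClosed {s : Set ℂ} (hs : IsClosed s)
    (h : ∀ z : ℂ, ‖z‖ = 1 → z ≠ 1 → z ≠ -1 → z ∈ s) : Metric.sphere (0 : ℂ) 1 ⊆ s := by
  have hc : Continuous fun t : ℝ => Complex.exp (t * Complex.I) := by fun_prop
  have hIoo : ∀ t ∈ Set.Ioo 0 Real.pi, Complex.exp (t * Complex.I) ∈ s := fun t ht =>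
    h _ (Complex.norm_exp_ofReal_mul_I t) (exp_mul_I_ne_one ht.1 ht.2).1
      (exp_mul_I_ne_one ht.1 ht.2).2
  -- The endpoints t = 0 and t = π are the points 1 and -1, reached as limits along the upper half
  -- circle.
  have hIcc : ∀ t ∈ Set.Icc 0 Real.pi, Complex.exp (t * Complex.I) ∈ s := by
    have hpre : IsClosed ((fun t : ℝ => Complex.exp (t * Complex.I)) ⁻¹' s) := hs.preimage hc
    rw [← closure_Ioo Real.pi_pos.ne]
    exact hpre.closure_subset_iff.mpr hIoo
  intro z hz
  have hz1 := norm_eq_one_of_mem_sphere hz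
  by_cases h1 : z = 1
  · have := hIcc 0 ⟨le_rfl, Real.pi_pos.le⟩
    rw [h1]
    simpa using this
  by_cases h2 : z = -1
  · have := hIcc Real.pi ⟨Real.pi_pos.le, le_rfl⟩
    rw [h2]
    simpa using this
  exact h z hz1 h1 h2

theorem spectrum_downGroverWalk_subset {V : Type*} [DecidableEq V]
    {K : AbstractSimplicialComplex V} {p : ℕ} (h : IsWalkPair (boundaryOp K p) (shiftOp K p)) :
    spectrum ℂ (downGroverWalk K p) ⊆ Metric.sphere 0 1 :=
  spectrum.subset_circle_of_unitary h.walkOp_mem_unitary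

theorem spectrum_triangleWalk :
    spectrum ℂ (downGroverWalk cylinder 1) = Metric.sphere 0 1 :=
  Set.Subset.antisymm (spectrum_downGroverWalk_subset isWalkPair_triangles)
    (sphere_subset_of_isClosed (spectrum.isClosed _) fun _ => mem_spectrum_triangleWalk)

theorem eq_I_or_of_re_eq_zero {z : ℂ} (hz : ‖z‖ = 1) (hre : z.re = 0) :
    z = Complex.I ∨ z = -Complex.I := by
  have h := Complex.sq_norm z
  rw [hz, Complex.normSq_apply, hre] at h
  have h2 : (z.im - 1) * (z.im + 1) = 0 := by linear_combination -h
  rcases mul_eq_zero.mp h2 with h3 | h3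
  · left
    apply Complex.ext <;> simp [hre]
    linarith
  · right
    apply Complex.ext <;> simp [hre]
    linarith

theorem subset_continuousSpectrum_triangleWalk :
    Metric.sphere 0 1 \ {Complex.I, -Complex.I, 1, -1} ⊆
      continuousSpectrum (downGroverWalk cylinder 1) := by
  rintro z ⟨hz, hne⟩
  simp only [Set.mem_insert_iff, Set.mem_singleton_iff, not_or] at hne
  obtain ⟨hI, hI', h1, h2⟩ := hne
  have hz1 := norm_eq_one_of_mem_sphere hz
  rw [continuousSpectrum_eq (T := downGroverWalk cylinder 1)
    isWalkPair_triangles.isStarNormal_walkOp]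
  refine ⟨mem_spectrum_triangleWalk hz1 h1 h2, fun hp => ?_⟩
  have h3 := (isWalkPair_triangles.mem_pointSpectrum_walkOp_iff hz1 h1 h2).mp hp
  have h4 : ((z.re : ℝ) : ℂ) ∈ ({0} : Set ℂ) := pointSpectrum_triangleDiscriminant ▸ h3
  rcases eq_I_or_of_re_eq_zero hz1 (Complex.ofReal_eq_zero.mp h4) with h | h
  · exact hI h
  · exact hI' h

theorem I_facts {z : ℂ} (hz : z ∈ ({Complex.I, -Complex.I} : Set ℂ)) :
    ‖z‖ = 1 ∧ z ≠ 1 ∧ z ≠ -1 ∧ z.re = 0 := by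
  rcases hz with rfl | rfl
  · exact ⟨by simp, fun h => by simpa using congrArg Complex.re h,
      fun h => by simpa using congrArg Complex.re h, by simp⟩
  · exact ⟨by simp, fun h => by simpa using congrArg Complex.re h,
      fun h => by simpa using congrArg Complex.re h, by simp⟩

theorem subset_pointSpectrum_triangleWalk :
    {Complex.I, -Complex.I} ⊆ pointSpectrum (downGroverWalk cylinder 1) := by
  intro z hz
  obtain ⟨hz1, h1, h2, hre⟩ := I_facts hz
  refine (isWalkPair_triangles.mem_pointSpectrum_walkOp_iff hz1 h1 h2).mpr ?_
  have h : (((0 : ℝ) : ℂ)) ∈ pointSpectrum (downDiscriminant cylinder 1) := by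
    rw [pointSpectrum_triangleDiscriminant]
    simp
  rw [hre]
  exact h

/-! ### Spectral sets for the discriminant and the walk on the edges. -/

theorem edgeSpectrum_eq :
    ({-1 / 5, 0} ∪ Set.Ioc (-1 / 5) (7 / 10) : Set ℝ) = Set.Icc (-1 / 5) (7 / 10) := by
  ext x
  simp only [Set.mem_union, Set.mem_insert_iff, Set.mem_singleton_iff, Set.mem_Ioc, Set.mem_Icc]
  constructor
  · rintro ((rfl | rfl) | h)
    · norm_num
    · norm_num
    · exact ⟨h.1.le, h.2⟩
  · rintro ⟨h1, h2⟩
    rcases h1.eq_or_lt with h | h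
    · exact Or.inl (Or.inl h.symm)
    · exact Or.inr ⟨h, h2⟩

theorem pointSpectrum_edgeDiscriminant' :
    pointSpectrum (downDiscriminant cylinder 0) = Complex.ofReal '' {-1 / 5, 0} := by
  rw [pointSpectrum_edgeDiscriminant, Set.image_pair, Complex.ofReal_zero]

theorem edgeSpectrum_diff :
    (Set.Icc (-1 / 5) (7 / 10) \ {-1 / 5, 0} : Set ℝ) = Set.Ioc (-1 / 5) (7 / 10) \ {0} := by
  ext x
  simp only [Set.mem_sdiff, Set.mem_insert_iff, Set.mem_singleton_iff, Set.mem_Ioc, Set.mem_Icc,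
    not_or]
  constructor
  · rintro ⟨⟨h1, h2⟩, h3, h4⟩
    exact ⟨⟨lt_of_le_of_ne h1 (Ne.symm h3), h2⟩, h4⟩
  · rintro ⟨⟨h1, h2⟩, h3⟩
    exact ⟨⟨h1.le, h2⟩, h1.ne', h3⟩

theorem continuousSpectrum_edgeDiscriminant :
    continuousSpectrum (downDiscriminant cylinder 0)
      = Complex.ofReal '' (Set.Ioc (-1 / 5) (7 / 10) \ {0}) := by
  rw [continuousSpectrum_eq isSelfAdjoint_edgeDiscriminant.isStarNormal,
    spectrum_edgeDiscriminant, pointSpectrum_edgeDiscriminant',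
    ← Set.image_sdiff Complex.ofReal_injective, edgeSpectrum_diff]

/-- The spectrum of D on the edges stays away from ±1, so the exceptional points of the spectral
correspondence matter only for the upper inclusion. -/
theorem ne_of_re_mem {z : ℂ} (hz : z.re ∈ Set.Icc (-1 / 5 : ℝ) (7 / 10)) : z ≠ 1 ∧ z ≠ -1 := by
  constructor <;> rintro rfl
  · have := hz.2
    norm_num at this
  · have := hz.1
    norm_num at this

theorem ofReal_mem_image {x : ℝ} {s : Set ℝ} : (x : ℂ) ∈ Complex.ofReal '' s ↔ x ∈ s :=
  Complex.ofReal_injective.mem_set_image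

theorem mem_spectrum_edgeWalk_iff {z : ℂ} (hz : ‖z‖ = 1) (h1 : z ≠ 1) (h2 : z ≠ -1) :
    z ∈ spectrum ℂ (downGroverWalk cylinder 0) ↔ z.re ∈ Set.Icc (-1 / 5 : ℝ) (7 / 10) := by
  rw [← ofReal_mem_image, ← spectrum_edgeDiscriminant]
  exact isWalkPair_edges.mem_spectrum_walkOp_iff hz h1 h2

theorem mem_pointSpectrum_edgeWalk_iff {z : ℂ} (hz : ‖z‖ = 1) (h1 : z ≠ 1) (h2 : z ≠ -1) :
    z ∈ pointSpectrum (downGroverWalk cylinder 0) ↔ z.re ∈ ({-1 / 5, 0} : Set ℝ) := by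
  rw [← ofReal_mem_image, ← pointSpectrum_edgeDiscriminant']
  exact isWalkPair_edges.mem_pointSpectrum_walkOp_iff hz h1 h2

theorem not_isClosed_range_edgeWalk {z : ℂ} (hz : z ∈ ({Complex.I, -Complex.I} : Set ℂ)) :
    ¬ IsClosed (Set.range fun x => downGroverWalk cylinder 0 x - z • x) := by
  obtain ⟨hz1, h1, h2, hre⟩ := I_facts hz
  refine isWalkPair_edges.not_isClosed_range hz1 h1 h2 fun c => ?_
  obtain ⟨f, hf, hlt⟩ := exists_approx_kernel_edgeDiscriminant c
  refine ⟨f, fun k hk => hf k ?_, ?_⟩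
  · rw [hre, Complex.ofReal_zero, zero_smul] at hk
    exact hk
  · rw [hre, Complex.ofReal_zero, zero_smul, sub_zero]
    exact hlt

end WalkSpectra

end DownWalk

end

theorem proposition5p5 :
    -- the two-dimensional down-discriminant
    (spectrum ℂ (downDiscriminant cylinder 1) =
        Complex.ofReal '' Set.Icc (-1) 1 ∧
      continuousSpectrum (downDiscriminant cylinder 1) =
        Complex.ofReal '' (Set.Icc (-1) 1 \ {0}) ∧
      pointSpectrum (downDiscriminant cylinder 1) = {0}) ∧
    -- the two-dimensional down-Grover walk
    (spectrum ℂ (downGroverWalk cylinder 1) = Metric.sphere 0 1 ∧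
      Metric.sphere 0 1 \ {Complex.I, -Complex.I, 1, -1} ⊆
        continuousSpectrum (downGroverWalk cylinder 1) ∧
      {Complex.I, -Complex.I} ⊆
        pointSpectrum (downGroverWalk cylinder 1)) ∧
    -- the one-dimensional down-discriminant
    (spectrum ℂ (downDiscriminant cylinder 0) =
        Complex.ofReal '' ({-1 / 5, 0} ∪ Set.Ioc (-1 / 5) (7 / 10)) ∧
      continuousSpectrum (downDiscriminant cylinder 0) =
        Complex.ofReal '' (Set.Ioc (-1 / 5) (7 / 10) \ {0}) ∧
      pointSpectrum (downDiscriminant cylinder 0) =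
        Complex.ofReal '' {-1 / 5, 0} ∧
      ¬ IsClosed (Set.range (downDiscriminant cylinder 0))) ∧
    -- the one-dimensional down-Grover walk
    ({z : ℂ | z ∈ Metric.sphere 0 1 ∧ z.re ∈ ({-1 / 5, 0} ∪ Set.Ioc (-1 / 5) (7 / 10) : Set ℝ)} ⊆
        spectrum ℂ (downGroverWalk cylinder 0) ∧
      spectrum ℂ (downGroverWalk cylinder 0) ⊆
        {z : ℂ | z ∈ Metric.sphere 0 1 ∧
          z.re ∈ ({-1 / 5, 0} ∪ Set.Ioc (-1 / 5) (7 / 10) : Set ℝ)} ∪ {1, -1} ∧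
      {z : ℂ | z ∈ Metric.sphere 0 1 ∧ z.re ∈ (Set.Ioc (-1 / 5) (7 / 10) \ {0} : Set ℝ)} ⊆
        continuousSpectrum (downGroverWalk cylinder 0) ∧
      {z : ℂ | z ∈ Metric.sphere 0 1 ∧ z.re ∈ ({-1 / 5, 0} : Set ℝ)} ⊆
        pointSpectrum (downGroverWalk cylinder 0) ∧
      ∀ z ∈ ({Complex.I, -Complex.I} : Set ℂ),
        ¬ IsClosed (Set.range fun x => downGroverWalk cylinder 0 x - z • x)) := by
  refine ⟨⟨spectrum_triangleDiscriminant, continuousSpectrum_triangleDiscriminant,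
      pointSpectrum_triangleDiscriminant⟩,
    ⟨spectrum_triangleWalk, subset_continuousSpectrum_triangleWalk,
      subset_pointSpectrum_triangleWalk⟩,
    ⟨by rw [edgeSpectrum_eq]; exact spectrum_edgeDiscriminant,
      continuousSpectrum_edgeDiscriminant, pointSpectrum_edgeDiscriminant',
      not_isClosed_range_edgeDiscriminant⟩,
    ?_, ?_, ?_, ?_, fun z hz => not_isClosed_range_edgeWalk hz⟩
  · rw [edgeSpectrum_eq]
    rintro z ⟨hz, hre⟩
    obtain ⟨h1, h2⟩ := ne_of_re_mem hre
    exact (mem_spectrum_edgeWalk_iff (norm_eq_one_of_mem_sphere hz) h1 h2).mpr hre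
  · rw [edgeSpectrum_eq]
    intro z hz
    have hs := spectrum_downGroverWalk_subset isWalkPair_edges hz
    by_cases h1 : z = 1
    · exact Or.inr (Or.inl h1)
    by_cases h2 : z = -1
    · exact Or.inr (Or.inr h2)
    exact Or.inl ⟨hs, (mem_spectrum_edgeWalk_iff (norm_eq_one_of_mem_sphere hs) h1 h2).mp hz⟩
  · rintro z ⟨hz, hre⟩
    rw [← edgeSpectrum_diff] at hre
    obtain ⟨h1, h2⟩ := ne_of_re_mem hre.1
    have hz1 := norm_eq_one_of_mem_sphere hz
    rw [continuousSpectrum_eq (T := downGroverWalk cylinder 0)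
      isWalkPair_edges.isStarNormal_walkOp]
    exact ⟨(mem_spectrum_edgeWalk_iff hz1 h1 h2).mpr hre.1,
      fun hp => hre.2 ((mem_pointSpectrum_edgeWalk_iff hz1 h1 h2).mp hp)⟩
  · rintro z ⟨hz, hre⟩
    have hre' : z.re ∈ Set.Icc (-1 / 5 : ℝ) (7 / 10) := by
      rw [← edgeSpectrum_eq]
      exact Or.inl hre
    obtain ⟨h1, h2⟩ := ne_of_re_mem hre'
    exact (mem_pointSpectrum_edgeWalk_iff (norm_eq_one_of_mem_sphere hz) h1 h2).mpr hre
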